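/- Let $n\ge 0$ and let $\varphi(x,y)=\tfrac12 Ax\cdot x+Bx\cdot y+\tfrac12 Cy\cdot y$ be a holomorphic quadratic form on $\mathbf C^n_x\times\mathbf C^n_y$ ($A$, $C$ complex symmetric matrices, $u\cdot v=\sum_j u_jv_j$) with $\det\varphi''_{xy}=\det B\neq 0$ and $\operatorname{Im}\varphi''_{yy}=\operatorname{Im}C>0$. Let $$\Phi(x)=\sup_{y\in\mathbf R^n}\bigl(-\operatorname{Im}\varphi(x,y)\bigr),\qquad \Lambda_\Phi=\Bigl\{\Bigl(x,\tfrac2i\tfrac{\partial\Phi}{\partial x}(x)\Bigr):x\in\mathbf C^n\Bigr\}\subset\mathbf C^{2n},$$ let $L(dx)$ be Lebesgue measure on $\mathbf C^n$, and for $0<h\le 1$ let $H_\Phi(\mathbf C^n)$ be the space of holomorphic functions in $L^2_\Phi=L^2(\mathbf C^n,e^{-2\Phi/h}L(dx))$, with the norm of $L^2_\Phi$. Let $\kappa_T:\mathbf R^{2n}\to\Lambda_\Phi$ be the restriction to $\mathbf R^{2n}$ of the complex canonical transformation $(y,-\varphi'_y(x,y))\mapsto(x,\varphi'_x(x,y))$.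 The metaplectic FBI transform $$Tu(x)=C_0h^{-3n/4}\int_{\mathbf R^n}e^{i\varphi(x,y)/h}u(y)\,dy,\qquad C_0=2^{-n/2}\pi^{-3n/4}(\det\operatorname{Im}\varphi''_{yy})^{-1/4}|\det\varphi''_{xy}|,$$ is a unitary operator $T:L^2(\mathbf R^n)\to H_\Phi(\mathbf C^n)$. Let $a\in S(\Lambda_\Phi)$, that is, $a:\Lambda_\Phi\to\mathbf C$ is $C^\infty$ with all derivatives bounded, when $\Lambda_\Phi$ is identified with $\mathbf C^n$ by the projection $(x,\xi)\mapsto x$. Let $\mathrm{Op}_h^w(a)$ be the unique bounded operator on $H_\Phi(\mathbf C^n)$ such that, for every entire $v$ with $v(x)=O_N(1)\langle x\rangle^{-N}e^{\Phi(x)/h}$ for all $N\geq 0$, $$\mathrm{Op}_h^w(a)v(x)=\frac1{(2\pi h)^n}\iint_{\Gamma(x)}e^{\frac ih(x-y)\cdot\theta}\,a\Bigl(\frac{x+y}2,\theta\Bigr)v(y)\,dy\wedge d\theta,\qquad \Gamma(x):\ \theta=\frac2i\frac{\partial\Phi}{\partial x}\Bigl(\frac{x+y}2\Bigr),\ y\in\mathbf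 C^n,$$ where $\Gamma(x)$ is oriented so that $dy\wedge d\theta$ restricted to it is a positive multiple of $L(dy)$. Then $a\circ\kappa_T$ is a $C^\infty$ function on $\mathbf R^{2n}$ with all derivatives bounded, and $$T^*\,\mathrm{Op}_h^w(a)\,T=\mathrm{Op}_h^w(a\circ\kappa_T)$$ as bounded operators on $L^2(\mathbf R^n)$. Here, for $b\in C^\infty(\mathbf R^{2n})$ with all derivatives bounded, $\mathrm{Op}_h^w(b)$ is the semiclassical Weyl quantization, the unique bounded operator on $L^2(\mathbf R^n)$ such that, for every Schwartz function $u$, $$\mathrm{Op}_h^w(b)u(x)=\frac1{(2\pi h)^n}\int_{\mathbf R^n}\Bigl(\int_{\mathbf R^n}e^{\frac ih(x-y)\cdot\xi}\,b\Bigl(\frac{x+y}2,\xi\Bigr)u(y)\,dy\Bigr)d\xi .$$ The existence and uniqueness of the operators $T$, $\mathrm{Op}_h^w(a)$ and $\mathrm{Op}_h^w(a\circ\kappa_T)$ are part of the statement. -/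

import Mathlib

open MeasureTheory Complex Matrix
open scoped ContDiff SchwartzMap ENNReal

noncomputable section

/-! ### Holomorphic quadratic phases and the associated weight -/

/-- A holomorphic quadratic form
`φ(x, y) = ½ Ax·x + Bx·y + ½ Cy·y` on `ℂⁿ × ℂⁿ` (bilinear dot product, `A`, `C` symmetric) with
`det φ''_{xy} ≠ 0` and `Im φ''_{yy} > 0`. -/
structure FBIPhase (n : ℕ) where
  A : Matrix (Fin n) (Fin n) ℂ
  B : Matrix (Fin n) (Fin n) ℂ
  C : Matrix (Fin n) (Fin n) ℂ
  symmA : A.IsSymm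
  symmC : C.IsSymm
  det_ne_zero : B.det ≠ 0
  im_posDef : (C.map Complex.im).PosDef

/-- The inclusion `ℝⁿ ⊂ ℂⁿ`. -/
def realToComplex {n : ℕ} (y : EuclideanSpace ℝ (Fin n)) : Fin n → ℂ := fun j => (y j : ℂ)

namespace FBIPhase

variable {n : ℕ} (φ : FBIPhase n)

/-- The value `φ(x, y)`. -/
def eval (x y : Fin n → ℂ) : ℂ :=
  (1 / 2) * (φ.A *ᵥ x ⬝ᵥ x) + φ.B *ᵥ x ⬝ᵥ y + (1 / 2) * (φ.C *ᵥ y ⬝ᵥ y)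

/-- The holomorphic gradient `φ'_x(x, y)`. -/
def gradX (x y : Fin n → ℂ) : Fin n → ℂ := φ.A *ᵥ x + φ.Bᵀ *ᵥ y

/-- The holomorphic gradient `φ'_y(x, y)`. -/
def gradY (x y : Fin n → ℂ) : Fin n → ℂ := φ.B *ᵥ x + φ.C *ᵥ y

/-- The weight `Φ(x) = sup_{y ∈ ℝⁿ} (-Im φ(x, y))`. -/
def weight (x : Fin n → ℂ) : ℝ :=
  ⨆ y : EuclideanSpace ℝ (Fin n), -(φ.eval x (realToComplex y)).im

end FBIPhase

/-- `∂f/∂x_j = ½ (∂/∂ Re x_j - i ∂/∂ Im x_j) f` on `ℂⁿ`. -/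
def wirtinger {n : ℕ} (f : (Fin n → ℂ) → ℂ) (j : Fin n) (x : Fin n → ℂ) : ℂ :=
  (1 / 2) * (fderiv ℝ f x (Pi.single j 1) - I * fderiv ℝ f x (Pi.single j I))

/-- `∂f/∂x̄_j = ½ (∂/∂ Re x_j + i ∂/∂ Im x_j) f` on `ℂⁿ`. -/
def wirtingerBar {n : ℕ} (f : (Fin n → ℂ) → ℂ) (j : Fin n) (x : Fin n → ℂ) : ℂ :=
  (1 / 2) * (fderiv ℝ f x (Pi.single j 1) + I * fderiv ℝ f x (Pi.single j I))

namespace FBIPhase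

variable {n : ℕ} (φ : FBIPhase n)

/-- `(2/i) ∂Φ/∂x (x)`. -/
def weightCovector (x : Fin n → ℂ) : Fin n → ℂ :=
  fun j => (2 / I) * wirtinger (fun z => (φ.weight z : ℂ)) j x

/-- The linear manifold `Λ_Φ = {(x, (2/i) ∂Φ/∂x (x)) : x ∈ ℂⁿ} ⊆ ℂ²ⁿ`. -/
def Lambda : Set ((Fin n → ℂ) × (Fin n → ℂ)) :=
  {p | p.2 = φ.weightCovector p.1}

/-- The inverse `ℂⁿ → Λ_Φ` of the projection `Λ_Φ ∋ (x, ξ) ↦ x`. -/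
def lift (x : Fin n → ℂ) : φ.Lambda := ⟨(x, φ.weightCovector x), rfl⟩

/-- The complex canonical transformation
`κ_φ : ℂ²ⁿ ∋ (y, -φ'_y(x, y)) ↦ (x, φ'_x(x, y)) ∈ ℂ²ⁿ`; given `(y, η)`, the point `x` is the unique
solution of `η = -φ'_y(x, y)`. -/
def kappa (p : (Fin n → ℂ) × (Fin n → ℂ)) : (Fin n → ℂ) × (Fin n → ℂ) :=
  let x := -(φ.B⁻¹ *ᵥ (p.2 + φ.C *ᵥ p.1))
  (x, φ.gradX x p.1)

theorem kappa_gradY (x y : Fin n → ℂ) :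
    φ.kappa (y, -φ.gradY x y) = (x, φ.gradX x y) := by
  have hB : IsUnit φ.B.det := isUnit_iff_ne_zero.mpr φ.det_ne_zero
  have : -(φ.B⁻¹ *ᵥ (-φ.gradY x y + φ.C *ᵥ y)) = x := by
    simp [gradY, Matrix.mulVec_neg, Matrix.mulVec_mulVec, Matrix.nonsing_inv_mul _ hB]
  simp only [kappa, this]

theorem gradY_kappa (y η : Fin n → ℂ) : -φ.gradY (φ.kappa (y, η)).1 y = η := by
  have hB : IsUnit φ.B.det := isUnit_iff_ne_zero.mpr φ.det_ne_zero
  simp [gradY, kappa, Matrix.mulVec_neg, Matrix.mulVec_mulVec, Matrix.mul_nonsing_inv _ hB]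

/-! The real points are mapped into `Λ_Φ`. -/

/-- `Im (B x)`. -/
def imB (x : Fin n → ℂ) : Fin n → ℝ := fun j => ((φ.B *ᵥ x) j).im

theorem im_C_symm : (φ.C.map Complex.im).IsSymm := by
  ext i j
  simpa using congrArg Complex.im (φ.symmC.apply i j)

theorem dot_symm {R : Type*} [CommRing R] {M : Matrix (Fin n) (Fin n) R} (hM : M.IsSymm)
    (u v : Fin n → R) : M *ᵥ u ⬝ᵥ v = M *ᵥ v ⬝ᵥ u := by
  rw [dotProduct_comm, dotProduct_mulVec, ← mulVec_transpose, hM.eq]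

theorem im_eval (x : Fin n → ℂ) (y : EuclideanSpace ℝ (Fin n)) :
    (φ.eval x (realToComplex y)).im =
      (1 / 2) * (φ.A *ᵥ x ⬝ᵥ x).im + φ.imB x ⬝ᵥ y.ofLp
        + (1 / 2) * ((φ.C.map Complex.im) *ᵥ y.ofLp ⬝ᵥ y.ofLp) := by
  have h1 : (φ.B *ᵥ x ⬝ᵥ realToComplex y).im = φ.imB x ⬝ᵥ y.ofLp := by
    simp [dotProduct, imB, realToComplex, Complex.im_sum, Complex.mul_im]
  have h2 : (φ.C *ᵥ realToComplex y ⬝ᵥ realToComplex y).im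
      = (φ.C.map Complex.im) *ᵥ y.ofLp ⬝ᵥ y.ofLp := by
    simp [dotProduct, mulVec, realToComplex, Complex.im_sum, Complex.mul_im]
  have hhalf : ∀ z : ℂ, ((1 / 2 : ℂ) * z).im = (1 / 2) * z.im := by
    intro z
    have : (1 / 2 : ℂ) = ((1 / 2 : ℝ) : ℂ) := by norm_num
    rw [this, Complex.im_ofReal_mul]
  simp only [eval, Complex.add_im, hhalf, h1, h2]

theorem weight_eq (x : Fin n → ℂ) :
    φ.weight x = -(1 / 2) * (φ.A *ᵥ x ⬝ᵥ x).im
      + (1 / 2) * ((φ.C.map Complex.im)⁻¹ *ᵥ φ.imB x ⬝ᵥ φ.imB x) := by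
  set M := φ.C.map Complex.im with hM
  set b := φ.imB x with hb
  have hdet : IsUnit M.det := (Matrix.isUnit_iff_isUnit_det M).mp φ.im_posDef.isUnit
  have hMM : M *ᵥ (M⁻¹ *ᵥ b) = b := by
    simp [Matrix.mulVec_mulVec, Matrix.mul_nonsing_inv _ hdet]
  have key : ∀ y : EuclideanSpace ℝ (Fin n), -(φ.eval x (realToComplex y)).im =
      -(1 / 2) * (φ.A *ᵥ x ⬝ᵥ x).im + (1 / 2) * (M⁻¹ *ᵥ b ⬝ᵥ b)
        - (1 / 2) * (M *ᵥ (y.ofLp + M⁻¹ *ᵥ b) ⬝ᵥ (y.ofLp + M⁻¹ *ᵥ b)) := by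
    intro y
    rw [im_eval, ← hM, ← hb]
    have e1 : M *ᵥ y.ofLp ⬝ᵥ (M⁻¹ *ᵥ b) = b ⬝ᵥ y.ofLp := by
      rw [dot_symm φ.im_C_symm, hMM]
    rw [mulVec_add, add_dotProduct, dotProduct_add, dotProduct_add, hMM, e1,
      dotProduct_comm b (M⁻¹ *ᵥ b)]
    ring
  have hle : ∀ y : EuclideanSpace ℝ (Fin n), -(φ.eval x (realToComplex y)).im ≤
      -(1 / 2) * (φ.A *ᵥ x ⬝ᵥ x).im + (1 / 2) * (M⁻¹ *ᵥ b ⬝ᵥ b) := by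
    intro y
    rw [key y]
    have h0 := φ.im_posDef.posSemidef.dotProduct_mulVec_nonneg (y.ofLp + M⁻¹ *ᵥ b)
    rw [star_trivial, dotProduct_comm] at h0
    linarith
  refine le_antisymm (ciSup_le hle) ?_
  have h1 := le_ciSup (f := fun y : EuclideanSpace ℝ (Fin n) =>
    -(φ.eval x (realToComplex y)).im) ⟨_, Set.forall_mem_range.mpr hle⟩
    (WithLp.toLp 2 (-(M⁻¹ *ᵥ b)))
  refine le_trans (le_of_eq ?_) h1
  simp only [key]
  simp

theorem imB_add (x v : Fin n → ℂ) : φ.imB (x + v) = φ.imB x + φ.imB v := by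
  ext j; simp [imB, mulVec_add]

theorem imB_smul (t : ℝ) (v : Fin n → ℂ) : φ.imB (t • v) = t • φ.imB v := by
  ext j; simp [imB, mulVec_smul]

theorem weight_add_smul (x v : Fin n → ℂ) (t : ℝ) :
    φ.weight (x + t • v) = φ.weight x
      + t * (-(φ.A *ᵥ x ⬝ᵥ v).im + ((φ.C.map Complex.im)⁻¹ *ᵥ φ.imB x ⬝ᵥ φ.imB v))
      + t ^ 2 * φ.weight v := by
  have hsymm : ((φ.C.map Complex.im)⁻¹).IsSymm := by
    rw [Matrix.IsSymm, Matrix.transpose_nonsing_inv, φ.im_C_symm.eq]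
  have hA : φ.A *ᵥ v ⬝ᵥ x = φ.A *ᵥ x ⬝ᵥ v := dot_symm φ.symmA _ _
  have hM := dot_symm hsymm (φ.imB v) (φ.imB x)
  simp only [weight_eq, imB_add, imB_smul, mulVec_add, mulVec_smul, add_dotProduct,
    dotProduct_add, smul_dotProduct, dotProduct_smul, hA, hM, Complex.add_im, Complex.smul_im,
    smul_eq_mul]
  ring

theorem differentiable_weight : Differentiable ℝ φ.weight := by
  have h : φ.weight = fun x => -(1 / 2) * (φ.A *ᵥ x ⬝ᵥ x).im
      + (1 / 2) * ((φ.C.map Complex.im)⁻¹ *ᵥ φ.imB x ⬝ᵥ φ.imB x) := funext φ.weight_eq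
  have him : ∀ f : (Fin n → ℂ) → ℂ, Differentiable ℝ f → Differentiable ℝ fun x => (f x).im :=
    fun f hf => Complex.imCLM.differentiable.comp hf
  have hb : ∀ j, Differentiable ℝ fun x => φ.imB x j := by
    intro j
    refine him _ ?_
    simp only [mulVec, dotProduct]
    fun_prop
  rw [h]
  refine Differentiable.add (Differentiable.const_mul (him _ ?_) _)
    (Differentiable.const_mul ?_ _)
  · simp only [mulVec, dotProduct]
    fun_prop
  · simp only [mulVec, dotProduct]
    fun_prop

theorem fderiv_weight (x v : Fin n → ℂ) :
    fderiv ℝ (fun z => (φ.weight z : ℂ)) x v =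
      ((-(φ.A *ᵥ x ⬝ᵥ v).im
        + ((φ.C.map Complex.im)⁻¹ *ᵥ φ.imB x ⬝ᵥ φ.imB v) : ℝ) : ℂ) := by
  have hd : HasFDerivAt (fun z => (φ.weight z : ℂ))
      (Complex.ofRealCLM.comp (fderiv ℝ φ.weight x)) x :=
    Complex.ofRealCLM.hasFDerivAt.comp x (φ.differentiable_weight x).hasFDerivAt
  rw [hd.fderiv, ContinuousLinearMap.comp_apply, Complex.ofRealCLM_apply]
  congr 1
  rw [← (φ.differentiable_weight x).lineDeriv_eq_fderiv]
  refine HasLineDerivAt.lineDeriv ?_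
  rw [HasLineDerivAt]
  simp only [weight_add_smul]
  set L := -(φ.A *ᵥ x ⬝ᵥ v).im + ((φ.C.map Complex.im)⁻¹ *ᵥ φ.imB x ⬝ᵥ φ.imB v)
  have h1 := (((hasDerivAt_id (0 : ℝ)).mul_const L).const_add (φ.weight x)).add
    (((hasDerivAt_id (0 : ℝ)).pow 2).mul_const (φ.weight v))
  exact h1.congr_deriv (by simp)

theorem kappa_mem_Lambda (y η : EuclideanSpace ℝ (Fin n)) :
    φ.kappa (realToComplex y, realToComplex η) ∈ φ.Lambda := by
  set x := (φ.kappa (realToComplex y, realToComplex η)).1 with hx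
  have hη := φ.gradY_kappa (realToComplex y) (realToComplex η)
  rw [← hx] at hη
  have hdet : IsUnit (φ.C.map Complex.im).det :=
    (Matrix.isUnit_iff_isUnit_det _).mp φ.im_posDef.isUnit
  have hcrit : φ.imB x = -((φ.C.map Complex.im) *ᵥ y.ofLp) := by
    ext j
    have h1 := congrArg Complex.im (congrFun hη j)
    have h2 : ((φ.C *ᵥ realToComplex y) j).im = ((φ.C.map Complex.im) *ᵥ y.ofLp) j := by
      simp [mulVec, dotProduct, realToComplex, Complex.im_sum, Complex.mul_im]
    have h3 : (realToComplex η j).im = 0 := by simp [realToComplex]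
    simp only [gradY, Pi.neg_apply, Pi.add_apply, Complex.neg_im, Complex.add_im, h2, h3] at h1
    simp only [imB, Pi.neg_apply]
    linarith
  have hinv : (φ.C.map Complex.im)⁻¹ *ᵥ φ.imB x = -y.ofLp := by
    rw [hcrit]
    simp [mulVec_neg, Matrix.mulVec_mulVec, Matrix.nonsing_inv_mul _ hdet]
  have hD : ∀ v, fderiv ℝ (fun z => (φ.weight z : ℂ)) x v =
      ((-(φ.gradX x (realToComplex y) ⬝ᵥ v).im : ℝ) : ℂ) := by
    intro v
    rw [fderiv_weight, hinv]
    congr 1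
    have h1 : (φ.Bᵀ *ᵥ realToComplex y ⬝ᵥ v).im = y.ofLp ⬝ᵥ φ.imB v := by
      rw [mulVec_transpose, ← dotProduct_mulVec]
      simp [dotProduct, imB, realToComplex, Complex.im_sum, Complex.mul_im]
    simp only [gradX, add_dotProduct, Complex.add_im, h1, neg_dotProduct]
    ring
  change φ.gradX x (realToComplex y) = φ.weightCovector x
  ext j
  simp only [weightCovector, wirtinger, hD, dotProduct_single, mul_one]
  generalize φ.gradX x (realToComplex y) j = z
  apply Complex.ext <;> simp

/-- The canonical transformation `κ_T : ℝ²ⁿ → Λ_Φ` associated with the transform: the restriction of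
`κ_φ` to the real phase space. -/
def kappaT (p : EuclideanSpace ℝ (Fin n) × EuclideanSpace ℝ (Fin n)) : φ.Lambda :=
  ⟨φ.kappa (realToComplex p.1, realToComplex p.2), φ.kappa_mem_Lambda p.1 p.2⟩

end FBIPhase

/-! ### Symbol classes -/

/-- `C^∞` functions on a real normed space all of whose derivatives are bounded. -/
def IsBoundedSymbol {E : Type*} [NormedAddCommGroup E] [NormedSpace ℝ E] (f : E → ℂ) : Prop :=
  ContDiff ℝ ∞ f ∧ ∀ k : ℕ, ∃ K : ℝ, ∀ p, ‖iteratedFDeriv ℝ k f p‖ ≤ K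

/-- The class `S(Λ_Φ)`, with `Λ_Φ` identified with `ℂⁿ` through the projection `(x, ξ) ↦ x`. -/
def FBIPhase.IsSymbol {n : ℕ} (φ : FBIPhase n) (a : φ.Lambda → ℂ) : Prop :=
  IsBoundedSymbol fun x => a (φ.lift x)

/-! ### Function spaces and the transform -/

/-- `L²(ℝⁿ)`. -/
abbrev L2Real (n : ℕ) : Type :=
  Lp ℂ 2 (volume : Measure (EuclideanSpace ℝ (Fin n)))

namespace FBIPhase

variable {n : ℕ} (φ : FBIPhase n) (h : ℝ)

/-- The measure `e^{-2Φ(x)/h} L(dx)` on `ℂⁿ`. -/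
def weightMeasure : Measure (Fin n → ℂ) :=
  volume.withDensity fun x => ENNReal.ofReal (Real.exp (-2 * φ.weight x / h))

/-- `L²_Φ(ℂⁿ) = L²(ℂⁿ, e^{-2Φ/h} L(dx))`. -/
abbrev L2Weight : Type := Lp ℂ 2 (φ.weightMeasure h)

/-- `H_Φ(ℂⁿ) = L²_Φ(ℂⁿ) ∩ Hol(ℂⁿ)`, with the norm of `L²_Φ(ℂⁿ)`. -/
def HPhi : Submodule ℂ (φ.L2Weight h) where
  carrier := {f | ∃ g : (Fin n → ℂ) → ℂ, Differentiable ℂ g ∧ f =ᵐ[φ.weightMeasure h] g}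
  zero_mem' := ⟨0, differentiable_const 0, Lp.coeFn_zero _ _ _⟩
  add_mem' := by
    rintro f₁ f₂ ⟨g₁, d₁, e₁⟩ ⟨g₂, d₂, e₂⟩
    exact ⟨g₁ + g₂, d₁.add d₂, (Lp.coeFn_add f₁ f₂).trans (e₁.add e₂)⟩
  smul_mem' := by
    rintro c f ⟨g, d, e⟩
    exact ⟨c • g, d.const_smul c, (Lp.coeFn_smul c f).trans (e.const_smul c)⟩

/-- The normalizing constant
`C = 2^{-n/2} π^{-3n/4} (det Im φ''_{yy})^{-1/4} |det φ''_{xy}| > 0` that makes the transform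
unitary. -/
def normConst : ℝ :=
  (2 : ℝ) ^ (-(n : ℝ) / 2) * Real.pi ^ (-3 * (n : ℝ) / 4)
    * (φ.C.map Complex.im).det ^ (-(1 / 4) : ℝ) * ‖φ.B.det‖

/-- `Tu(x; h) = C h^{-3n/4} ∫_{ℝⁿ} e^{iφ(x, y)/h} u(y) dy`. -/
def fbiIntegral (u : EuclideanSpace ℝ (Fin n) → ℂ) (x : Fin n → ℂ) : ℂ :=
  (φ.normConst : ℂ) * ((h ^ (-3 * (n : ℝ) / 4) : ℝ) : ℂ) *
    ∫ y : EuclideanSpace ℝ (Fin n), Complex.exp (I * φ.eval x (realToComplex y) / h) * u y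

/-- `T` is the metaplectic FBI transform, as a unitary map `L²(ℝⁿ) → H_Φ(ℂⁿ)`. -/
def IsFBITransform (T : L2Real n ≃ₗᵢ[ℂ] φ.HPhi h) : Prop :=
  ∀ u : L2Real n, (T u : φ.L2Weight h) =ᵐ[φ.weightMeasure h] φ.fbiIntegral h u

/-! ### Weyl quantization on the transform side -/

/-- `θ = (2/i) ∂Φ/∂x ((x + y)/2)`: the contour `Γ(x)`, parametrized by `y ∈ ℂⁿ`. -/
def contourTheta (x y : Fin n → ℂ) : Fin n → ℂ :=
  φ.weightCovector ((1 / 2 : ℂ) • (x + y))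

/-- The density of `dy ∧ dθ` along `Γ(x)` with respect to Lebesgue measure `L(dy)`, for the
orientation that makes it positive: the pull-back of `dy ∧ dθ` is
`det (∂θ_j/∂ȳ_k) dy ∧ dȳ`, and `dy ∧ dȳ` has modulus `2ⁿ L(dy)`. -/
def contourDensity (x y : Fin n → ℂ) : ℝ :=
  2 ^ n * ‖(Matrix.of fun j k : Fin n => wirtingerBar (fun w => φ.contourTheta x w j) k y).det‖

/-- The Weyl quantization on the transform side,
`Op_h^w(a)v(x) = (2πh)^{-n} ∬_{Γ(x)} e^{i(x-y)·θ/h} a((x+y)/2, θ) v(y) dy ∧ dθ`. -/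
def opIntegral (a : φ.Lambda → ℂ) (v : (Fin n → ℂ) → ℂ) (x : Fin n → ℂ) : ℂ :=
  (1 / (2 * Real.pi * h) ^ n : ℂ) *
    ∫ y : Fin n → ℂ, Complex.exp (I / h * ((x - y) ⬝ᵥ φ.contourTheta x y))
      * a (φ.lift ((1 / 2 : ℂ) • (x + y))) * v y * φ.contourDensity x y

/-- Entire functions `v` with `v = O_N(⟨x⟩^{-N}) e^{Φ(x)/h}` for all `N`. -/
def IsRapidlyDecreasing (v : (Fin n → ℂ) → ℂ) : Prop :=
  Differentiable ℂ v ∧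
    ∀ N : ℕ, ∃ K : ℝ, ∀ x, (1 + ‖x‖) ^ N * ‖v x‖ ≤ K * Real.exp (φ.weight x / h)

/-- `A` is a bounded operator on `H_Φ(ℂⁿ)` extending `Op_h^w(a)` from the rapidly decreasing
functions. -/
def IsWeylOp (a : φ.Lambda → ℂ) (A : φ.HPhi h →L[ℂ] φ.HPhi h) : Prop :=
  ∀ (f : φ.HPhi h) (v : (Fin n → ℂ) → ℂ), φ.IsRapidlyDecreasing h v →
    (f : φ.L2Weight h) =ᵐ[φ.weightMeasure h] v →
      (A f : φ.L2Weight h) =ᵐ[φ.weightMeasure h] φ.opIntegral h a v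

end FBIPhase

/-! ### Semiclassical Weyl quantization on `ℝⁿ` -/

/-- `Op_h^w(b)u(x) = (2πh)^{-n} ∬ e^{i(x-y)·ξ/h} b((x+y)/2, ξ) u(y) dy dξ`, as an iterated integral
(for `b` bounded with all its derivatives and `u` a Schwartz function, the inner integral converges
absolutely and is rapidly decreasing in `ξ`). -/
def weylIntegral {n : ℕ} (h : ℝ)
    (b : EuclideanSpace ℝ (Fin n) × EuclideanSpace ℝ (Fin n) → ℂ)
    (u : EuclideanSpace ℝ (Fin n) → ℂ) (x : EuclideanSpace ℝ (Fin n)) : ℂ :=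
  (1 / (2 * Real.pi * h) ^ n : ℂ) *
    ∫ ξ : EuclideanSpace ℝ (Fin n), ∫ y : EuclideanSpace ℝ (Fin n),
      Complex.exp (I / h * (inner ℝ (x - y) ξ : ℝ)) * b ((1 / 2 : ℝ) • (x + y), ξ) * u y

/-- `Q` is a bounded operator on `L²(ℝⁿ)` extending `Op_h^w(b)` from the Schwartz functions. -/
def IsRealWeylOp {n : ℕ} (h : ℝ)
    (b : EuclideanSpace ℝ (Fin n) × EuclideanSpace ℝ (Fin n) → ℂ)
    (Q : L2Real n →L[ℂ] L2Real n) : Prop :=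
  ∀ u : 𝓢(EuclideanSpace ℝ (Fin n), ℂ), Q (u.toLp 2) =ᵐ[volume] weylIntegral h b u

namespace FBIPhase

variable {n : ℕ} (φ : FBIPhase n) (h : ℝ)

/-- `T` as a bounded operator `L²(ℝⁿ) → L²_Φ(ℂⁿ)` between Hilbert spaces. -/
def toL2Weight (T : L2Real n ≃ₗᵢ[ℂ] φ.HPhi h) : L2Real n →L[ℂ] φ.L2Weight h :=
  (φ.HPhi h).subtypeL ∘L (T.toContinuousLinearEquiv : L2Real n →L[ℂ] φ.HPhi h)

/-- `T* : H_Φ(ℂⁿ) → L²(ℝⁿ)`, the Hilbert space adjoint of `T` restricted to `H_Φ(ℂⁿ)`. -/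
def fbiAdjoint (T : L2Real n ≃ₗᵢ[ℂ] φ.HPhi h) : φ.HPhi h →L[ℂ] L2Real n :=
  ContinuousLinearMap.adjoint (φ.toL2Weight h T) ∘L (φ.HPhi h).subtypeL

end FBIPhase

end

noncomputable section

/-! Both Weyl quantizations are superpositions of reflections. With the midpoint $s=(x+y)/2$ as
variable, the contour integral becomes an integral over $s$ of $a(s)$ times the operator $v\mapsto
e^{i(x-y)\cdot\theta/h}v(y)$, $y=2s-x$; the real Weyl integral is likewise an integral over
$(s,\xi)$ of real reflections. Because $\varphi$ is quadratic, the FBI kernel intertwines the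
reflection at $(s,\xi)$ exactly with the one at the base point `basePt s ξ` of $\kappa_T(s,\xi)$:
this is the phase identity `contour_phase_add_eval`. The map `basePt` is a real linear isomorphism
with constant Jacobian (`integral_basePt`), so $T\,\mathrm{Op}(a\circ\kappa_T)u=\mathrm{Op}(a)Tu$
for Schwartz $u$ (`fbiIntegral_weylIntegral`).

Unitarity of $T$ rests on the splitting of $\Phi$ into a pluriharmonic part and a positive Hermitian
form. The polarized kernel `cohKer` reproduces holomorphic functions, by the mean value property
under rotations (`integral_cohKer_mul`), and it is also the Gram matrix of the coherent states
$\overline{e^{i\varphi(x,\cdot)/h}}$, by a Gaussian integral. Sending coherent states to reproducing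
kernels is therefore isometric after the normalization `fbiScale_sq_mul`; density of coherent states
is Fourier injectivity, and surjectivity is the reproducing formula.

Boundedness is proved on the transform side only. Inserting the reproducing formula into the contour
integral gives a kernel `weylKer`, which is the Fourier transform of a symbol times a Gaussian at
frequency $(x-z)/2$. It decays rapidly off the diagonal relative to $e^{(\Phi(x)+\Phi(z))/h}$, so
Schur's test yields an operator $A$ on $L^2_\Phi$. The operator $Q=T^*AT$ satisfies
$T(Qu)=\mathrm{Op}(a)(Tu)$ pointwise (`exists_transported_operator`); by the intertwining and
injectivity of the FBI integral it is the real Weyl operator, while $TQT^{-1}$ is the one on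
$H_\Phi$. Uniqueness on both sides is density. -/

theorem exists_pos_mul_norm_sq_le {E : Type*} [NormedAddCommGroup E] [NormedSpace ℝ E]
    [FiniteDimensional ℝ E] {q : E → ℝ} (hq : Continuous q)
    (hom : ∀ (t : ℝ) x, q (t • x) = t ^ 2 * q x) (pos : ∀ x, x ≠ 0 → 0 < q x) :
    ∃ c > 0, ∀ x, c * ‖x‖ ^ 2 ≤ q x := by
  have h0 : q 0 = 0 := by simpa using hom 0 0
  -- The sphere is empty when `E` is trivial, which happens for $n=0$; any constant then serves.
  rcases (Metric.sphere (0 : E) 1).eq_empty_or_nonempty with he | hne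
  · refine ⟨1, one_pos, fun x => ?_⟩
    have hx : x = 0 := by
      by_contra hx
      have : (‖x‖⁻¹ • x) ∈ Metric.sphere (0 : E) 1 := by
        simp [norm_smul, norm_ne_zero_iff.mpr hx]
      rw [he] at this
      exact this
    simp [hx, h0]
  · obtain ⟨x₀, hx₀, hmin⟩ := (isCompact_sphere (0 : E) 1).exists_isMinOn hne hq.continuousOn
    have hx₀' : x₀ ≠ 0 := by
      rintro rfl
      simp at hx₀
    refine ⟨q x₀, pos x₀ hx₀', fun x => ?_⟩
    rcases eq_or_ne x 0 with rfl | hx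
    · simp [h0]
    have hn : ‖x‖ ≠ 0 := norm_ne_zero_iff.mpr hx
    have hm : q x₀ ≤ q (‖x‖⁻¹ • x) := hmin (by simp [norm_smul, hn])
    rw [hom, inv_pow] at hm
    calc q x₀ * ‖x‖ ^ 2 ≤ ((‖x‖ ^ 2)⁻¹ * q x) * ‖x‖ ^ 2 := by gcongr
      _ = q x := by field_simp

theorem Matrix.PosDef.pos_dot {n : ℕ} {M : Matrix (Fin n) (Fin n) ℝ} (hM : M.PosDef)
    {x : Fin n → ℝ} (hx : x ≠ 0) : 0 < M *ᵥ x ⬝ᵥ x := by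
  have := hM.dotProduct_mulVec_pos hx
  rwa [star_trivial, dotProduct_comm] at this

theorem Matrix.PosDef.nonneg_dot {n : ℕ} {M : Matrix (Fin n) (Fin n) ℝ} (hM : M.PosDef)
    (x : Fin n → ℝ) : 0 ≤ M *ᵥ x ⬝ᵥ x := by
  have := hM.posSemidef.dotProduct_mulVec_nonneg x
  rwa [star_trivial, dotProduct_comm] at this

/-! ### Pluriharmonic and Hermitian parts of the weight. -/

namespace FBIPhase

variable {n : ℕ} (φ : FBIPhase n)

/-- `Im φ''_{yy}`. -/
def imC : Matrix (Fin n) (Fin n) ℝ := φ.C.map Complex.im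

/-- `(Im φ''_{yy})⁻¹` as a complex matrix. -/
def minv : Matrix (Fin n) (Fin n) ℂ := (φ.imC⁻¹).map ofReal

/-- The Hermitian part `4 ∑ Φ''_{x x̄} z w̄` of the weight. -/
def herm (z w : Fin n → ℂ) : ℂ := φ.minv *ᵥ (φ.B *ᵥ z) ⬝ᵥ star (φ.B *ᵥ w)

/-- The holomorphic quadratic form whose real part is the pluriharmonic part of the weight. -/
def hol (z w : Fin n → ℂ) : ℂ :=
  I / 2 * (φ.A *ᵥ z ⬝ᵥ w) - 1 / 4 * (φ.minv *ᵥ (φ.B *ᵥ z) ⬝ᵥ φ.B *ᵥ w)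

theorem isUnit_det_imC : IsUnit φ.imC.det :=
  (Matrix.isUnit_iff_isUnit_det _).mp φ.im_posDef.isUnit

theorem imC_posDef : φ.imC.PosDef := φ.im_posDef

theorem imC_inv_posDef : (φ.imC⁻¹).PosDef := φ.im_posDef.inv

theorem imC_inv_symm : (φ.imC⁻¹).IsSymm := by
  rw [Matrix.IsSymm, Matrix.transpose_nonsing_inv, imC, φ.im_C_symm.eq]

theorem minv_symm : φ.minv.IsSymm := φ.imC_inv_symm.map _

theorem herm_add_left (z z' w : Fin n → ℂ) : φ.herm (z + z') w = φ.herm z w + φ.herm z' w := by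
  simp [herm, mulVec_add, add_dotProduct]

theorem herm_add_right (z w w' : Fin n → ℂ) : φ.herm z (w + w') = φ.herm z w + φ.herm z w' := by
  simp [herm, mulVec_add, dotProduct_add]

theorem herm_smul_left (c : ℂ) (z w : Fin n → ℂ) : φ.herm (c • z) w = c * φ.herm z w := by
  simp [herm, mulVec_smul]

theorem herm_smul_right (c : ℂ) (z w : Fin n → ℂ) :
    φ.herm z (c • w) = star c * φ.herm z w := by
  simp [herm, mulVec_smul]

theorem herm_neg_left (z w : Fin n → ℂ) : φ.herm (-z) w = -φ.herm z w := by
  simp [herm, mulVec_neg]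

theorem herm_neg_right (z w : Fin n → ℂ) : φ.herm z (-w) = -φ.herm z w := by
  simp [herm, mulVec_neg]

theorem herm_sub_left (z z' w : Fin n → ℂ) : φ.herm (z - z') w = φ.herm z w - φ.herm z' w := by
  rw [sub_eq_add_neg, herm_add_left, herm_neg_left, sub_eq_add_neg]

theorem herm_sub_right (z w w' : Fin n → ℂ) : φ.herm z (w - w') = φ.herm z w - φ.herm z w' := by
  rw [sub_eq_add_neg, herm_add_right, herm_neg_right, sub_eq_add_neg]

theorem star_minv_mulVec (u : Fin n → ℂ) : star (φ.minv *ᵥ u) = φ.minv *ᵥ star u := by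
  ext j
  simp [mulVec, dotProduct, minv]

theorem star_herm (z w : Fin n → ℂ) : star (φ.herm z w) = φ.herm w z := by
  rw [herm, ← star_dotProduct_star, star_star, star_minv_mulVec, dotProduct_comm,
    dot_symm φ.minv_symm, dotProduct_comm]
  exact dotProduct_comm _ _

theorem conj_herm (z w : Fin n → ℂ) : (starRingEnd ℂ) (φ.herm z w) = φ.herm w z := φ.star_herm z w

theorem hol_add_left (z z' w : Fin n → ℂ) : φ.hol (z + z') w = φ.hol z w + φ.hol z' w := by
  simp only [hol, mulVec_add, add_dotProduct]
  ring

theorem hol_symm (z w : Fin n → ℂ) : φ.hol z w = φ.hol w z := by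
  rw [hol, hol, dot_symm φ.symmA, dot_symm φ.minv_symm]

theorem hol_add_right (z w w' : Fin n → ℂ) : φ.hol z (w + w') = φ.hol z w + φ.hol z w' := by
  rw [hol_symm, hol_add_left, hol_symm, φ.hol_symm z w']

theorem hol_smul_left (c : ℂ) (z w : Fin n → ℂ) : φ.hol (c • z) w = c * φ.hol z w := by
  simp only [hol, mulVec_smul, smul_dotProduct, smul_eq_mul]
  ring

theorem hol_smul_right (c : ℂ) (z w : Fin n → ℂ) : φ.hol z (c • w) = c * φ.hol z w := by
  rw [hol_symm, hol_smul_left, hol_symm]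

theorem hol_neg_left (z w : Fin n → ℂ) : φ.hol (-z) w = -φ.hol z w := by
  rw [← neg_one_smul ℂ, hol_smul_left, neg_one_mul]

theorem hol_neg_right (z w : Fin n → ℂ) : φ.hol z (-w) = -φ.hol z w := by
  rw [hol_symm, hol_neg_left, hol_symm]

theorem hol_sub_left (z z' w : Fin n → ℂ) : φ.hol (z - z') w = φ.hol z w - φ.hol z' w := by
  rw [sub_eq_add_neg, hol_add_left, hol_neg_left, sub_eq_add_neg]

theorem hol_sub_right (z w w' : Fin n → ℂ) : φ.hol z (w - w') = φ.hol z w - φ.hol z w' := by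
  rw [sub_eq_add_neg, hol_add_right, hol_neg_right, sub_eq_add_neg]

@[fun_prop]
theorem differentiable_herm_left (w : Fin n → ℂ) : Differentiable ℂ fun z => φ.herm z w := by
  simp only [herm, mulVec, dotProduct]
  fun_prop

@[fun_prop]
theorem differentiable_hol_left (w : Fin n → ℂ) : Differentiable ℂ fun z => φ.hol z w := by
  simp only [hol, mulVec, dotProduct]
  fun_prop

@[fun_prop]
theorem differentiable_hol_self : Differentiable ℂ fun z => φ.hol z z := by
  simp only [hol, mulVec, dotProduct]
  fun_prop

theorem differentiable_herm_right (z : Fin n → ℂ) : Differentiable ℝ fun w => φ.herm z w := by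
  have h : (fun w => φ.herm z w) = fun w => conjCLE (φ.herm w z) := by
    funext w
    exact (φ.conj_herm w z).symm
  rw [h]
  exact conjCLE.differentiable.comp ((φ.differentiable_herm_left z).restrictScalars ℝ)

@[fun_prop]
theorem continuous_herm {X : Type*} [TopologicalSpace X] {f g : X → Fin n → ℂ}
    (hf : Continuous f) (hg : Continuous g) : Continuous fun x => φ.herm (f x) (g x) := by
  have h : ∀ u : X → Fin n → ℂ, Continuous u → Continuous fun x => φ.B *ᵥ u x := fun u hu =>
    continuous_const.matrix_mulVec hu
  exact (continuous_const.matrix_mulVec (h f hf)).dotProduct (h g hg).star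

@[fun_prop]
theorem continuous_hol {X : Type*} [TopologicalSpace X] {f g : X → Fin n → ℂ}
    (hf : Continuous f) (hg : Continuous g) : Continuous fun x => φ.hol (f x) (g x) := by
  simp only [hol, mulVec, dotProduct]
  fun_prop

/-- `Re (B x)`. -/
def reB (x : Fin n → ℂ) : Fin n → ℝ := fun j => ((φ.B *ᵥ x) j).re

theorem B_mulVec_eq (x : Fin n → ℂ) (j : Fin n) :
    (φ.B *ᵥ x) j = (φ.reB x j : ℂ) + (φ.imB x j : ℂ) * I := (re_add_im _).symm

theorem herm_re (z w : Fin n → ℂ) : (φ.herm z w).re =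
    φ.imC⁻¹ *ᵥ φ.reB z ⬝ᵥ φ.reB w + φ.imC⁻¹ *ᵥ φ.imB z ⬝ᵥ φ.imB w := by
  simp only [herm, minv, mulVec, dotProduct, Pi.star_apply, Complex.star_def, re_sum, mul_re,
    im_sum, mul_im, conj_re, conj_im, map_apply, ofReal_re, ofReal_im, zero_mul, sub_zero,
    add_zero, ← Finset.sum_add_distrib, reB, imB]
  refine Finset.sum_congr rfl fun i _ => ?_
  ring

theorem minv_dot_re (z w : Fin n → ℂ) : (φ.minv *ᵥ (φ.B *ᵥ z) ⬝ᵥ φ.B *ᵥ w).re =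
    φ.imC⁻¹ *ᵥ φ.reB z ⬝ᵥ φ.reB w - φ.imC⁻¹ *ᵥ φ.imB z ⬝ᵥ φ.imB w := by
  simp only [minv, mulVec, dotProduct, re_sum, mul_re,
    im_sum, mul_im, map_apply, ofReal_re, ofReal_im, zero_mul, sub_zero,
    add_zero, ← Finset.sum_sub_distrib, reB, imB]

theorem herm_self_im (z : Fin n → ℂ) : (φ.herm z z).im = 0 := by
  have := congrArg im (φ.star_herm z z)
  simp only [Complex.star_def, conj_im] at this
  linarith

theorem herm_self_eq (z : Fin n → ℂ) : φ.herm z z = ((φ.herm z z).re : ℂ) := by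
  apply Complex.ext <;> simp [herm_self_im]

theorem hol_re (z w : Fin n → ℂ) : (φ.hol z w).re = -(1 / 2) * (φ.A *ᵥ z ⬝ᵥ w).im -
    1 / 4 * (φ.imC⁻¹ *ᵥ φ.reB z ⬝ᵥ φ.reB w - φ.imC⁻¹ *ᵥ φ.imB z ⬝ᵥ φ.imB w) := by
  rw [← minv_dot_re, hol, sub_re, mul_re, mul_re]
  simp

/-- The form $M^{-1}\operatorname{Im}Bx\cdot\operatorname{Im}Bx$, $M=\operatorname{Im}C$, is half
the difference of its Hermitian and complex bilinear versions. The pluriharmonic term cancels from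
every estimate relative to the weight; the Hermitian term governs all decay. -/
theorem weight_eq_hol_herm (x : Fin n → ℂ) :
    φ.weight x = (φ.hol x x).re + 1 / 4 * (φ.herm x x).re := by
  rw [weight_eq, hol_re, herm_re, imC]
  ring

theorem fderiv_weight_eq (x v : Fin n → ℂ) :
    fderiv ℝ (fun z => (φ.weight z : ℂ)) x v =
      (((2 * φ.hol x v + 1 / 2 * φ.herm v x).re : ℝ) : ℂ) := by
  have h : (φ.herm v x).re = (φ.herm x v).re := by
    rw [← φ.star_herm x v]; simp
  rw [fderiv_weight]
  congr 1
  have h2 : ((1 / 2 : ℂ) * φ.herm v x).re = 1 / 2 * (φ.herm v x).re := by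
    rw [mul_re]; simp
  have h3 : ((2 : ℂ) * φ.hol x v).re = 2 * (φ.hol x v).re := by
    rw [mul_re]; simp
  rw [add_re, h2, h3, h, hol_re, herm_re, imC]
  ring

theorem weightCovector_apply (x : Fin n → ℂ) (j : Fin n) :
    φ.weightCovector x j = -I * (2 * φ.hol x (Pi.single j 1) + 1 / 2 * φ.herm (Pi.single j 1) x) := by
  have hs : (Pi.single j I : Fin n → ℂ) = I • Pi.single j 1 := by
    rw [← Pi.single_smul]; simp
  simp only [weightCovector, wirtinger, fderiv_weight_eq]
  rw [hs, hol_smul_right, herm_smul_left]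
  set w := 2 * φ.hol x (Pi.single j 1) + 1 / 2 * φ.herm (Pi.single j 1) x with hw
  have : 2 * (I * φ.hol x (Pi.single j 1)) + 1 / 2 * (I * φ.herm (Pi.single j 1) x) = I * w := by
    rw [hw]; ring
  rw [this]
  clear_value w
  apply Complex.ext <;> simp

/-- Coordinate-free form of the covector: linear in `s` through `hol` and antilinear in `s` through
`herm`, which makes the contour phases computable by bilinear algebra. -/
theorem dot_weightCovector (w s : Fin n → ℂ) :
    w ⬝ᵥ φ.weightCovector s = -I * (2 * φ.hol s w + 1 / 2 * φ.herm w s) := by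
  have h1 : w = ∑ j, w j • (Pi.single j 1 : Fin n → ℂ) := by
    ext k; simp [Finset.sum_apply, Pi.single_apply]
  have hh : ∀ (t : Finset (Fin n)) (f : Fin n → Fin n → ℂ),
      φ.hol s (∑ j ∈ t, f j) = ∑ j ∈ t, φ.hol s (f j) := fun t f => by
    classical
    induction t using Finset.induction_on with
    | empty => simp [hol]
    | insert a t ha ih => rw [Finset.sum_insert ha, hol_add_right, ih, Finset.sum_insert ha]
  have hk : ∀ (t : Finset (Fin n)) (f : Fin n → Fin n → ℂ),
      φ.herm (∑ j ∈ t, f j) s = ∑ j ∈ t, φ.herm (f j) s := fun t f => by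
    classical
    induction t using Finset.induction_on with
    | empty => simp [herm]
    | insert a t ha ih => rw [Finset.sum_insert ha, herm_add_left, ih, Finset.sum_insert ha]
  conv_rhs => rw [h1, hh, hk]
  simp only [dotProduct, weightCovector_apply, hol_smul_right, herm_smul_left, Finset.mul_sum,
    ← Finset.sum_add_distrib]
  refine Finset.sum_congr rfl fun j _ => ?_
  ring

theorem continuous_weightCovector : Continuous φ.weightCovector := by
  refine continuous_pi fun j => ?_
  simp only [weightCovector_apply]
  fun_prop

theorem continuous_weight : Continuous φ.weight := φ.differentiable_weight.continuous

/-- Only the Hermitian part of $\theta$ depends on $\bar y$, and linearly, so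
$\partial\theta/\partial\bar y$ is the constant matrix $-\tfrac i4B^{T}M^{-1}\overline B$. One
factor $\tfrac12$ comes from the covector and one from the midpoint. -/
theorem contourDensity_eq (x y : Fin n → ℂ) :
    φ.contourDensity x y = (2 ^ n)⁻¹ * ‖φ.B.det‖ ^ 2 / φ.imC.det := by
  have hd : ∀ j k, wirtingerBar (fun w => φ.contourTheta x w j) k y =
      -(I / 4) * φ.herm (Pi.single j 1) (Pi.single k 1) := by
    intro j k
    obtain ⟨θ₀, hf⟩ : ∃ θ₀ : ℂ, (fun w => φ.contourTheta x w j) = fun w =>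
        θ₀ + -(I * φ.hol w (Pi.single j 1)) + -(I / 4) * φ.herm (Pi.single j 1) w := by
      refine ⟨φ.contourTheta x 0 j, ?_⟩
      funext w
      simp only [contourTheta, weightCovector_apply, hol_smul_left, herm_smul_right, hol_add_left,
        herm_add_right, add_zero]
      simp only [star_div₀, star_one, star_ofNat]
      ring
    have hl : ∀ v, fderiv ℝ (fun w => φ.contourTheta x w j) y v =
        -(I * φ.hol v (Pi.single j 1)) + -(I / 4) * φ.herm (Pi.single j 1) v := by
      intro v
      have hdiff : Differentiable ℝ (fun w => φ.contourTheta x w j) := by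
        rw [hf]
        refine (Differentiable.const_add _ ?_).add ?_
        · exact (((φ.differentiable_hol_left _).restrictScalars ℝ).const_mul I).neg
        · exact (φ.differentiable_herm_right _).const_mul _
      rw [← (hdiff y).lineDeriv_eq_fderiv]
      refine HasLineDerivAt.lineDeriv ?_
      have hf' : ∀ w, φ.contourTheta x w j = _ := congrFun hf
      simp only [HasLineDerivAt, hf']
      have hs : ∀ t : ℝ, t • v = (t : ℂ) • v := fun t => by ext; simp
      simp only [hol_add_left, herm_add_right, hs, hol_smul_left, herm_smul_right]
      simp only [Complex.star_def, conj_ofReal]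
      have h0 : HasDerivAt (fun t : ℝ => (t : ℂ)) 1 0 := Complex.ofRealCLM.hasDerivAt
      have h1 := (((((h0.mul_const (φ.hol v (Pi.single j 1))).const_add
        (φ.hol y (Pi.single j 1))).const_mul I).neg).const_add θ₀).add
        (((h0.mul_const (φ.herm (Pi.single j 1) v)).const_add
          (φ.herm (Pi.single j 1) y)).const_mul (-(I / 4)))
      exact h1.congr_deriv (by simp)
    have hs : (Pi.single k I : Fin n → ℂ) = I • Pi.single k 1 := by
      rw [← Pi.single_smul]; simp
    simp only [wirtingerBar, hl]
    rw [hs, hol_smul_left, herm_smul_right]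
    simp only [Complex.star_def, conj_I]
    linear_combination (-1/2*(I * φ.hol (Pi.single k 1) (Pi.single j 1)) +
      I / 8 * φ.herm (Pi.single j 1) (Pi.single k 1)) * I_sq
  have hmat : (Matrix.of fun j k : Fin n => wirtingerBar (fun w => φ.contourTheta x w j) k y) =
      (-(I / 4)) • (φ.Bᵀ * φ.minv * φ.B.map star) := by
    ext j k
    rw [Matrix.of_apply, hd, Matrix.smul_apply, smul_eq_mul]
    congr 1
    have e1 : φ.B *ᵥ Pi.single j 1 = φ.B.col j := mulVec_single_one _ _
    have e2 : φ.B *ᵥ Pi.single k 1 = φ.B.col k := mulVec_single_one _ _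
    rw [herm, e1, e2, dot_symm φ.minv_symm, dotProduct_comm, Matrix.mul_assoc]
    simp only [Matrix.mul_apply, dotProduct, mulVec, Matrix.map_apply, Matrix.col,
      Matrix.transpose_apply, Pi.star_apply]
  rw [contourDensity, hmat, Matrix.det_smul, Matrix.det_mul, Matrix.det_mul, Matrix.det_transpose]
  have hB : (φ.B.map star).det = star φ.B.det := ((starRingEnd ℂ).map_det φ.B).symm
  have hM : φ.minv.det = ((φ.imC.det)⁻¹ : ℝ) := by
    have := (Complex.ofRealHom.map_det φ.imC⁻¹).symm
    rw [Matrix.det_nonsing_inv, Ring.inverse_eq_inv'] at this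
    exact this
  have hpos : 0 < φ.imC.det := φ.imC_posDef.det_pos
  rw [hB, hM]
  simp only [norm_mul, norm_pow, norm_neg, norm_div, norm_I, Fintype.card_fin, norm_star,
    Complex.norm_real, norm_inv, Real.norm_of_nonneg hpos.le]
  have h4 : ((1 : ℝ) / ‖(4 : ℂ)‖) ^ n = (2 ^ n)⁻¹ * (2 ^ n)⁻¹ := by
    rw [← mul_inv, ← mul_pow, one_div, inv_pow]; norm_num
  rw [h4]
  field_simp
end FBIPhase

/-! ### The coherent-state kernel and its reflections. -/

namespace FBIPhase

variable {n : ℕ} (φ : FBIPhase n) (h : ℝ)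

/-- The coherent-state kernel `e^{2Ψ(z, x̄)/h}`, where `Ψ` is the polarization of the weight. -/
def cohKer (z x : Fin n → ℂ) : ℂ :=
  cexp ((φ.hol z z + (starRingEnd ℂ) (φ.hol x x) + 1 / 2 * φ.herm z x) / h)

/-- The composition of the coherent-state kernel with the reflection at `s`. -/
def reflKer (x s z : Fin n → ℂ) : ℂ :=
  cexp ((φ.hol x x + (starRingEnd ℂ) (φ.hol z z) + φ.herm x s - φ.herm s s + φ.herm s z
    - 1 / 2 * φ.herm x z) / h)

theorem half_re (z : ℂ) : ((1 / 2 : ℂ) * z).re = 1 / 2 * z.re := by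
  rw [mul_re]; simp

theorem herm_re_comm (z w : Fin n → ℂ) : (φ.herm z w).re = (φ.herm w z).re := by
  rw [← φ.star_herm w z]; simp

theorem conj_cohKer (z x : Fin n → ℂ) : (starRingEnd ℂ) (φ.cohKer h z x) = φ.cohKer h x z := by
  rw [cohKer, cohKer, ← exp_conj, map_div₀, conj_ofReal]
  simp only [map_add, map_mul, conj_conj, conj_herm, map_div₀, map_one, map_ofNat]
  ring_nf

theorem norm_cohKer (z x : Fin n → ℂ) : ‖φ.cohKer h z x‖ =
    Real.exp ((φ.weight z + φ.weight x) / h - (φ.herm (z - x) (z - x)).re / (4 * h)) := by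
  rw [cohKer, norm_exp, div_ofReal_re]
  congr 1
  simp only [add_re, conj_re, half_re, weight_eq_hol_herm, herm_sub_left, herm_sub_right, sub_re,
    φ.herm_re_comm x z]
  rcases eq_or_ne h 0 with rfl | hh
  · simp
  field_simp
  ring

/-- Relative to the weights the kernel is a Gaussian in `s` centred at the midpoint of `x` and `z`.
This gives convergence in `s` but no decay in `x - z`; that has to come from oscillation. -/
theorem norm_reflKer (x s z : Fin n → ℂ) : ‖φ.reflKer h x s z‖ =
    Real.exp ((φ.weight x + φ.weight z) / h
      - (φ.herm (s - (1 / 2 : ℂ) • (x + z)) (s - (1 / 2 : ℂ) • (x + z))).re / h) := by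
  rw [reflKer, norm_exp, div_ofReal_re]
  have h12 : star (1 / 2 : ℂ) = 1 / 2 := by simp
  rw [← sub_div]
  congr 2
  simp only [add_re, sub_re, conj_re, half_re, weight_eq_hol_herm, herm_sub_left, herm_sub_right,
    herm_smul_left, herm_smul_right, h12, herm_add_left, herm_add_right,
    φ.herm_re_comm x z, φ.herm_re_comm s x, φ.herm_re_comm s z]
  ring

theorem half_smul_add_reflect (x s : Fin n → ℂ) :
    (1 / 2 : ℂ) • (x + ((2 : ℂ) • s - x)) = s := by
  rw [add_sub_cancel, smul_smul]; norm_num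

theorem contour_phase_reflect (x s : Fin n → ℂ) :
    I * ((x - ((2 : ℂ) • s - x)) ⬝ᵥ φ.contourTheta x ((2 : ℂ) • s - x)) =
      4 * φ.hol s x - 4 * φ.hol s s + φ.herm x s - φ.herm s s := by
  rw [contourTheta, half_smul_add_reflect, dot_weightCovector]
  have : x - ((2 : ℂ) • s - x) = (2 : ℂ) • (x - s) := by
    rw [smul_sub, two_smul ℂ x]; abel
  rw [this, hol_smul_right, herm_smul_left, hol_sub_right, herm_sub_left]
  linear_combination (-4 * (φ.hol s x - φ.hol s s) - (φ.herm x s - φ.herm s s)) * I_sq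

/-- The terms $4\,\mathrm{hol}(s,x)-4\,\mathrm{hol}(s,s)$ of the contour phase cancel against the
expansion of $\mathrm{hol}(2s-x,2s-x)$, so `s` survives only in the Hermitian form. -/
theorem exp_contour_mul_cohKer (x s z : Fin n → ℂ) :
    cexp (I / h * ((x - ((2 : ℂ) • s - x)) ⬝ᵥ φ.contourTheta x ((2 : ℂ) • s - x))) *
      φ.cohKer h ((2 : ℂ) • s - x) z = φ.reflKer h x s z := by
  rw [div_mul_eq_mul_div, contour_phase_reflect, reflKer, cohKer, ← Complex.exp_add, ← add_div]
  congr 2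
  simp only [hol_sub_left, hol_sub_right, hol_smul_left, hol_smul_right, herm_sub_left,
    herm_smul_left, φ.hol_symm x s]
  ring

theorem norm_exp_contour (x s : Fin n → ℂ) :
    ‖cexp (I / h * ((x - ((2 : ℂ) • s - x)) ⬝ᵥ φ.contourTheta x ((2 : ℂ) • s - x)))‖ =
      Real.exp ((φ.weight x - φ.weight ((2 : ℂ) • s - x)) / h) := by
  rw [div_mul_eq_mul_div, contour_phase_reflect, norm_exp, div_ofReal_re]
  have h2 : star (2 : ℂ) = 2 := by simp
  have r2 : ∀ z : ℂ, (2 * z).re = 2 * z.re := fun z => by rw [mul_re]; simp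
  have r4 : ∀ z : ℂ, (4 * z).re = 4 * z.re := fun z => by rw [mul_re]; simp
  congr 2
  simp only [weight_eq_hol_herm, hol_sub_left, hol_sub_right, hol_smul_left, hol_smul_right,
    herm_sub_left, herm_sub_right, herm_smul_right, herm_smul_left, h2, φ.hol_symm x s, sub_re,
    add_re, r2, r4, φ.herm_re_comm s x]
  ring

theorem exists_herm_lower_bound : ∃ c > 0, ∀ x, c * ‖x‖ ^ 2 ≤ (φ.herm x x).re := by
  refine exists_pos_mul_norm_sq_le (Complex.continuous_re.comp (by fun_prop)) (fun t x => ?_)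
    fun x hx => ?_
  · have hs : t • x = (t : ℂ) • x := by ext; simp
    rw [hs, herm_smul_left, herm_smul_right, Complex.star_def, conj_ofReal, re_ofReal_mul,
      re_ofReal_mul]
    ring
  · have hB : IsUnit φ.B.det := isUnit_iff_ne_zero.mpr φ.det_ne_zero
    have hBx : φ.B *ᵥ x ≠ 0 := fun h0 => hx <| by
      have := congrArg (φ.B⁻¹ *ᵥ ·) h0
      simpa [Matrix.mulVec_mulVec, Matrix.nonsing_inv_mul _ hB] using this
    rw [herm_re]
    by_cases hr : φ.reB x = 0
    · have hi : φ.imB x ≠ 0 := fun hi => hBx <| by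
        ext j
        rw [B_mulVec_eq, hr, hi]
        simp
      exact add_pos_of_nonneg_of_pos (φ.imC_inv_posDef.nonneg_dot _)
        (φ.imC_inv_posDef.pos_dot hi)
    · exact add_pos_of_pos_of_nonneg (φ.imC_inv_posDef.pos_dot hr)
        (φ.imC_inv_posDef.nonneg_dot _)

theorem herm_self_nonneg (x : Fin n → ℂ) : 0 ≤ (φ.herm x x).re := by
  rw [herm_re]
  exact add_nonneg (φ.imC_inv_posDef.nonneg_dot _) (φ.imC_inv_posDef.nonneg_dot _)

/-! Coordinates from the real phase space. -/

/-- The base point of `κ_T(s, ξ)`. -/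
def basePt (s ξ : EuclideanSpace ℝ (Fin n)) : Fin n → ℂ :=
  (φ.kappa (realToComplex s, realToComplex ξ)).1

theorem basePt_eq (s ξ : EuclideanSpace ℝ (Fin n)) :
    φ.basePt s ξ = -(φ.B⁻¹ *ᵥ (realToComplex ξ + φ.C *ᵥ realToComplex s)) := rfl

theorem kappaT_eq_lift (s ξ : EuclideanSpace ℝ (Fin n)) :
    φ.kappaT (s, ξ) = φ.lift (φ.basePt s ξ) := by
  apply Subtype.ext
  exact Prod.ext rfl (φ.kappa_mem_Lambda s ξ)

theorem weightCovector_basePt (s ξ : EuclideanSpace ℝ (Fin n)) :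
    φ.weightCovector (φ.basePt s ξ) = φ.gradX (φ.basePt s ξ) (realToComplex s) :=
  (φ.kappa_mem_Lambda s ξ).symm

theorem B_basePt (s ξ : EuclideanSpace ℝ (Fin n)) :
    φ.B *ᵥ φ.basePt s ξ = -realToComplex ξ - φ.C *ᵥ realToComplex s := by
  have hB : IsUnit φ.B.det := isUnit_iff_ne_zero.mpr φ.det_ne_zero
  rw [basePt_eq, mulVec_neg, mulVec_mulVec, Matrix.mul_nonsing_inv _ hB, one_mulVec]
  abel

theorem im_C_mulVec (s : EuclideanSpace ℝ (Fin n)) (j : Fin n) :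
    ((φ.C *ᵥ realToComplex s) j).im = (φ.imC *ᵥ s.ofLp) j := by
  simp [mulVec, dotProduct, realToComplex, Complex.im_sum, Complex.mul_im, imC]

theorem imB_basePt (s ξ : EuclideanSpace ℝ (Fin n)) :
    φ.imB (φ.basePt s ξ) = -(φ.imC *ᵥ s.ofLp) := by
  ext j
  have h3 : (realToComplex ξ j).im = 0 := by simp [realToComplex]
  rw [imB, B_basePt, Pi.sub_apply, Pi.neg_apply, sub_im, neg_im, h3, im_C_mulVec, Pi.neg_apply]
  ring

theorem neg_im_eval (x : Fin n → ℂ) (y : EuclideanSpace ℝ (Fin n)) :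
    -(φ.eval x (realToComplex y)).im = φ.weight x
      - 1 / 2 * (φ.imC *ᵥ (y.ofLp + φ.imC⁻¹ *ᵥ φ.imB x) ⬝ᵥ (y.ofLp + φ.imC⁻¹ *ᵥ φ.imB x)) := by
  have hMM : φ.imC *ᵥ (φ.imC⁻¹ *ᵥ φ.imB x) = φ.imB x := by
    simp [Matrix.mulVec_mulVec, Matrix.mul_nonsing_inv _ φ.isUnit_det_imC]
  have e1 : φ.imC *ᵥ y.ofLp ⬝ᵥ (φ.imC⁻¹ *ᵥ φ.imB x) = φ.imB x ⬝ᵥ y.ofLp := by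
    rw [imC, dot_symm φ.im_C_symm, ← imC, hMM]
  rw [im_eval, weight_eq, ← imC, mulVec_add, add_dotProduct, dotProduct_add, dotProduct_add, hMM,
    e1, dotProduct_comm (φ.imB x) (φ.imC⁻¹ *ᵥ φ.imB x)]
  ring

/-- The supremum defining the weight is attained at $y=s$, since `imB_basePt` is the critical point
equation. -/
theorem weight_basePt (s ξ : EuclideanSpace ℝ (Fin n)) :
    φ.weight (φ.basePt s ξ) = -(φ.eval (φ.basePt s ξ) (realToComplex s)).im := by
  rw [neg_im_eval, imB_basePt, mulVec_neg, mulVec_mulVec,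
    Matrix.nonsing_inv_mul _ φ.isUnit_det_imC]
  simp

theorem realToComplex_dot (s ξ : EuclideanSpace ℝ (Fin n)) :
    realToComplex s ⬝ᵥ realToComplex ξ = (inner ℝ s ξ : ℝ) := by
  simp [dotProduct, realToComplex, PiLp.inner_apply, mul_comm]

theorem realToComplex_sub (s ξ : EuclideanSpace ℝ (Fin n)) :
    realToComplex (s - ξ) = realToComplex s - realToComplex ξ := by
  ext; simp [realToComplex]

theorem realToComplex_smul (c : ℝ) (s : EuclideanSpace ℝ (Fin n)) :
    realToComplex (c • s) = (c : ℂ) • realToComplex s := by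
  ext; simp [realToComplex]

theorem B_basePt_dot (s ξ : EuclideanSpace ℝ (Fin n)) (v : Fin n → ℂ) :
    φ.B *ᵥ φ.basePt s ξ ⬝ᵥ v = -(realToComplex ξ ⬝ᵥ v) - φ.C *ᵥ realToComplex s ⬝ᵥ v := by
  rw [B_basePt, sub_dotProduct, neg_dotProduct]

/-- Taylor expansion at $y=s$, where $\varphi'_y=-\xi$. In these coordinates the FBI integral is a
Fourier transform with a Gaussian window centred at `s`. -/
theorem eval_basePt (s ξ y : EuclideanSpace ℝ (Fin n)) :
    φ.eval (φ.basePt s ξ) (realToComplex y) = φ.eval (φ.basePt s ξ) (realToComplex s)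
      - (inner ℝ (y - s) ξ : ℝ)
      + 1 / 2 * (φ.C *ᵥ realToComplex (y - s) ⬝ᵥ realToComplex (y - s)) := by
  rw [← realToComplex_dot]
  simp only [eval, realToComplex_sub, B_basePt_dot, mulVec_sub, sub_dotProduct, dotProduct_sub,
    dot_symm φ.symmC (realToComplex y) (realToComplex s),
    dotProduct_comm (realToComplex ξ)]
  ring

/-- Exact Egorov theorem at the level of phases: reflecting the kernel in its complex variable at
$X=$ `basePt s ξ` equals reflecting it in its real variable at $(s,\xi)$. It follows from
$\theta=\varphi'_x(X,s)$ and $\varphi'_y(X,s)=-\xi$, because $\varphi$ has no terms beyond second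
order. -/
theorem contour_phase_add_eval (z : Fin n → ℂ) (s ξ y : EuclideanSpace ℝ (Fin n)) :
    (z - ((2 : ℂ) • φ.basePt s ξ - z)) ⬝ᵥ φ.contourTheta z ((2 : ℂ) • φ.basePt s ξ - z)
      + φ.eval ((2 : ℂ) • φ.basePt s ξ - z) (realToComplex y)
    = φ.eval z (realToComplex ((2 : ℝ) • s - y)) + 2 * (inner ℝ (s - y) ξ : ℝ) := by
  rw [contourTheta, half_smul_add_reflect, weightCovector_basePt, ← realToComplex_dot]
  have ht : ∀ v w : Fin n → ℂ, v ⬝ᵥ φ.Bᵀ *ᵥ w = φ.B *ᵥ v ⬝ᵥ w := fun v w => by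
    rw [dotProduct_mulVec, vecMul_transpose]
  have hA : ∀ v w : Fin n → ℂ, v ⬝ᵥ φ.A *ᵥ w = φ.A *ᵥ v ⬝ᵥ w := fun v w => by
    rw [dotProduct_comm, dot_symm φ.symmA]
  simp only [eval, gradX, realToComplex_sub, realToComplex_smul, mulVec_sub, mulVec_smul,
    sub_dotProduct, dotProduct_sub, smul_dotProduct, dotProduct_smul, dotProduct_add, smul_eq_mul,
    ht, hA, B_basePt_dot, dot_symm φ.symmC (realToComplex y) (realToComplex s),
    dotProduct_comm (realToComplex ξ), dot_symm φ.symmA z (φ.basePt s ξ)]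
  push_cast
  ring

end FBIPhase

/-! ### Gaussian integrals with a linear term. -/

theorem measurePreserving_mulVec {n : ℕ} {N : Matrix (Fin n) (Fin n) ℝ} (hN : N.det ≠ 0) :
    MeasurePreserving (fun y : EuclideanSpace ℝ (Fin n) => N *ᵥ y.ofLp) volume
      (ENNReal.ofReal |N.det⁻¹| • volume) := by
  have h1 : MeasurePreserving (toLin' N) (volume : Measure (Fin n → ℝ))
      (ENNReal.ofReal |N.det⁻¹| • volume) :=
    ⟨(LinearMap.continuous_of_finiteDimensional _).measurable,
      Real.map_matrix_volume_pi_eq_smul_volume_pi hN⟩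
  exact h1.comp (PiLp.volume_preserving_ofLp (Fin n))

theorem measurableEmbedding_mulVec {n : ℕ} {N : Matrix (Fin n) (Fin n) ℝ} (hN : N.det ≠ 0) :
    MeasurableEmbedding (fun y : EuclideanSpace ℝ (Fin n) => N *ᵥ y.ofLp) := by
  refine Continuous.measurableEmbedding ?_ fun a b hab => ?_
  · exact continuous_const.matrix_mulVec (PiLp.continuous_ofLp 2 _)
  · have := Matrix.mulVec_injective_of_det_ne_zero hN hab
    exact (WithLp.ofLp_injective 2) this

open scoped MatrixOrder in
theorem Matrix.PosDef.exists_transpose_mul_self {n : ℕ} {P : Matrix (Fin n) (Fin n) ℝ}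
    (hP : P.PosDef) : ∃ N : Matrix (Fin n) (Fin n) ℝ, N.det ≠ 0 ∧ P = Nᵀ * N := by
  obtain ⟨N, hN⟩ := CStarAlgebra.nonneg_iff_eq_star_mul_self.mp hP.posSemidef.nonneg
  have hN' : P = Nᵀ * N := by rw [hN]; rfl
  refine ⟨N, fun h0 => ?_, hN'⟩
  have := hP.det_pos
  rw [hN', det_mul, h0, mul_zero] at this
  exact lt_irrefl _ this

section Gaussian

variable {n : ℕ} {P : Matrix (Fin n) (Fin n) ℝ}

/-- With $P=N^{T}N$, the substitution $t=Ny$ reduces the Gaussian to a standard one. -/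
theorem gaussian_exponent_eq {N : Matrix (Fin n) (Fin n) ℝ} (hN : N.det ≠ 0) (w : Fin n → ℂ)
    (y : Fin n → ℝ) :
    -(((Nᵀ * N) *ᵥ y ⬝ᵥ y : ℝ) : ℂ) + w ⬝ᵥ (fun j => (y j : ℂ)) =
      -(1 : ℂ) * ∑ i, ((N *ᵥ y) i : ℂ) ^ 2 + ∑ i, ((Nᵀ⁻¹).map ofReal *ᵥ w) i * ((N *ᵥ y) i : ℂ) := by
  have h1 : ((Nᵀ * N) *ᵥ y ⬝ᵥ y : ℝ) = ∑ i, ((N *ᵥ y) i) ^ 2 := by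
    rw [← mulVec_mulVec, mulVec_transpose, ← dotProduct_mulVec]
    simp [dotProduct, sq]
  have h2 : (fun i => ((N *ᵥ y) i : ℂ)) = N.map ofReal *ᵥ (fun j => (y j : ℂ)) := by
    ext i; simp [mulVec, dotProduct]
  have h3 : ∑ i, ((Nᵀ⁻¹).map ofReal *ᵥ w) i * ((N *ᵥ y) i : ℂ) = w ⬝ᵥ (fun j => (y j : ℂ)) := by
    change (Nᵀ⁻¹).map ofReal *ᵥ w ⬝ᵥ (fun i => ((N *ᵥ y) i : ℂ)) = _
    rw [h2, dotProduct_mulVec, vecMul_mulVec]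
    have h4 : (((Nᵀ⁻¹).map ofReal)ᵀ * N.map ofReal : Matrix (Fin n) (Fin n) ℂ) = 1 := by
      have : N⁻¹ * N = 1 := Matrix.nonsing_inv_mul _ hN.isUnit
      rw [← Matrix.transpose_map, Matrix.transpose_nonsing_inv, transpose_transpose]
      have h5 := congrArg (fun X => X.map Complex.ofRealHom) this
      simp only [Matrix.map_mul, Matrix.map_one _ (map_zero _) (map_one _)] at h5
      exact h5
    rw [h4, vecMul_one]
  rw [h1, h3]
  push_cast
  ring

theorem integrable_gaussian (hP : P.PosDef) (w : Fin n → ℂ) :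
    Integrable fun y : EuclideanSpace ℝ (Fin n) =>
      cexp (-((P *ᵥ y.ofLp ⬝ᵥ y.ofLp : ℝ) : ℂ) + w ⬝ᵥ realToComplex y) := by
  obtain ⟨N, hN, rfl⟩ := hP.exists_transpose_mul_self
  have hi := (GaussianFourier.integrable_cexp_neg_mul_sum_add (b := 1) (by simp)
    ((Nᵀ⁻¹).map ofReal *ᵥ w)).smul_measure (c := ENNReal.ofReal |N.det⁻¹|) ENNReal.ofReal_ne_top
  have := (measurePreserving_mulVec hN).integrable_comp_emb (measurableEmbedding_mulVec hN) |>.mpr hi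
  refine this.congr (ae_of_all _ fun y => ?_)
  simp only [Function.comp_apply]
  exact congrArg cexp (gaussian_exponent_eq hN w y.ofLp).symm

theorem integral_gaussian_linear (hP : P.PosDef) (w : Fin n → ℂ) :
    ∫ y : EuclideanSpace ℝ (Fin n),
      cexp (-((P *ᵥ y.ofLp ⬝ᵥ y.ofLp : ℝ) : ℂ) + w ⬝ᵥ realToComplex y) =
    ((Real.pi ^ ((n : ℝ) / 2) / Real.sqrt P.det : ℝ) : ℂ) *
      cexp (1 / 4 * ((P⁻¹).map ofReal *ᵥ w ⬝ᵥ w)) := by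
  obtain ⟨N, hN, rfl⟩ := hP.exists_transpose_mul_self
  have h0 : ∀ y : EuclideanSpace ℝ (Fin n),
      cexp (-(((Nᵀ * N) *ᵥ y.ofLp ⬝ᵥ y.ofLp : ℝ) : ℂ) + w ⬝ᵥ realToComplex y) =
      (fun t : Fin n → ℝ => cexp (-(1 : ℂ) * ∑ i, ((t i : ℂ)) ^ 2 +
        ∑ i, ((Nᵀ⁻¹).map ofReal *ᵥ w) i * (t i : ℂ))) (N *ᵥ y.ofLp) := fun y => by
    exact congrArg cexp (gaussian_exponent_eq hN w y.ofLp)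
  refine (integral_congr_ae (ae_of_all _ h0)).trans
    (((measurePreserving_mulVec hN).integral_comp (measurableEmbedding_mulVec hN)
      (fun t : Fin n → ℝ => cexp (-(1 : ℂ) * ∑ i, ((t i : ℂ)) ^ 2 +
        ∑ i, ((Nᵀ⁻¹).map ofReal *ᵥ w) i * (t i : ℂ)))).trans ?_)
  rw [integral_smul_measure, GaussianFourier.integral_cexp_neg_mul_sum_add (by simp)]
  have h1 : Real.sqrt (Nᵀ * N).det = |N.det| := by
    rw [det_mul, det_transpose, Real.sqrt_mul_self_eq_abs]
  have h2 : ∑ i, ((Nᵀ⁻¹).map ofReal *ᵥ w) i ^ 2 = ((Nᵀ * N)⁻¹.map ofReal *ᵥ w ⬝ᵥ w : ℂ) := by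
    have h3 : ((Nᵀ * N)⁻¹.map ofReal : Matrix (Fin n) (Fin n) ℂ)
        = ((Nᵀ⁻¹).map ofReal)ᵀ * (Nᵀ⁻¹).map ofReal := by
      rw [Matrix.mul_inv_rev, ← Matrix.transpose_map, Matrix.transpose_nonsing_inv,
        transpose_transpose]
      exact Matrix.map_mul (f := Complex.ofRealHom)
    rw [h3, ← mulVec_mulVec, mulVec_transpose, ← dotProduct_mulVec]
    simp [dotProduct, sq]
  rw [h1, h2, ENNReal.toReal_ofReal (abs_nonneg _), Complex.real_smul, ← mul_assoc]
  congr 1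
  · rw [Fintype.card_fin, abs_inv, div_one, div_eq_inv_mul]
    push_cast
    rw [Complex.ofReal_cpow Real.pi_pos.le]
    push_cast
    ring_nf
  · congr 1; ring

end Gaussian

/-! ### The Jacobian of the parametrization by real phase space. -/

namespace FBIPhase

variable {n : ℕ} (φ : FBIPhase n)

theorem measurePreserving_complex_pi (n : ℕ) :
    MeasurePreserving (fun p : (Fin n → ℝ) × (Fin n → ℝ) => fun j => (p.1 j : ℂ) + p.2 j * I) := by
  have h1 := (volume_measurePreserving_arrowProdEquivProdArrow ℝ ℝ (Fin n)).symm
  have h2 := volume_preserving_pi (fun _ : Fin n => Complex.volume_preserving_equiv_real_prod.symm)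
  have h3 := h2.comp h1
  convert h3 using 1
  funext p j
  simp [MeasurableEquiv.arrowProdEquivProdArrow, Equiv.arrowProdEquivProdArrow,
    Complex.measurableEquivRealProd]
  apply Complex.ext <;> simp [Complex.equivRealProdCLM_symm_apply]

theorem map_linear_complex {N : Matrix (Fin n) (Fin n) ℂ} (hN : N.det ≠ 0) :
    MeasurePreserving (fun x : Fin n → ℂ => N *ᵥ x) volume
      (ENNReal.ofReal ((‖N.det‖ ^ 2)⁻¹) • volume) := by
  have hd : LinearMap.det ((toLin' N).restrictScalars ℝ) = ‖N.det‖ ^ 2 := by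
    rw [LinearMap.det_restrictScalars, LinearMap.det_toLin', Algebra.norm_complex_apply,
      Complex.normSq_eq_norm_sq]
  refine ⟨(Continuous.matrix_mulVec continuous_const continuous_id).measurable, ?_⟩
  have := Measure.map_linearMap_addHaar_eq_smul_addHaar (volume : Measure (Fin n → ℂ))
    (f := (toLin' N).restrictScalars ℝ) (by rw [hd]; positivity)
  rw [hd, abs_of_pos (by positivity)] at this
  exact this

/-- Writing $C=R+iM$, the map factors as $(s,\xi)\mapsto(Ms,Rs+\xi)$, a skew product that merely
translates $\xi$, followed by $\mathbf R^n\times\mathbf R^n\cong\mathbf C^n$ and by $-B^{-1}$. Only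
$\det M$ and $|\det B|^2$ contribute. -/
theorem measurePreserving_basePt :
    MeasurePreserving (fun p : EuclideanSpace ℝ (Fin n) × EuclideanSpace ℝ (Fin n) =>
      φ.basePt p.1 p.2) (volume.prod volume)
      (ENNReal.ofReal (‖φ.B.det‖ ^ 2 / φ.imC.det) • volume) := by
  have hpos : 0 < φ.imC.det := φ.imC_posDef.det_pos
  set R : Matrix (Fin n) (Fin n) ℝ := φ.C.map Complex.re with hR
  have h1 := measurePreserving_mulVec hpos.ne'
  have h2 : MeasurePreserving
      (fun p : EuclideanSpace ℝ (Fin n) × EuclideanSpace ℝ (Fin n) =>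
        (φ.imC *ᵥ p.1.ofLp, R *ᵥ p.1.ofLp + p.2.ofLp)) (volume.prod volume)
      ((ENNReal.ofReal |φ.imC.det⁻¹| • volume).prod volume) := by
    refine h1.skew_product (g := fun s (ξ : EuclideanSpace ℝ (Fin n)) => R *ᵥ s.ofLp + ξ.ofLp) ?_ (ae_of_all _ fun s => ?_)
    · refine Continuous.measurable ?_
      simp only [Function.uncurry_def]
      exact (continuous_const.matrix_mulVec ((PiLp.continuous_ofLp 2 _).comp continuous_fst)).add
        ((PiLp.continuous_ofLp 2 _).comp continuous_snd)
    · exact ((measurePreserving_add_left volume (R *ᵥ s.ofLp)).comp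
        (PiLp.volume_preserving_ofLp (Fin n))).map_eq
  -- The swap makes $Rs+\xi$ the real part and $Ms$ the imaginary part.
  have h3 := ((measurePreserving_complex_pi n).comp
    (Measure.measurePreserving_swap (μ := (volume : Measure (Fin n → ℝ)))
      (ν := (volume : Measure (Fin n → ℝ))))).smul_measure (ENNReal.ofReal |φ.imC.det⁻¹|)
  rw [← Measure.prod_smul_left] at h3
  have hB : (-φ.B⁻¹).det ≠ 0 := by
    rw [det_neg, det_nonsing_inv, Ring.inverse_eq_inv']
    exact mul_ne_zero (pow_ne_zero _ (by simp)) (inv_ne_zero φ.det_ne_zero)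
  have h4 := (map_linear_complex hB).smul_measure (ENNReal.ofReal |φ.imC.det⁻¹|)
  have h5 := h4.comp (h3.comp h2)
  convert h5 using 1
  · funext p
    simp only [Function.comp_apply, basePt_eq, neg_mulVec]
    congr 2
    ext j
    have : (φ.C *ᵥ realToComplex p.1) j =
        (((R *ᵥ p.1.ofLp) j : ℝ) : ℂ) + ((φ.imC *ᵥ p.1.ofLp) j : ℝ) * I := by
      rw [← im_C_mulVec]
      refine (re_add_im ((φ.C *ᵥ realToComplex p.1) j)).symm.trans ?_
      congr 2
      simp [mulVec, dotProduct, realToComplex, Complex.re_sum, Complex.mul_re, hR]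
    simp only [Pi.add_apply, this, realToComplex, Prod.fst_swap, Prod.snd_swap]
    push_cast
    ring
  · rw [smul_smul, ← ENNReal.ofReal_mul (abs_nonneg _), det_neg, det_nonsing_inv,
      Ring.inverse_eq_inv', abs_inv, abs_of_pos hpos]
    congr 2
    simp
    field_simp

theorem continuous_realToComplex : Continuous (realToComplex : EuclideanSpace ℝ (Fin n) → _) := by
  unfold realToComplex
  fun_prop

@[fun_prop]
theorem _root_.Continuous.realToComplex {X : Type*} [TopologicalSpace X]
    {f : X → EuclideanSpace ℝ (Fin n)} (hf : Continuous f) :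
    Continuous fun x => realToComplex (f x) := continuous_realToComplex.comp hf

theorem continuous_basePt : Continuous
    (fun p : EuclideanSpace ℝ (Fin n) × EuclideanSpace ℝ (Fin n) => φ.basePt p.1 p.2) := by
  simp only [basePt_eq]
  exact (continuous_const.matrix_mulVec (Continuous.add (by fun_prop)
    (continuous_const.matrix_mulVec (by fun_prop)))).neg

theorem measurableEmbedding_basePt : MeasurableEmbedding
    (fun p : EuclideanSpace ℝ (Fin n) × EuclideanSpace ℝ (Fin n) => φ.basePt p.1 p.2) := by
  refine φ.continuous_basePt.measurableEmbedding ?_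
  rintro ⟨s, ξ⟩ ⟨s', ξ'⟩ hp
  simp only at hp
  have hB : φ.B *ᵥ φ.basePt s ξ = φ.B *ᵥ φ.basePt s' ξ' := by rw [hp]
  have hs : s = s' := by
    have := congrArg φ.imB hp
    rw [imB_basePt, imB_basePt, neg_inj] at this
    exact WithLp.ofLp_injective 2
      (Matrix.mulVec_injective_of_det_ne_zero φ.imC_posDef.det_pos.ne' this)
  subst hs
  rw [B_basePt, B_basePt, sub_left_inj, neg_inj] at hB
  refine Prod.ext rfl (PiLp.ext fun j => ?_)
  simpa [realToComplex] using congrFun hB j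

theorem integral_basePt (f : (Fin n → ℂ) → ℂ) :
    ∫ p : EuclideanSpace ℝ (Fin n) × EuclideanSpace ℝ (Fin n), f (φ.basePt p.1 p.2) =
      (‖φ.B.det‖ ^ 2 / φ.imC.det : ℝ) * ∫ x, f x := by
  have hpos : 0 < φ.imC.det := φ.imC_posDef.det_pos
  have := φ.measurePreserving_basePt.integral_comp φ.measurableEmbedding_basePt f
  rw [integral_smul_measure, ENNReal.toReal_ofReal (by positivity), Complex.real_smul] at this
  exact this

theorem integrable_basePt_iff (f : (Fin n → ℂ) → ℂ) :
    Integrable (fun p : EuclideanSpace ℝ (Fin n) × EuclideanSpace ℝ (Fin n) =>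
      f (φ.basePt p.1 p.2)) ↔ Integrable f := by
  have hpos : 0 < φ.imC.det := φ.imC_posDef.det_pos
  have hB := norm_pos_iff.mpr φ.det_ne_zero
  have := φ.measurePreserving_basePt.integrable_comp_emb φ.measurableEmbedding_basePt (g := f)
  rw [integrable_smul_measure (by simp; positivity) ENNReal.ofReal_ne_top] at this
  exact this

end FBIPhase

/-! ### Integrability of Gaussians and polynomial tails. -/

theorem exists_one_add_pow_mul_exp_le (N : ℕ) {c : ℝ} (hc : 0 < c) :
    ∃ K : ℝ, 0 < K ∧ ∀ r : ℝ, 0 ≤ r → (1 + r) ^ N * Real.exp (-(c * r ^ 2)) ≤ K := by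
  -- The constant combines $(1+r)^N\le N!\,e^{1+r}$ with $r-cr^2\le 1/(4c)$.
  refine ⟨N.factorial * Real.exp (1 + 1 / (4 * c)), by positivity, fun r hr => ?_⟩
  have h1 : (1 + r) ^ N ≤ N.factorial * Real.exp (1 + r) := by
    have := Real.pow_div_factorial_le_exp (1 + r) (by linarith) N
    rwa [div_le_iff₀ (by positivity), mul_comm] at this
  have h2 : (1 + r) + -(c * r ^ 2) ≤ 1 + 1 / (4 * c) := by
    have : 0 ≤ c * (r - 1 / (2 * c)) ^ 2 := by positivity
    have h3 : c * (r - 1 / (2 * c)) ^ 2 = c * r ^ 2 - r + 1 / (4 * c) := by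
      field_simp; ring
    linarith
  calc (1 + r) ^ N * Real.exp (-(c * r ^ 2))
      ≤ N.factorial * Real.exp (1 + r) * Real.exp (-(c * r ^ 2)) := by gcongr
    _ = N.factorial * Real.exp ((1 + r) + -(c * r ^ 2)) := by rw [mul_assoc, ← Real.exp_add]
    _ ≤ _ := by gcongr

theorem integrable_one_add_norm_pow_inv {E : Type*} [NormedAddCommGroup E] [NormedSpace ℝ E]
    [FiniteDimensional ℝ E] [MeasurableSpace E] [BorelSpace E] (μ : Measure E)
    [μ.IsAddHaarMeasure] {N : ℕ} (hN : Module.finrank ℝ E < N) :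
    Integrable (fun x : E => ((1 + ‖x‖) ^ N)⁻¹) μ := by
  refine (integrable_one_add_norm (μ := μ) (r := N) (by exact_mod_cast hN)).congr
    (ae_of_all _ fun x => ?_)
  simp only
  rw [Real.rpow_neg (by positivity), Real.rpow_natCast]

theorem integrable_exp_neg_mul_norm_sq {E : Type*} [NormedAddCommGroup E] [NormedSpace ℝ E]
    [FiniteDimensional ℝ E] [MeasurableSpace E] [BorelSpace E] (μ : Measure E)
    [μ.IsAddHaarMeasure] {c : ℝ} (hc : 0 < c) :
    Integrable (fun x : E => Real.exp (-(c * ‖x‖ ^ 2))) μ := by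
  obtain ⟨K, -, hK⟩ := exists_one_add_pow_mul_exp_le (Module.finrank ℝ E + 1) hc
  refine ((integrable_one_add_norm_pow_inv μ (Nat.lt_succ_self _)).const_mul K).mono'
    (by fun_prop) (ae_of_all _ fun x => ?_)
  rw [Real.norm_of_nonneg (by positivity), ← div_eq_mul_inv, le_div_iff₀ (by positivity), mul_comm]
  exact hK _ (norm_nonneg _)

theorem integral_gaussian_real {n : ℕ} {P : Matrix (Fin n) (Fin n) ℝ} (hP : P.PosDef) :
    ∫ y : EuclideanSpace ℝ (Fin n), Real.exp (-(P *ᵥ y.ofLp ⬝ᵥ y.ofLp)) =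
      Real.pi ^ ((n : ℝ) / 2) / Real.sqrt P.det := by
  have := integral_gaussian_linear hP 0
  simp only [zero_dotProduct, add_zero, mulVec_zero, mul_zero, Complex.exp_zero, mul_one] at this
  have h2 : ∀ y : EuclideanSpace ℝ (Fin n), cexp (-((P *ᵥ y.ofLp ⬝ᵥ y.ofLp : ℝ) : ℂ)) =
      ((Real.exp (-(P *ᵥ y.ofLp ⬝ᵥ y.ofLp)) : ℝ) : ℂ) := fun y => by push_cast; rfl
  simp_rw [h2] at this
  rw [integral_complex_ofReal] at this
  exact_mod_cast this

/-! ### Coherent states and their Gram matrix. -/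

namespace FBIPhase

variable {n : ℕ} (φ : FBIPhase n) {h : ℝ}

theorem integrable_exp_neg_herm {c : ℝ} (hc : 0 < c) :
    Integrable fun x : Fin n → ℂ => Real.exp (-(c * (φ.herm x x).re)) := by
  obtain ⟨d, hd, hb⟩ := φ.exists_herm_lower_bound
  refine (integrable_exp_neg_mul_norm_sq volume (mul_pos hc hd)).mono'
    (Continuous.aestronglyMeasurable ?_) (ae_of_all _ fun x => ?_)
  · exact Real.continuous_exp.comp
      ((Complex.continuous_re.comp (φ.continuous_herm continuous_id continuous_id)).const_mul c).neg
  · rw [Real.norm_of_nonneg (by positivity), mul_assoc]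
    gcongr
    exact hb x

/-- The constant `∫ e^{-2(Φ(x) - Re Ψ)/h}` in the reproducing formula. -/
def kap (h : ℝ) : ℝ := (2 * Real.pi * h) ^ n * φ.imC.det / ‖φ.B.det‖ ^ 2

theorem kap_pos (hh : 0 < h) : 0 < φ.kap h := by
  have hpos : 0 < φ.imC.det := φ.imC_posDef.det_pos
  have hB := norm_pos_iff.mpr φ.det_ne_zero
  unfold kap
  positivity

theorem herm_basePt_re (s ξ : EuclideanSpace ℝ (Fin n)) :
    (φ.herm (φ.basePt s ξ) (φ.basePt s ξ)).re =
      φ.imC⁻¹ *ᵥ (ξ + WithLp.toLp 2 (φ.C.map Complex.re *ᵥ s.ofLp)).ofLp ⬝ᵥ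
        (ξ + WithLp.toLp 2 (φ.C.map Complex.re *ᵥ s.ofLp)).ofLp + φ.imC *ᵥ s.ofLp ⬝ᵥ s.ofLp := by
  have h1 : φ.reB (φ.basePt s ξ) =
      -(ξ + WithLp.toLp 2 (φ.C.map Complex.re *ᵥ s.ofLp)).ofLp := by
    ext j
    have : ((φ.C *ᵥ realToComplex s) j).re = (φ.C.map Complex.re *ᵥ s.ofLp) j := by
      simp [mulVec, dotProduct, realToComplex, Complex.re_sum, Complex.mul_re]
    rw [reB, B_basePt, Pi.sub_apply, sub_re, this]
    simp [realToComplex]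
    ring
  rw [herm_re, h1, imB_basePt, mulVec_neg, mulVec_neg, neg_dotProduct_neg, neg_dotProduct_neg,
    mulVec_mulVec, Matrix.nonsing_inv_mul _ φ.isUnit_det_imC, one_mulVec,
    dotProduct_comm s.ofLp]

/-- In the coordinates $(s,\xi)$ the Hermitian form is $M^{-1}$ evaluated at $\xi+Rs$ plus $M$
evaluated at $s$. Translating $\xi$ decouples the two Gaussians, whose determinants cancel, so only
the Jacobian of `basePt` remains. -/
theorem integral_exp_neg_herm (hh : 0 < h) :
    ∫ x : Fin n → ℂ, cexp (-(φ.herm x x / (2 * h))) = φ.kap h := by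
  have hpos : 0 < φ.imC.det := φ.imC_posDef.det_pos
  have hB := norm_pos_iff.mpr φ.det_ne_zero
  have hf : ∀ x : Fin n → ℂ, cexp (-(φ.herm x x / (2 * h))) =
      ((Real.exp (-(1 / (2 * h) * (φ.herm x x).re)) : ℝ) : ℂ) := fun x => by
    conv_lhs => rw [herm_self_eq]
    push_cast
    congr 1
    ring
  have h2h : 0 < 1 / (2 * h) := by positivity
  have hi : Integrable fun x : Fin n → ℂ => cexp (-(φ.herm x x / (2 * h))) := by
    simp_rw [hf]
    exact (φ.integrable_exp_neg_herm h2h).ofReal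
  have hi2 := (φ.integrable_basePt_iff _).mpr hi
  have h1 := φ.integral_basePt (fun x => cexp (-(φ.herm x x / (2 * h))))
  rw [Measure.volume_eq_prod, integral_prod _ hi2] at h1
  simp_rw [hf, herm_basePt_re] at h1
  have hP1 : ((1 / (2 * h)) • φ.imC⁻¹).PosDef := φ.imC_inv_posDef.smul h2h
  have hP2 : ((1 / (2 * h)) • φ.imC).PosDef := φ.imC_posDef.smul h2h
  have h3 : ∀ s : EuclideanSpace ℝ (Fin n), ∫ ξ : EuclideanSpace ℝ (Fin n),
      ((Real.exp (-(1 / (2 * h) * (φ.imC⁻¹ *ᵥ (ξ + WithLp.toLp 2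
        (φ.C.map Complex.re *ᵥ s.ofLp)).ofLp ⬝ᵥ (ξ + WithLp.toLp 2
        (φ.C.map Complex.re *ᵥ s.ofLp)).ofLp + φ.imC *ᵥ s.ofLp ⬝ᵥ s.ofLp))) : ℝ) : ℂ) =
      (((Real.pi ^ ((n : ℝ) / 2) / Real.sqrt ((1 / (2 * h)) • φ.imC⁻¹).det) *
        Real.exp (-(((1 / (2 * h)) • φ.imC) *ᵥ s.ofLp ⬝ᵥ s.ofLp)) : ℝ) : ℂ) := by
    intro s
    rw [integral_complex_ofReal, integral_add_right_eq_self (fun ξ : EuclideanSpace ℝ (Fin n) =>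
      Real.exp (-(1 / (2 * h) * (φ.imC⁻¹ *ᵥ ξ.ofLp ⬝ᵥ ξ.ofLp + φ.imC *ᵥ s.ofLp ⬝ᵥ s.ofLp)))),
      ← integral_gaussian_real hP1, ← integral_mul_const]
    congr 2
    funext ξ
    rw [← Real.exp_add, smul_mulVec, smul_mulVec, smul_dotProduct, smul_dotProduct]
    congr 1
    simp only [smul_eq_mul]
    ring
  simp_rw [h3] at h1
  rw [integral_complex_ofReal, integral_const_mul, integral_gaussian_real hP2] at h1
  have h4 : (Real.pi ^ ((n : ℝ) / 2) / Real.sqrt ((1 / (2 * h)) • φ.imC⁻¹).det) *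
      (Real.pi ^ ((n : ℝ) / 2) / Real.sqrt ((1 / (2 * h)) • φ.imC).det) =
      (2 * Real.pi * h) ^ n := by
    rw [div_mul_div_comm, ← Real.sqrt_mul hP1.det_pos.le, ← Real.rpow_add Real.pi_pos, det_smul,
      det_smul, det_nonsing_inv, Ring.inverse_eq_inv', Fintype.card_fin]
    have e1 : (1 / (2 * h)) ^ n * φ.imC.det⁻¹ * ((1 / (2 * h)) ^ n * φ.imC.det) =
        ((1 / (2 * h)) ^ n) ^ 2 := by
      field_simp
    rw [e1, Real.sqrt_sq (by positivity), add_halves, Real.rpow_natCast, one_div, inv_pow,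
      div_inv_eq_mul, ← mul_pow]
    congr 1; ring
  rw [h4] at h1
  simp_rw [hf]
  rw [kap]
  have h5 : ((‖φ.B.det‖ ^ 2 / φ.imC.det : ℝ) : ℂ) ≠ 0 := by
    exact_mod_cast (by positivity : (0 : ℝ) < ‖φ.B.det‖ ^ 2 / φ.imC.det).ne'
  apply mul_left_cancel₀ h5
  rw [← h1, ← ofReal_mul]
  congr 1
  field_simp

/-- The coherent state `y ↦ conj e^{iφ(x, y)/h}`. -/
def coh (h : ℝ) (x : Fin n → ℂ) (y : EuclideanSpace ℝ (Fin n)) : ℂ :=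
  (starRingEnd ℂ) (cexp (I * φ.eval x (realToComplex y) / h))

theorem norm_exp_phase (x : Fin n → ℂ) (y : EuclideanSpace ℝ (Fin n)) :
    ‖cexp (I * φ.eval x (realToComplex y) / h)‖ = Real.exp (φ.weight x / h -
      (φ.imC *ᵥ (y.ofLp + φ.imC⁻¹ *ᵥ φ.imB x) ⬝ᵥ (y.ofLp + φ.imC⁻¹ *ᵥ φ.imB x)) / (2 * h)) := by
  rw [norm_exp, div_ofReal_re, I_mul_re, neg_im_eval]
  congr 1
  rcases eq_or_ne h 0 with rfl | hh
  · simp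
  field_simp

/-- The squared norm of a coherent state, up to the factor `e^{2Φ/h}`. -/
def cohConst (h : ℝ) : ℝ := Real.pi ^ ((n : ℝ) / 2) / Real.sqrt ((1 / h) • φ.imC).det

theorem conj_mulVec_dot_realToComplex (N : Matrix (Fin n) (Fin n) ℂ) (v : Fin n → ℂ)
    (y : EuclideanSpace ℝ (Fin n)) :
    (starRingEnd ℂ) (N *ᵥ v ⬝ᵥ realToComplex y) = star (N *ᵥ v) ⬝ᵥ realToComplex y := by
  simp [dotProduct, realToComplex]

theorem C_dot_sub_conj (y : EuclideanSpace ℝ (Fin n)) :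
    φ.C *ᵥ realToComplex y ⬝ᵥ realToComplex y
      - (starRingEnd ℂ) (φ.C *ᵥ realToComplex y ⬝ᵥ realToComplex y) =
      2 * I * ((φ.imC *ᵥ y.ofLp ⬝ᵥ y.ofLp : ℝ) : ℂ) := by
  rw [Complex.sub_conj]
  have : (φ.C *ᵥ realToComplex y ⬝ᵥ realToComplex y).im = φ.imC *ᵥ y.ofLp ⬝ᵥ y.ofLp := by
    simp only [dotProduct, Complex.im_sum, Complex.mul_im, im_C_mulVec]
    simp [realToComplex]
  rw [this]
  push_cast
  ring

theorem phase_sub_conj_eq (x z : Fin n → ℂ) (y : EuclideanSpace ℝ (Fin n)) :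
    I * φ.eval x (realToComplex y) / h + (starRingEnd ℂ) (I * φ.eval z (realToComplex y) / h) =
      I / (2 * h) * (φ.A *ᵥ x ⬝ᵥ x - (starRingEnd ℂ) (φ.A *ᵥ z ⬝ᵥ z)) +
      (-((((1 / h) • φ.imC) *ᵥ y.ofLp ⬝ᵥ y.ofLp : ℝ) : ℂ) +
        ((I / h : ℂ) • (φ.B *ᵥ x - star (φ.B *ᵥ z))) ⬝ᵥ realToComplex y) := by
  have h1 := φ.C_dot_sub_conj y
  rw [smul_mulVec, smul_dotProduct, smul_dotProduct, sub_dotProduct,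
    ← conj_mulVec_dot_realToComplex]
  simp only [eval, map_div₀, map_mul, map_add, conj_I, conj_ofReal, map_one, map_ofNat,
    smul_eq_mul, ofReal_mul, ofReal_div, ofReal_one]
  linear_combination (I / (2 * h)) * h1 +
    ((φ.imC *ᵥ y.ofLp ⬝ᵥ y.ofLp : ℝ) : ℂ) / h * I_sq

theorem gaussian_value_eq (hh : 0 < h) (x z : Fin n → ℂ) :
    I / (2 * h) * (φ.A *ᵥ x ⬝ᵥ x - (starRingEnd ℂ) (φ.A *ᵥ z ⬝ᵥ z)) +
      1 / 4 * ((((1 / h) • φ.imC)⁻¹).map ofReal *ᵥ ((I / h : ℂ) • (φ.B *ᵥ x - star (φ.B *ᵥ z)))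
        ⬝ᵥ ((I / h : ℂ) • (φ.B *ᵥ x - star (φ.B *ᵥ z)))) =
    (φ.hol x x + (starRingEnd ℂ) (φ.hol z z) + 1 / 2 * φ.herm x z) / h := by
  have hinv : (((1 / h) • φ.imC)⁻¹).map ofReal = (h : ℂ) • φ.minv := by
    have hu : IsUnit (1 / h) := (one_div_pos.mpr hh).ne'.isUnit
    rw [minv]
    have : ((1 / h) • φ.imC)⁻¹ = h • φ.imC⁻¹ := by
      refine Matrix.inv_eq_left_inv ?_
      rw [smul_mul_smul_comm, Matrix.nonsing_inv_mul _ φ.isUnit_det_imC, mul_one_div_cancel hh.ne',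
        one_smul]
    rw [this]
    ext i j
    simp
  have hc : (h : ℂ) ≠ 0 := by exact_mod_cast hh.ne'
  have e1 : (starRingEnd ℂ) (φ.minv *ᵥ (φ.B *ᵥ z) ⬝ᵥ φ.B *ᵥ z) =
      φ.minv *ᵥ star (φ.B *ᵥ z) ⬝ᵥ star (φ.B *ᵥ z) := by
    rw [← star_minv_mulVec, star_dotProduct_star, dotProduct_comm]
    rfl
  have e2 : φ.minv *ᵥ star (φ.B *ᵥ z) ⬝ᵥ φ.B *ᵥ x = φ.herm x z := by
    rw [dot_symm φ.minv_symm, herm]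
  rw [hinv]
  simp only [smul_mulVec, mulVec_smul, smul_dotProduct, dotProduct_smul, smul_eq_mul, mulVec_sub,
    sub_dotProduct, dotProduct_sub, e2, hol, map_sub, map_mul, e1, map_div₀, conj_I, map_one,
    map_ofNat]
  rw [show φ.minv *ᵥ (φ.B *ᵥ x) ⬝ᵥ star (φ.B *ᵥ z) = φ.herm x z from rfl]
  field_simp
  linear_combination 2 * (φ.minv *ᵥ (φ.B *ᵥ x) ⬝ᵥ φ.B *ᵥ x - 2 * φ.herm x z
    + φ.minv *ᵥ star (φ.B *ᵥ z) ⬝ᵥ star (φ.B *ᵥ z)) * I_sq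

theorem posDef_inv_smul_imC (hh : 0 < h) : ((1 / h) • φ.imC).PosDef :=
  φ.imC_posDef.smul (one_div_pos.mpr hh)

theorem exp_phase_mul_coh (x z : Fin n → ℂ) (y : EuclideanSpace ℝ (Fin n)) :
    cexp (I * φ.eval x (realToComplex y) / h) * φ.coh h z y =
      cexp (I / (2 * h) * (φ.A *ᵥ x ⬝ᵥ x - (starRingEnd ℂ) (φ.A *ᵥ z ⬝ᵥ z))) *
      cexp (-((((1 / h) • φ.imC) *ᵥ y.ofLp ⬝ᵥ y.ofLp : ℝ) : ℂ) +
        ((I / h : ℂ) • (φ.B *ᵥ x - star (φ.B *ᵥ z))) ⬝ᵥ realToComplex y) := by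
  rw [coh, ← exp_conj, ← Complex.exp_add, phase_sub_conj_eq, Complex.exp_add]

theorem integrable_exp_phase_mul_coh (hh : 0 < h) (x z : Fin n → ℂ) :
    Integrable fun y : EuclideanSpace ℝ (Fin n) =>
      cexp (I * φ.eval x (realToComplex y) / h) * φ.coh h z y := by
  simp_rw [exp_phase_mul_coh]
  exact (integrable_gaussian (φ.posDef_inv_smul_imC hh) _).const_mul _

/-- The overlap of two coherent states is the polarized weight: this links the real side to the
reproducing kernel of the holomorphic side. -/
theorem integral_exp_phase_mul_coh (hh : 0 < h) (x z : Fin n → ℂ) :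
    ∫ y : EuclideanSpace ℝ (Fin n), cexp (I * φ.eval x (realToComplex y) / h) * φ.coh h z y =
      φ.cohConst h * φ.cohKer h x z := by
  simp_rw [exp_phase_mul_coh]
  rw [integral_const_mul, integral_gaussian_linear (φ.posDef_inv_smul_imC hh), cohKer,
    ← gaussian_value_eq φ hh, Complex.exp_add, cohConst]
  ring

end FBIPhase

/-! ### Mean value property, Fourier injectivity and the reproducing formula. -/

theorem measurePreserving_circle_smul {n : ℕ} (t : ℝ) :
    MeasurePreserving (fun s : Fin n → ℂ => cexp (t * I) • s) := by
  have h1 : MeasurePreserving (fun z : ℂ => cexp (t * I) * z) := by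
    have := (rotation ⟨cexp (t * I), by
      simp [Submonoid.unitSphere, Complex.norm_exp_ofReal_mul_I]⟩).measurePreserving
    exact this
  exact volume_preserving_pi (fun _ : Fin n => h1)

/-- Average over the rotations $s\mapsto e^{it}s$, which preserve both $\rho$ and Lebesgue measure.
After Fubini, the mean value property of $\zeta\mapsto G(\zeta s)$ on the unit circle replaces $G$
by $G(0)$. -/
theorem integral_entire_mul_of_rotation_invariant {n : ℕ} {G ρ : (Fin n → ℂ) → ℂ}
    (hG : Differentiable ℂ G) (hρ : ∀ (t : ℝ) s, ρ (cexp (t * I) • s) = ρ s)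
    (hi : Integrable fun s => G s * ρ s) : ∫ s, G s * ρ s = G 0 * ∫ s, ρ s := by
  set ν : Measure ℝ := volume.restrict (Set.Ioc 0 (2 * Real.pi)) with hν
  have hpi : 0 < 2 * Real.pi := by positivity
  have hmp : MeasurePreserving
      (fun p : ℝ × (Fin n → ℂ) => (p.1, cexp (p.1 * I) • p.2)) (ν.prod volume)
      (ν.prod volume) :=
    (MeasurePreserving.id ν).skew_product (g := fun (t : ℝ) (s : Fin n → ℂ) => cexp (t * I) • s)
      (Continuous.measurable (by simp only [Function.uncurry_def]; fun_prop))
      (ae_of_all _ fun t => (measurePreserving_circle_smul t).map_eq)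
  have hint : Integrable (fun p : ℝ × (Fin n → ℂ) => G (cexp (p.1 * I) • p.2) * ρ p.2)
      (ν.prod volume) := by
    have h1 : Integrable (fun p : ℝ × (Fin n → ℂ) => G p.2 * ρ p.2) (ν.prod volume) :=
      hi.comp_snd ν
    have h2 := hmp.integrable_comp_of_integrable h1
    refine h2.congr (ae_of_all _ fun p => ?_)
    simp only [Function.comp_apply, hρ]
  have e1 : ∫ t, (∫ s, G (cexp (t * I) • s) * ρ s) ∂ν = (2 * Real.pi : ℝ) • ∫ s, G s * ρ s := by
    have : ∀ t : ℝ, ∫ s, G (cexp (t * I) • s) * ρ s = ∫ s, G s * ρ s := fun t => by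
      have hemb : MeasurableEmbedding (fun s : Fin n → ℂ => cexp (t * I) • s) :=
        (Homeomorph.smulOfNeZero (cexp (t * I)) (Complex.exp_ne_zero _)).measurableEmbedding
      rw [← (measurePreserving_circle_smul t).integral_comp hemb (fun s => G s * ρ s)]
      simp only [hρ]
    simp_rw [this]
    rw [integral_const, hν]
    simp [hpi.le]
  have e2 : ∀ s, ∫ t, G (cexp (t * I) • s) * ρ s ∂ν = (2 * Real.pi : ℝ) • (G 0 * ρ s) := by
    intro s
    have hd : Differentiable ℂ fun ζ : ℂ => G (ζ • s) :=
      hG.comp (differentiable_id.smul_const s)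
    have hc := circleAverage_of_differentiable_on_off_countable (f := fun ζ : ℂ => G (ζ • s))
      (c := 0) (R := 1) Set.countable_empty hd.continuous.continuousOn
      (fun z _ => hd z)
    rw [Real.circleAverage_def, intervalIntegral.integral_of_le hpi.le] at hc
    simp only [circleMap, zero_add, ofReal_one, one_mul, zero_smul] at hc
    rw [integral_mul_const, ← smul_mul_assoc, ← hc, smul_inv_smul₀ hpi.ne']
  have e3 := integral_integral_swap (f := fun (t : ℝ) (s : Fin n → ℂ) =>
    G (cexp (t * I) • s) * ρ s) hint
  rw [e1] at e3
  simp_rw [e2] at e3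
  rw [integral_smul, integral_const_mul] at e3
  exact smul_right_injective _ hpi.ne' e3

-- A test function is the Fourier transform of a Schwartz function, so pairing it with `f` moves the
-- transform onto `f`, where it vanishes.
open scoped FourierTransform RealInnerProductSpace in
theorem ae_eq_zero_of_fourier_eq_zero {V : Type*} [NormedAddCommGroup V] [InnerProductSpace ℝ V]
    [FiniteDimensional ℝ V] [MeasurableSpace V] [BorelSpace V] {f : V → ℂ} (hf : Integrable f)
    (h0 : ∀ w, 𝓕 f w = 0) : f =ᵐ[volume] 0 := by
  refine ae_eq_zero_of_integral_contDiff_smul_eq_zero hf.locallyIntegrable fun g g_smooth g_cpt => ?_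
  have hg₁ : HasCompactSupport (Complex.ofRealCLM ∘ g) := g_cpt.comp_left rfl
  have hg₂ : ContDiff ℝ ∞ (Complex.ofRealCLM ∘ g) := by fun_prop
  set ψ : 𝓢(V, ℂ) := hg₁.toSchwartzMap hg₂ with hψ
  have h1 : 𝓕 (𝓕⁻ ψ) = ψ := FourierTransform.fourier_fourierInv_eq ψ
  have h2 := VectorFourier.integral_fourierIntegral_smul_eq_flip (L := innerₗ V)
    (μ := (volume : Measure V)) (ν := (volume : Measure V)) Real.continuous_fourierChar
    (by simpa using continuous_inner) (𝓕⁻ ψ : 𝓢(V, ℂ)).integrable hf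
  have h3 : ∀ w, VectorFourier.fourierIntegral Real.fourierChar volume (innerₗ V).flip f w = 0 := by
    intro w
    rw [← h0 w, Real.fourier_eq, VectorFourier.fourierIntegral]
    simp [real_inner_comm]
  have h4 : ∀ ξ, VectorFourier.fourierIntegral Real.fourierChar volume (innerₗ V)
      (𝓕⁻ ψ : 𝓢(V, ℂ)) ξ = (g ξ : ℂ) := by
    intro ξ
    have := congrFun (congrArg (fun (F : 𝓢(V, ℂ)) => (F : V → ℂ)) h1) ξ
    rw [SchwartzMap.fourier_coe] at this
    exact this
  simp only [h3, h4, smul_zero, integral_zero] at h2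
  simpa [Complex.real_smul] using h2

namespace FBIPhase

variable {n : ℕ} (φ : FBIPhase n) {h : ℝ}

/-- Up to a nonzero factor independent of $y$, the phase at $x=B^{-1}(-2\pi hw)$ is the character of
frequency $w$ times $e^{i\varphi(0,y)/h}$. Invertibility of $B$ makes every real frequency
available. -/
theorem ae_eq_zero_of_integral_exp_phase_eq_zero (hh : 0 < h)
    {d : EuclideanSpace ℝ (Fin n) → ℂ}
    (hi : Integrable fun y => cexp (I * φ.eval 0 (realToComplex y) / h) * d y)
    (h0 : ∀ x, ∫ y, cexp (I * φ.eval x (realToComplex y) / h) * d y = 0) :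
    d =ᵐ[volume] 0 := by
  have h1 := ae_eq_zero_of_fourier_eq_zero hi fun w => by
    have hB : IsUnit φ.B.det := isUnit_iff_ne_zero.mpr φ.det_ne_zero
    have hx := h0 (φ.B⁻¹ *ᵥ (-(2 * Real.pi * h : ℂ) • realToComplex w))
    set x := φ.B⁻¹ *ᵥ (-(2 * Real.pi * h : ℂ) • realToComplex w) with hxdef
    have hBx : φ.B *ᵥ x = -(2 * Real.pi * h : ℂ) • realToComplex w := by
      rw [hxdef, mulVec_mulVec, Matrix.mul_nonsing_inv _ hB, one_mulVec]
    have hc : (h : ℂ) ≠ 0 := by exact_mod_cast hh.ne'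
    have e : ∀ y : EuclideanSpace ℝ (Fin n), cexp (I * φ.eval x (realToComplex y) / h) * d y =
        cexp (I / (2 * h) * (φ.A *ᵥ x ⬝ᵥ x)) * (Real.fourierChar (-(inner ℝ y w)) •
          (cexp (I * φ.eval 0 (realToComplex y) / h) * d y)) := by
      intro y
      rw [Circle.smul_def, Real.fourierChar_apply, smul_eq_mul, ← mul_assoc, ← mul_assoc,
        ← Complex.exp_add, ← Complex.exp_add]
      congr 2
      simp only [eval, hBx, mulVec_zero, zero_dotProduct, smul_dotProduct, realToComplex_dot,
        real_inner_comm y w, smul_eq_mul]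
      push_cast
      field_simp
      ring
    simp_rw [e] at hx
    rw [integral_const_mul] at hx
    rw [Real.fourier_eq]
    exact (mul_eq_zero.mp hx).resolve_left (Complex.exp_ne_zero _)
  filter_upwards [h1] with y hy
  exact (mul_eq_zero.mp hy).resolve_left (Complex.exp_ne_zero _)

theorem measurable_weight_density : Measurable fun x => ENNReal.ofReal
    (Real.exp (-2 * φ.weight x / h)) := by
  have := φ.continuous_weight
  exact (by fun_prop : Continuous fun x => Real.exp (-2 * φ.weight x / h)).measurable.ennreal_ofReal

theorem integral_weightMeasure (f : (Fin n → ℂ) → ℂ) :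
    ∫ x, f x ∂(φ.weightMeasure h) = ∫ x, (Real.exp (-2 * φ.weight x / h) : ℂ) * f x := by
  rw [weightMeasure, integral_withDensity_eq_integral_toReal_smul φ.measurable_weight_density
    (ae_of_all _ fun x => ENNReal.ofReal_lt_top)]
  simp_rw [ENNReal.toReal_ofReal (Real.exp_pos _).le, Complex.real_smul]

theorem integrable_weightMeasure_iff {f : (Fin n → ℂ) → ℂ} :
    Integrable f (φ.weightMeasure h) ↔
      Integrable fun x => (Real.exp (-2 * φ.weight x / h) : ℂ) * f x := by
  rw [weightMeasure, integrable_withDensity_iff_integrable_smul' φ.measurable_weight_density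
    (ae_of_all _ fun x => ENNReal.ofReal_lt_top)]
  simp_rw [ENNReal.toReal_ofReal (Real.exp_pos _).le, Complex.real_smul]

theorem integrable_weightMeasure_real_iff {f : (Fin n → ℂ) → ℝ} :
    Integrable f (φ.weightMeasure h) ↔
      Integrable fun x => Real.exp (-2 * φ.weight x / h) * f x := by
  rw [weightMeasure, integrable_withDensity_iff_integrable_smul' φ.measurable_weight_density
    (ae_of_all _ fun x => ENNReal.ofReal_lt_top)]
  simp_rw [ENNReal.toReal_ofReal (Real.exp_pos _).le, smul_eq_mul]

theorem integral_weightMeasure_real (f : (Fin n → ℂ) → ℝ) :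
    ∫ x, f x ∂(φ.weightMeasure h) = ∫ x, Real.exp (-2 * φ.weight x / h) * f x := by
  rw [weightMeasure, integral_withDensity_eq_integral_toReal_smul φ.measurable_weight_density
    (ae_of_all _ fun x => ENNReal.ofReal_lt_top)]
  simp_rw [ENNReal.toReal_ofReal (Real.exp_pos _).le, smul_eq_mul]

theorem ac_weightMeasure : volume ≪ φ.weightMeasure h :=
  withDensity_absolutelyContinuous' φ.measurable_weight_density.aemeasurable
    (ae_of_all _ fun x => by simp [Real.exp_pos])

instance : SigmaFinite (φ.weightMeasure h) := by
  have : weightMeasure φ h = volume.withDensity (fun x =>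
    ((Real.exp (-2 * φ.weight x / h)).toNNReal : ENNReal)) := rfl
  rw [this]
  infer_instance

instance : (φ.weightMeasure h).IsOpenPosMeasure := φ.ac_weightMeasure.isOpenPosMeasure

/-- The antiholomorphic part of the weight cancels that of the kernel. What remains is a factor
holomorphic in `s`, equal to 1 at $s=0$, times a rotation-invariant Gaussian, as the mean value
argument requires. -/
theorem exp_weight_mul_cohKer (hh : 0 < h) (x s : Fin n → ℂ) :
    (Real.exp (-2 * φ.weight (x + s) / h) : ℂ) * φ.cohKer h x (x + s) =
      cexp ((φ.hol x x - φ.hol (x + s) (x + s) - 1 / 2 * φ.herm s x) / h) *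
        cexp (-(φ.herm s s / (2 * h))) := by
  have hc : (h : ℂ) ≠ 0 := by exact_mod_cast hh.ne'
  have hw : (φ.weight (x + s) : ℂ) = (φ.hol (x + s) (x + s)
      + (starRingEnd ℂ) (φ.hol (x + s) (x + s))) / 2 + 1 / 4 * φ.herm (x + s) (x + s) := by
    rw [weight_eq_hol_herm, Complex.add_conj, herm_self_eq φ (x + s)]
    push_cast
    simp only [ofReal_re]
    ring
  rw [cohKer, Complex.ofReal_exp, ← Complex.exp_add, ← Complex.exp_add]
  congr 1
  push_cast
  rw [hw]
  simp only [herm_add_left, herm_add_right]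
  field_simp
  ring

/-- The reproducing formula. -/
theorem integral_cohKer_mul (hh : 0 < h) {v : (Fin n → ℂ) → ℂ} (hv : Differentiable ℂ v)
    {x : Fin n → ℂ} (hi : Integrable (fun z => φ.cohKer h x z * v z) (φ.weightMeasure h)) :
    ∫ z, φ.cohKer h x z * v z ∂(φ.weightMeasure h) = φ.kap h * v x := by
  rw [integrable_weightMeasure_iff] at hi
  rw [integral_weightMeasure, ← integral_add_left_eq_self _ x]
  have e : ∀ s, (Real.exp (-2 * φ.weight (x + s) / h) : ℂ) * (φ.cohKer h x (x + s) * v (x + s)) =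
      (v (x + s) * cexp ((φ.hol x x - φ.hol (x + s) (x + s) - 1 / 2 * φ.herm s x) / h)) *
        cexp (-(φ.herm s s / (2 * h))) := fun s => by
    rw [← mul_assoc, φ.exp_weight_mul_cohKer hh]; ring
  have hi' := hi.comp_add_left x
  simp_rw [e] at hi' ⊢
  rw [integral_entire_mul_of_rotation_invariant ?_ ?_ hi', φ.integral_exp_neg_herm hh]
  · simp [herm]; ring
  · have h1 : Differentiable ℂ fun s => v (x + s) := hv.comp (differentiable_id.const_add x)
    have h2 : Differentiable ℂ fun s => φ.hol (x + s) (x + s) :=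
      φ.differentiable_hol_self.comp (differentiable_id.const_add x)
    have h3 := φ.differentiable_herm_left x
    simp only [div_eq_mul_inv]
    exact h1.mul (((h2.const_sub _).sub (h3.const_mul _)).mul_const _).cexp
  · intro t s
    rw [herm_smul_left, herm_smul_right, ← mul_assoc]
    have : cexp (t * I) * star (cexp (t * I)) = 1 := by
      rw [Complex.star_def, Complex.mul_conj, Complex.normSq_eq_norm_sq,
        Complex.norm_exp_ofReal_mul_I]
      simp
    rw [this, one_mul]

end FBIPhase

/-! ### Isometries from equal Gram matrices. -/

section Isometry

variable {X E F : Type*} [NormedAddCommGroup E] [InnerProductSpace ℂ E] [NormedAddCommGroup F]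
  [InnerProductSpace ℂ F]

theorem inner_linearCombination_eq {u : X → E} {w : X → F}
    (huw : ∀ x z, inner ℂ (u x) (u z) = inner ℂ (w x) (w z)) (f g : X →₀ ℂ) :
    inner ℂ (Finsupp.linearCombination ℂ u f) (Finsupp.linearCombination ℂ u g) =
      inner ℂ (Finsupp.linearCombination ℂ w f) (Finsupp.linearCombination ℂ w g) := by
  simp only [Finsupp.linearCombination_apply, Finsupp.sum_inner, Finsupp.inner_sum,
    inner_smul_left, inner_smul_right, huw]

/-- Equal Gram matrices make the map of linear combinations norm preserving, even where the family
`u` has linear relations; density then extends it. -/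
theorem exists_linearIsometry_of_inner_eq [CompleteSpace F] {u : X → E} {w : X → F}
    (huw : ∀ x z, inner ℂ (u x) (u z) = inner ℂ (w x) (w z))
    (hu : DenseRange (Finsupp.linearCombination ℂ u)) :
    ∃ T : E →ₗᵢ[ℂ] F, ∀ x, T (u x) = w x := by
  have hn : ∀ f : X →₀ ℂ, ‖Finsupp.linearCombination ℂ w f‖ =
      ‖Finsupp.linearCombination ℂ u f‖ := fun f => by
    rw [@norm_eq_sqrt_re_inner ℂ, @norm_eq_sqrt_re_inner ℂ _ _ _ _
      (Finsupp.linearCombination ℂ u f), inner_linearCombination_eq huw]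
  have hext := fun f => LinearMap.extendOfNorm_eq (f := Finsupp.linearCombination ℂ w) hu
    ⟨1, fun x => by rw [hn, one_mul]⟩ f
  set T := (Finsupp.linearCombination ℂ w).extendOfNorm (Finsupp.linearCombination ℂ u) with hT
  refine ⟨⟨T.toLinearMap, fun v => ?_⟩, fun x => ?_⟩
  · refine hu.induction_on (p := fun v => ‖T.toLinearMap v‖ = ‖v‖) v ?_ fun f => ?_
    · exact isClosed_eq (continuous_norm.comp T.continuous) continuous_norm
    · change ‖T _‖ = _
      rw [hext, hn]
  · have := hext (Finsupp.single x 1)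
    simpa using this

end Isometry

theorem denseRange_linearCombination {X E : Type*} [NormedAddCommGroup E] [InnerProductSpace ℂ E]
    [CompleteSpace E] {u : X → E} (hu : ∀ v, (∀ x, inner ℂ (u x) v = 0) → v = 0) :
    DenseRange (Finsupp.linearCombination ℂ u) := by
  have h1 : (Submodule.span ℂ (Set.range u)).topologicalClosure = ⊤ := by
    rw [Submodule.topologicalClosure_eq_top_iff, Submodule.eq_bot_iff]
    intro v hv
    refine hu v fun x => ?_
    exact (Submodule.mem_orthogonal _ _).mp hv _ (Submodule.subset_span ⟨x, rfl⟩)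
  rw [DenseRange, ← LinearMap.coe_range, Finsupp.range_linearCombination]
  exact Submodule.dense_iff_topologicalClosure_eq_top.mpr h1

/-! ### Holomorphy of Laplace-type integrals. -/

section Laplace

variable {n : ℕ}

/-- The linear form `w ↦ ∑ w_j y_j`. -/
def dotCLM (y : EuclideanSpace ℝ (Fin n)) : (Fin n → ℂ) →L[ℂ] ℂ :=
  ∑ j, (y j : ℂ) • ContinuousLinearMap.proj j

theorem dotCLM_apply (y : EuclideanSpace ℝ (Fin n)) (w : Fin n → ℂ) :
    dotCLM y w = w ⬝ᵥ realToComplex y := by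
  simp [dotCLM, dotProduct, realToComplex, mul_comm]

theorem norm_dotCLM_le (y : EuclideanSpace ℝ (Fin n)) : ‖dotCLM y‖ ≤ n * ‖y‖ := by
  refine (norm_sum_le _ _).trans ?_
  have : ∀ j ∈ Finset.univ, ‖(y j : ℂ) • (ContinuousLinearMap.proj (R := ℂ)
      (φ := fun _ : Fin n => ℂ) j)‖ ≤ ‖y‖ := fun j _ => by
    rw [norm_smul, Complex.norm_real]
    have h1 : ‖(ContinuousLinearMap.proj (R := ℂ) (φ := fun _ : Fin n => ℂ) j)‖ ≤ 1 :=
      ContinuousLinearMap.opNorm_le_bound _ zero_le_one fun x => by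
        rw [one_mul]; exact norm_le_pi_norm x j
    calc ‖y j‖ * _ ≤ ‖y‖ * 1 := by
          gcongr
          exact PiLp.norm_apply_le y j
      _ = ‖y‖ := mul_one _
  refine (Finset.sum_le_sum this).trans ?_
  simp

theorem continuous_dotCLM : Continuous (dotCLM : EuclideanSpace ℝ (Fin n) → _) := by
  unfold dotCLM
  fun_prop

theorem differentiable_integral_exp_dot {f : EuclideanSpace ℝ (Fin n) → ℂ}
    (hf : AEStronglyMeasurable f) (hi : ∀ a : ℝ, Integrable fun y => Real.exp (a * ‖y‖) * ‖f y‖) :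
    Differentiable ℂ fun w : Fin n → ℂ => ∫ y, cexp (w ⬝ᵥ realToComplex y) * f y := by
  intro w₀
  -- The first summand controls the exponential on the unit ball about `w₀`; the extra $n$ absorbs
  -- the factor `‖dotCLM y‖` $\le e^{n\|y\|}$ created by differentiation.
  set a : ℝ := n * (‖w₀‖ + 1) + n with ha
  have hE : ∀ (w : Fin n → ℂ) (y : EuclideanSpace ℝ (Fin n)),
      ‖cexp (dotCLM y w)‖ ≤ Real.exp (n * ‖w‖ * ‖y‖) := fun w y => by
    rw [Complex.norm_exp]
    gcongr
    calc (dotCLM y w).re ≤ ‖dotCLM y w‖ := Complex.re_le_norm _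
      _ ≤ ‖dotCLM y‖ * ‖w‖ := (dotCLM y).le_opNorm w
      _ ≤ n * ‖y‖ * ‖w‖ := by gcongr; exact norm_dotCLM_le y
      _ = _ := by ring
  have hm : ∀ w : Fin n → ℂ, AEStronglyMeasurable (fun y => cexp (dotCLM y w) * f y) := fun w => by
    refine AEStronglyMeasurable.mul (Continuous.aestronglyMeasurable ?_) hf
    have := continuous_dotCLM (n := n)
    fun_prop
  simp_rw [← dotCLM_apply]
  refine (hasFDerivAt_integral_of_dominated_of_fderiv_le (𝕜 := ℂ)
    (F' := fun w y => (cexp (dotCLM y w) * f y) • dotCLM y)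
    (bound := fun y => Real.exp (a * ‖y‖) * ‖f y‖)
    (Metric.ball_mem_nhds w₀ one_pos) (Filter.Eventually.of_forall hm) ?_ ?_ ?_ (hi a) ?_
    ).differentiableAt
  · refine (hi (n * ‖w₀‖)).mono' (hm w₀) (ae_of_all _ fun y => ?_)
    rw [norm_mul]
    gcongr
    exact hE _ _
  · exact (hm w₀).smul continuous_dotCLM.aestronglyMeasurable
  · refine ae_of_all _ fun y w hw => ?_
    have hw' : ‖w‖ ≤ ‖w₀‖ + 1 := by
      have := norm_sub_norm_le w w₀
      rw [Metric.mem_ball, dist_eq_norm] at hw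
      linarith
    rw [norm_smul, norm_mul]
    calc ‖cexp (dotCLM y w)‖ * ‖f y‖ * ‖dotCLM y‖
        ≤ Real.exp (n * (‖w₀‖ + 1) * ‖y‖) * ‖f y‖ * Real.exp (n * ‖y‖) := by
          gcongr
          · refine (hE w y).trans ?_
            gcongr
          · refine (norm_dotCLM_le y).trans ?_
            linarith [Real.add_one_le_exp (n * ‖y‖)]
      _ = Real.exp (a * ‖y‖) * ‖f y‖ := by
          rw [mul_right_comm, ← Real.exp_add, ha]
          ring_nf
  · refine ae_of_all _ fun y w _ => ?_
    have h1 := ((dotCLM y).hasFDerivAt (x := w)).cexp.mul_const (f y)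
    refine h1.congr_fderiv ?_
    rw [smul_smul, mul_comm]

end Laplace

/-! ### Unitarity of the FBI transform. -/

namespace FBIPhase

variable {n : ℕ} (φ : FBIPhase n) {h : ℝ}

@[fun_prop]
theorem continuous_eval {X : Type*} [TopologicalSpace X] {f g : X → Fin n → ℂ}
    (hf : Continuous f) (hg : Continuous g) : Continuous fun x => φ.eval (f x) (g x) := by
  simp only [eval, mulVec, dotProduct]
  fun_prop

theorem continuous_coh (x : Fin n → ℂ) : Continuous (φ.coh h x) := by
  unfold coh
  exact Complex.continuous_conj.comp (by fun_prop)

theorem memLp_coh (hh : 0 < h) (x : Fin n → ℂ) : MemLp (φ.coh h x) 2 := by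
  rw [memLp_two_iff_integrable_sq_norm (φ.continuous_coh x).aestronglyMeasurable]
  refine (φ.integrable_exp_phase_mul_coh hh x x).norm.congr (ae_of_all _ fun y => ?_)
  simp only [coh, norm_mul, RCLike.norm_conj]
  ring

theorem memLp_cohKer (hh : 0 < h) (x : Fin n → ℂ) :
    MemLp (fun z => φ.cohKer h z x) 2 (φ.weightMeasure h) := by
  have hc : Continuous fun z => φ.cohKer h z x := by
    unfold cohKer
    fun_prop
  rw [memLp_two_iff_integrable_sq_norm hc.aestronglyMeasurable, integrable_weightMeasure_real_iff]
  have h1 := ((φ.integrable_exp_neg_herm (c := 1 / (2 * h)) (by positivity)).comp_sub_right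
    x).const_mul (Real.exp (2 * φ.weight x / h))
  refine h1.congr (ae_of_all _ fun z => ?_)
  simp only
  rw [norm_cohKer, ← Real.exp_nat_mul, ← Real.exp_add, ← Real.exp_add]
  congr 1
  push_cast
  field_simp
  ring

/-- The coherent state as an element of `L²(ℝⁿ)`. -/
def cohLp (hh : 0 < h) (x : Fin n → ℂ) : L2Real n := (φ.memLp_coh hh x).toLp

/-- The coherent-state kernel as an element of `L²_Φ`. -/
def kerLp (hh : 0 < h) (x : Fin n → ℂ) : φ.L2Weight h := (φ.memLp_cohKer hh x).toLp

theorem inner_cohLp (hh : 0 < h) (x : Fin n → ℂ) (u : L2Real n) :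
    inner ℂ (φ.cohLp hh x) u =
      ∫ y, cexp (I * φ.eval x (realToComplex y) / h) * u y := by
  rw [MeasureTheory.L2.inner_def]
  refine integral_congr_ae ?_
  filter_upwards [(φ.memLp_coh hh x).coeFn_toLp] with y hy
  rw [cohLp, hy, RCLike.inner_apply, coh, Complex.conj_conj, mul_comm]

theorem inner_kerLp (hh : 0 < h) (x : Fin n → ℂ) (f : φ.L2Weight h) :
    inner ℂ (φ.kerLp hh x) f = ∫ z, φ.cohKer h x z * f z ∂(φ.weightMeasure h) := by
  rw [MeasureTheory.L2.inner_def]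
  refine integral_congr_ae ?_
  filter_upwards [(φ.memLp_cohKer hh x).coeFn_toLp] with y hy
  rw [kerLp, hy, RCLike.inner_apply, conj_cohKer, mul_comm]

theorem integrable_cohKer_mul (hh : 0 < h) (x : Fin n → ℂ) (f : φ.L2Weight h) :
    Integrable (fun z => φ.cohKer h x z * f z) (φ.weightMeasure h) := by
  have := (φ.memLp_cohKer hh x).star.integrable_mul (Lp.memLp f)
  refine this.congr (ae_of_all _ fun z => ?_)
  simp only [Pi.mul_apply, Pi.star_apply, Complex.star_def, conj_cohKer]

theorem differentiable_cohKer (x : Fin n → ℂ) : Differentiable ℂ fun z => φ.cohKer h z x := by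
  unfold cohKer
  have h1 := φ.differentiable_hol_self
  have h3 := φ.differentiable_herm_left x
  simp only [div_eq_mul_inv _ (h : ℂ)]
  exact (((h1.add_const _).add (h3.const_mul _)).mul_const _).cexp

/-- The reproducing formula in `H_Φ`. -/
theorem inner_kerLp_eq (hh : 0 < h) (x : Fin n → ℂ) {f : φ.L2Weight h} {v : (Fin n → ℂ) → ℂ}
    (hv : Differentiable ℂ v) (hf : f =ᵐ[φ.weightMeasure h] v) :
    inner ℂ (φ.kerLp hh x) f = φ.kap h * v x := by
  have he : (fun z => φ.cohKer h x z * f z) =ᵐ[φ.weightMeasure h]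
      fun z => φ.cohKer h x z * v z := by
    filter_upwards [hf] with z hz
    rw [hz]
  rw [inner_kerLp, integral_congr_ae he]
  exact φ.integral_cohKer_mul hh hv ((φ.integrable_cohKer_mul hh x f).congr he)

theorem inner_kerLp_kerLp (hh : 0 < h) (x z : Fin n → ℂ) :
    inner ℂ (φ.kerLp hh x) (φ.kerLp hh z) = φ.kap h * φ.cohKer h x z :=
  φ.inner_kerLp_eq hh x (φ.differentiable_cohKer z) (φ.memLp_cohKer hh z).coeFn_toLp

theorem inner_cohLp_cohLp (hh : 0 < h) (x z : Fin n → ℂ) :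
    inner ℂ (φ.cohLp hh x) (φ.cohLp hh z) = φ.cohConst h * φ.cohKer h x z := by
  rw [inner_cohLp, ← φ.integral_exp_phase_mul_coh hh]
  refine integral_congr_ae ?_
  filter_upwards [(φ.memLp_coh hh z).coeFn_toLp] with y hy
  rw [cohLp, hy]

/-- The normalizing factor of the transform. -/
def fbiScale (h : ℝ) : ℝ := φ.normConst * h ^ (-3 * (n : ℝ) / 4)

theorem fbiIntegral_eq_inner (hh : 0 < h) (u : L2Real n) (x : Fin n → ℂ) :
    φ.fbiIntegral h u x = φ.fbiScale h * inner ℂ (φ.cohLp hh x) u := by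
  rw [inner_cohLp, fbiIntegral, fbiScale, ofReal_mul]

theorem cohConst_pos (hh : 0 < h) : 0 < φ.cohConst h :=
  div_pos (Real.rpow_pos_of_pos Real.pi_pos _)
    (Real.sqrt_pos.mpr (φ.posDef_inv_smul_imC hh).det_pos)

theorem fbiScale_pos (hh : 0 < h) : 0 < φ.fbiScale h := by
  have h1 : 0 < (φ.C.map Complex.im).det := φ.imC_posDef.det_pos
  have h2 := norm_pos_iff.mpr φ.det_ne_zero
  have h3 := Real.pi_pos
  unfold fbiScale normConst
  positivity

/-- This is what determines `normConst`: it equates the Gram matrix of the coherent states with that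
of their images. -/
theorem fbiScale_sq_mul (hh : 0 < h) : φ.fbiScale h ^ 2 * φ.cohConst h * φ.kap h = 1 := by
  have h1 : 0 < φ.imC.det := φ.imC_posDef.det_pos
  have h2 := norm_pos_iff.mpr φ.det_ne_zero
  have h3 := Real.pi_pos
  have hsq : ∀ (a b : ℝ), 0 < a → (a ^ b) ^ 2 = a ^ (2 * b) := fun a b ha => by
    rw [← Real.rpow_natCast, ← Real.rpow_mul ha.le]; congr 1; push_cast; ring
  have e1 : φ.fbiScale h ^ 2 = (2 : ℝ) ^ (-(n : ℝ)) * Real.pi ^ (-3 * (n : ℝ) / 2) *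
      φ.imC.det ^ (-(1 / 2) : ℝ) * ‖φ.B.det‖ ^ 2 * h ^ (-3 * (n : ℝ) / 2) := by
    rw [fbiScale, normConst, ← imC]
    simp only [mul_pow]
    rw [hsq _ _ two_pos, hsq _ _ h3, hsq _ _ h1, hsq _ _ hh]
    ring_nf
  have e2 : φ.cohConst h = Real.pi ^ ((n : ℝ) / 2) * h ^ ((n : ℝ) / 2) *
      φ.imC.det ^ (-(1 / 2) : ℝ) := by
    rw [cohConst, det_smul, Fintype.card_fin, Real.sqrt_eq_rpow,
      Real.mul_rpow (by positivity) h1.le, one_div h, ← Real.rpow_natCast, ← Real.rpow_mul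
      (inv_pos.mpr hh).le, Real.inv_rpow hh.le, Real.rpow_neg h1.le]
    field_simp
  have e3 : φ.kap h = 2 ^ (n : ℝ) * Real.pi ^ (n : ℝ) * h ^ (n : ℝ) *
      φ.imC.det ^ (1 : ℝ) / ‖φ.B.det‖ ^ 2 := by
    rw [kap, mul_pow, mul_pow]
    simp only [Real.rpow_natCast, Real.rpow_one]
  rw [e1, e2, e3]
  calc _ = (2 ^ (-(n : ℝ)) * 2 ^ (n : ℝ)) *
        (Real.pi ^ (-3 * (n : ℝ) / 2) * Real.pi ^ ((n : ℝ) / 2) * Real.pi ^ (n : ℝ)) *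
        (φ.imC.det ^ (-(1 / 2) : ℝ) * φ.imC.det ^ (-(1 / 2) : ℝ) * φ.imC.det ^ (1 : ℝ)) *
        (h ^ (-3 * (n : ℝ) / 2) * h ^ ((n : ℝ) / 2) * h ^ (n : ℝ)) := by
        field_simp
    _ = 1 := by
      simp only [← Real.rpow_add two_pos, ← Real.rpow_add h3, ← Real.rpow_add h1,
        ← Real.rpow_add hh]
      have t1 : -(n : ℝ) + n = 0 := by ring
      have t2 : -3 * (n : ℝ) / 2 + n / 2 + n = 0 := by ring
      have t3 : (-(1 / 2) : ℝ) + -(1 / 2) + 1 = 0 := by ring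
      rw [t1, t2, t3]
      simp

theorem eq_zero_of_inner_cohLp (hh : 0 < h) (u : L2Real n)
    (hu : ∀ x, inner ℂ (φ.cohLp hh x) u = 0) : u = 0 := by
  rw [Lp.eq_zero_iff_ae_eq_zero]
  simp only [inner_cohLp] at hu
  refine φ.ae_eq_zero_of_integral_exp_phase_eq_zero hh ?_ hu
  refine ((φ.memLp_coh hh 0).star.integrable_mul (Lp.memLp u)).congr (ae_of_all _ fun y => ?_)
  simp [coh]

theorem exists_isometry (hh : 0 < h) : ∃ T : L2Real n →ₗᵢ[ℂ] φ.L2Weight h, ∀ x,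
    T (φ.cohLp hh x) = ((φ.fbiScale h * φ.cohConst h : ℝ) : ℂ) • φ.kerLp hh x := by
  refine exists_linearIsometry_of_inner_eq (fun x z => ?_)
    (denseRange_linearCombination (φ.eq_zero_of_inner_cohLp hh))
  rw [inner_smul_left, inner_smul_right, inner_kerLp_kerLp, inner_cohLp_cohLp, conj_ofReal]
  have : (φ.cohConst h : ℂ) = φ.cohConst h * (φ.fbiScale h ^ 2 * φ.cohConst h * φ.kap h : ℝ) := by
    rw [φ.fbiScale_sq_mul hh]; simp
  rw [this]
  push_cast
  ring

theorem fbiIntegral_eq_inner_ker (hh : 0 < h) {T : L2Real n →ₗᵢ[ℂ] φ.L2Weight h}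
    (hT : ∀ x, T (φ.cohLp hh x) = ((φ.fbiScale h * φ.cohConst h : ℝ) : ℂ) • φ.kerLp hh x)
    (u : L2Real n) (x : Fin n → ℂ) :
    (φ.kap h : ℂ) * φ.fbiIntegral h u x = inner ℂ (φ.kerLp hh x) (T u) := by
  rw [fbiIntegral_eq_inner φ hh, ← T.inner_map_map, hT, inner_smul_left, conj_ofReal]
  have := φ.fbiScale_sq_mul hh
  calc _ = ((φ.fbiScale h ^ 2 * φ.cohConst h * φ.kap h : ℝ) : ℂ) *
      inner ℂ (φ.kerLp hh x) (T u) := by push_cast; ring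
    _ = _ := by rw [this]; simp

/-- On the span of the coherent states both sides are explicit combinations of kernels. In general,
$L^2$ convergence of the images gives almost everywhere convergence along a subsequence, while the
FBI integral, being an inner product, converges at every point. -/
theorem isometry_ae_eq (hh : 0 < h) {T : L2Real n →ₗᵢ[ℂ] φ.L2Weight h}
    (hT : ∀ x, T (φ.cohLp hh x) = ((φ.fbiScale h * φ.cohConst h : ℝ) : ℂ) • φ.kerLp hh x)
    (u : L2Real n) : T u =ᵐ[φ.weightMeasure h] φ.fbiIntegral h u := by
  have hk : (φ.kap h : ℂ) ≠ 0 := by exact_mod_cast (φ.kap_pos hh).ne'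
  have hP : ∀ v : L2Real n, φ.fbiIntegral h v =
      fun x => (φ.kap h : ℂ)⁻¹ * inner ℂ (φ.kerLp hh x) (T v) := fun v => by
    funext x
    rw [← φ.fbiIntegral_eq_inner_ker hh hT, inv_mul_cancel_left₀ hk]
  have hspan : ∀ f : (Fin n → ℂ) →₀ ℂ, T (Finsupp.linearCombination ℂ (φ.cohLp hh) f)
      =ᵐ[φ.weightMeasure h] φ.fbiIntegral h (Finsupp.linearCombination ℂ (φ.cohLp hh) f) := by
    intro f
    induction f using Finsupp.induction_linear with
    | zero =>
      rw [map_zero, map_zero, hP]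
      filter_upwards [Lp.coeFn_zero ℂ 2 (φ.weightMeasure h)] with x hx
      rw [hx]
      simp
    | add f g hf hg =>
      rw [map_add, map_add]
      rw [hP] at hf hg ⊢
      filter_upwards [hf, hg, Lp.coeFn_add (T (Finsupp.linearCombination ℂ (φ.cohLp hh) f))
        (T (Finsupp.linearCombination ℂ (φ.cohLp hh) g))] with x h1 h2 h3
      rw [h3, Pi.add_apply, h1, h2, map_add, inner_add_right]
      ring
    | single z c =>
      rw [hP]
      simp only [Finsupp.linearCombination_single, map_smul, hT, inner_smul_right,
        inner_kerLp_kerLp]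
      filter_upwards [Lp.coeFn_smul c (((φ.fbiScale h * φ.cohConst h : ℝ) : ℂ) • φ.kerLp hh z),
        Lp.coeFn_smul ((φ.fbiScale h * φ.cohConst h : ℝ) : ℂ) (φ.kerLp hh z),
        (φ.memLp_cohKer hh z).coeFn_toLp] with x h1 h2 h3
      rw [h1, Pi.smul_apply, h2, Pi.smul_apply, kerLp, h3, smul_eq_mul, smul_eq_mul]
      field_simp
  have hd := denseRange_linearCombination (φ.eq_zero_of_inner_cohLp hh)
  obtain ⟨s, hs, hlim⟩ := mem_closure_iff_seq_limit.mp (hd u)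
  choose f hf using hs
  have hlimT : Filter.Tendsto (fun j => T (s j)) Filter.atTop (nhds (T u)) :=
    (T.continuous.tendsto u).comp hlim
  obtain ⟨ns, hns, hae⟩ := (tendstoInMeasure_of_tendsto_Lp hlimT).exists_seq_tendsto_ae
  have hall : ∀ᵐ x ∂(φ.weightMeasure h), ∀ j, T (s j) x = φ.fbiIntegral h (s j) x :=
    ae_all_iff.mpr fun j => by rw [← hf]; exact hspan (f j)
  filter_upwards [hae, hall] with x h1 h2
  refine tendsto_nhds_unique h1 ?_
  simp only [h2, hP]
  have hin : Filter.Tendsto (fun j => inner ℂ (φ.kerLp hh x) (T (s (ns j)))) Filter.atTop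
      (nhds (inner ℂ (φ.kerLp hh x) (T u))) :=
    tendsto_const_nhds.inner (hlimT.comp hns.tendsto_atTop)
  exact hin.const_mul _

theorem exists_imC_lower_bound : ∃ c > 0, ∀ y : EuclideanSpace ℝ (Fin n),
    c * ‖y‖ ^ 2 ≤ φ.imC *ᵥ y.ofLp ⬝ᵥ y.ofLp := by
  refine exists_pos_mul_norm_sq_le ?_ (fun t y => ?_) fun y hy => ?_
  · have h1 : Continuous fun y : EuclideanSpace ℝ (Fin n) => y.ofLp := PiLp.continuous_ofLp 2 _
    exact (continuous_const.matrix_mulVec h1).dotProduct h1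
  · simp only [WithLp.ofLp_smul, mulVec_smul, smul_dotProduct, dotProduct_smul,
      smul_eq_mul]
    ring
  · exact φ.imC_posDef.pos_dot fun h0 => hy (WithLp.ofLp_injective 2 h0)

theorem norm_exp_phase_zero (y : EuclideanSpace ℝ (Fin n)) :
    ‖cexp (I * φ.eval 0 (realToComplex y) / h)‖ =
      Real.exp (-(φ.imC *ᵥ y.ofLp ⬝ᵥ y.ofLp) / (2 * h)) := by
  rw [norm_exp_phase]
  have h1 : φ.imB 0 = 0 := by ext; simp [imB]
  have h2 : φ.weight 0 = 0 := by rw [weight_eq_hol_herm]; simp [hol, herm]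
  rw [h1, h2, mulVec_zero, add_zero]
  ring_nf

theorem integrable_exp_mul_norm_mul (hh : 0 < h) (u : L2Real n) (a : ℝ) :
    Integrable fun y => Real.exp (a * ‖y‖) *
      ‖cexp (I * φ.eval 0 (realToComplex y) / h) * u y‖ := by
  obtain ⟨c, hc, hb⟩ := φ.exists_imC_lower_bound
  set d := c / (2 * h) with hd
  have hdpos : 0 < d := by positivity
  have hm : Continuous fun y : EuclideanSpace ℝ (Fin n) =>
      Real.exp (a * ‖y‖ - d * ‖y‖ ^ 2) := by fun_prop
  have hL : MemLp (fun y : EuclideanSpace ℝ (Fin n) => Real.exp (a * ‖y‖ - d * ‖y‖ ^ 2)) 2 := by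
    rw [memLp_two_iff_integrable_sq_norm hm.aestronglyMeasurable]
    -- Squaring doubles the exponent. Half of the resulting Gaussian is kept, and
    -- $2a\|y\|-d\|y\|^2\le a^2/d$ bounds the rest.
    refine ((integrable_exp_neg_mul_norm_sq volume hdpos).const_mul
      (Real.exp (a ^ 2 / d))).mono' (by fun_prop) (ae_of_all _ fun y => ?_)
    rw [Real.norm_of_nonneg (by positivity), Real.norm_of_nonneg (Real.exp_pos _).le,
      ← Real.exp_nat_mul, ← Real.exp_add]
    gcongr
    have : 0 ≤ d * (‖y‖ - a / d) ^ 2 := by positivity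
    have e : d * (‖y‖ - a / d) ^ 2 = d * ‖y‖ ^ 2 - 2 * a * ‖y‖ + a ^ 2 / d := by
      field_simp
      ring
    push_cast
    linarith
  refine (hL.integrable_mul (Lp.memLp u).norm).mono' ?_ (ae_of_all _ fun y => ?_)
  · refine AEStronglyMeasurable.mul (by fun_prop) (AEStronglyMeasurable.norm ?_)
    exact AEStronglyMeasurable.mul (Continuous.aestronglyMeasurable (by fun_prop))
      (Lp.memLp u).aestronglyMeasurable
  · rw [Real.norm_of_nonneg (by positivity), norm_mul, norm_exp_phase_zero, ← mul_assoc,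
      ← Real.exp_add, Pi.mul_apply]
    gcongr
    have := hb y
    have e : d * ‖y‖ ^ 2 = c * ‖y‖ ^ 2 / (2 * h) := by rw [hd]; ring
    rw [e, sub_eq_add_neg, ← neg_div]
    gcongr

theorem exp_phase_factor (x : Fin n → ℂ) (y : EuclideanSpace ℝ (Fin n)) :
    cexp (I * φ.eval x (realToComplex y) / h) = cexp (I / (2 * h) * (φ.A *ᵥ x ⬝ᵥ x)) *
      (cexp ((I / h : ℂ) • (φ.B *ᵥ x) ⬝ᵥ realToComplex y) *
        cexp (I * φ.eval 0 (realToComplex y) / h)) := by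
  rw [← Complex.exp_add, ← Complex.exp_add]
  congr 1
  simp only [eval, mulVec_zero, zero_dotProduct, smul_dotProduct, smul_eq_mul]
  ring

theorem differentiable_fbiIntegral (hh : 0 < h) (u : L2Real n) :
    Differentiable ℂ (φ.fbiIntegral h u) := by
  have h1 := differentiable_integral_exp_dot
    (f := fun y => cexp (I * φ.eval 0 (realToComplex y) / h) * u y)
    (AEStronglyMeasurable.mul (Continuous.aestronglyMeasurable (by fun_prop))
      (Lp.memLp u).aestronglyMeasurable) (φ.integrable_exp_mul_norm_mul hh u)
  have h2 : Differentiable ℂ fun x : Fin n → ℂ => (I / h : ℂ) • (φ.B *ᵥ x) :=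
    (Matrix.mulVecLin φ.B).toContinuousLinearMap.differentiable.const_smul (I / h : ℂ)
  have h3 : Differentiable ℂ fun x : Fin n → ℂ => cexp (I / (2 * h) * (φ.A *ᵥ x ⬝ᵥ x)) := by
    simp only [mulVec, dotProduct]
    fun_prop
  have h4 := (h3.mul (h1.comp h2)).const_mul (φ.fbiScale h : ℂ)
  refine (congrArg (Differentiable ℂ) ?_).mpr h4
  funext x
  rw [fbiIntegral, fbiScale, ofReal_mul]
  congr 1
  simp only [Pi.mul_apply, Function.comp_apply]
  rw [← integral_const_mul]
  refine integral_congr_ae (ae_of_all _ fun y => ?_)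
  simp only
  rw [exp_phase_factor]
  ring

/-- The value on coherent states is kept in the conclusion because it later turns point values of
FBI integrals into pairings with `kerLp`. -/
theorem exists_isFBITransform (hh : 0 < h) : ∃ T : L2Real n ≃ₗᵢ[ℂ] φ.HPhi h,
    φ.IsFBITransform h T ∧
    ∀ x, (T (φ.cohLp hh x) : φ.L2Weight h) =
      ((φ.fbiScale h * φ.cohConst h : ℝ) : ℂ) • φ.kerLp hh x := by
  obtain ⟨T₀, hT₀⟩ := φ.exists_isometry hh
  have hae := φ.isometry_ae_eq hh hT₀
  have hmem : ∀ u, T₀.toLinearMap u ∈ φ.HPhi h := fun u =>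
    ⟨_, φ.differentiable_fbiIntegral hh u, hae u⟩
  set T₁ : L2Real n →ₗᵢ[ℂ] φ.HPhi h :=
    ⟨T₀.toLinearMap.codRestrict (φ.HPhi h) hmem, fun u => T₀.norm_map u⟩ with hT₁
  have hk : (φ.kap h : ℂ) ≠ 0 := by exact_mod_cast (φ.kap_pos hh).ne'
  have hs : Function.Surjective T₁ := by
    intro f
    -- With $u=T_0^*f$ the difference $f-T_0u$ is holomorphic and orthogonal to the range of $T_0$,
    -- hence to every reproducing kernel, so all its values vanish.
    set u : L2Real n := ContinuousLinearMap.adjoint T₀.toContinuousLinearMap (f : φ.L2Weight h)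
      with hu
    refine ⟨u, Subtype.ext ?_⟩
    have hmem2 : (f : φ.L2Weight h) - T₀ u ∈ φ.HPhi h := sub_mem f.2 (hmem u)
    obtain ⟨g, hg, hgf⟩ := hmem2
    have hg0 : ∀ x, g x = 0 := fun x => by
      have h1 := φ.inner_kerLp_eq hh x hg hgf
      have h2 : inner ℂ (T₀ (φ.cohLp hh x)) ((f : φ.L2Weight h) - T₀ u) = 0 := by
        rw [inner_sub_right, T₀.inner_map_map, hu, ContinuousLinearMap.adjoint_inner_right]
        simp
      rw [hT₀, inner_smul_left, h1, conj_ofReal] at h2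
      have h3 : ((φ.fbiScale h * φ.cohConst h : ℝ) : ℂ) ≠ 0 := by
        exact_mod_cast (mul_pos (φ.fbiScale_pos hh) (φ.cohConst_pos hh)).ne'
      exact (mul_eq_zero.mp ((mul_eq_zero.mp h2).resolve_left h3)).resolve_left hk
    have h4 : (f : φ.L2Weight h) - T₀ u = 0 := by
      rw [Lp.eq_zero_iff_ae_eq_zero]
      filter_upwards [hgf] with x hx
      rw [hx, hg0]; rfl
    exact (sub_eq_zero.mp h4).symm
  refine ⟨LinearIsometryEquiv.ofSurjective T₁ hs, fun u => ?_, fun x => ?_⟩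
  · exact hae u
  · exact hT₀ x

end FBIPhase

/-! ### Decay of Fourier integrals, uniformly over bounded symbols. -/

/-- Differentiating $e^fg$ gives $e^f(g'+f'g)$, of the same shape but with values in linear maps.
The induction on `k` must therefore quantify over the target space `E` and over `g`. -/
theorem exists_norm_iteratedFDeriv_exp_smul_le {V : Type} [NormedAddCommGroup V] [NormedSpace ℝ V]
    {f : V → ℂ} (hf : f.HasTemperateGrowth) (k : ℕ) :
    ∀ {E : Type} [NormedAddCommGroup E] [NormedSpace ℂ E] (g : V → E), g.HasTemperateGrowth →
      ∃ (m : ℕ) (K : ℝ), ∀ x, ‖iteratedFDeriv ℝ k (fun y => cexp (f y) • g y) x‖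
        ≤ K * (1 + ‖x‖) ^ m * Real.exp (f x).re := by
  induction k with
  | zero =>
    intro E _ _ g hg
    obtain ⟨m, K, hK⟩ := hg.2 0
    refine ⟨m, K, fun x => ?_⟩
    have := hK x
    rw [norm_iteratedFDeriv_zero] at this ⊢
    rw [norm_smul, Complex.norm_exp, mul_comm]
    gcongr
  | succ k ih =>
    intro E _ _ g hg
    have hfd : (fderiv ℝ f).HasTemperateGrowth := by
      refine ⟨hf.1.fderiv_right (by simp), fun n => ?_⟩
      obtain ⟨m, K, hK⟩ := hf.2 (n + 1)
      exact ⟨m, K, fun x => by rw [norm_iteratedFDeriv_fderiv]; exact hK x⟩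
    have hgd : (fderiv ℝ g).HasTemperateGrowth := by
      refine ⟨hg.1.fderiv_right (by simp), fun n => ?_⟩
      obtain ⟨m, K, hK⟩ := hg.2 (n + 1)
      exact ⟨m, K, fun x => by rw [norm_iteratedFDeriv_fderiv]; exact hK x⟩
    let P : (V →L[ℝ] ℂ) →L[ℝ] E →L[ℝ] (V →L[ℝ] E) :=
      ((ContinuousLinearMap.compL ℝ V ℂ E).comp
        (ContinuousLinearMap.lsmul ℝ ℂ : ℂ →L[ℝ] E →L[ℝ] E).flip).flip
    have hG : (fun y => fderiv ℝ g y + P (fderiv ℝ f y) (g y)).HasTemperateGrowth :=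
      hgd.add (P.bilinear_hasTemperateGrowth hfd hg)
    obtain ⟨m, K, hK⟩ := ih _ hG
    have hD : fderiv ℝ (fun y => cexp (f y) • g y) =
        fun y => cexp (f y) • (fderiv ℝ g y + P (fderiv ℝ f y) (g y)) := by
      ext y v
      have h1 : HasFDerivAt f (fderiv ℝ f y) y :=
        (hf.1.differentiable (by simp) y).hasFDerivAt
      have h2 : HasFDerivAt g (fderiv ℝ g y) y :=
        (hg.1.differentiable (by simp) y).hasFDerivAt
      change fderiv ℝ ((fun x => cexp (f x)) • g) y v = _
      rw [(h1.cexp.smul h2).fderiv]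
      simp [P, mul_smul]
    refine ⟨m, K, fun x => ?_⟩
    rw [← norm_iteratedFDeriv_fderiv, hD]
    exact hK x

/-- A Gaussian with a phase of temperate growth is a Schwartz function. -/
theorem exists_schwartz_eq_exp {V : Type} [NormedAddCommGroup V] [NormedSpace ℝ V]
    {f : V → ℂ} (hf : f.HasTemperateGrowth) {c : ℝ} (hc : 0 < c)
    (hre : ∀ x, (f x).re ≤ -(c * ‖x‖ ^ 2)) : ∃ g : 𝓢(V, ℂ), ∀ x, g x = cexp (f x) := by
  refine ⟨⟨fun x => cexp (f x), hf.1.cexp, fun k n => ?_⟩, fun _ => rfl⟩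
  obtain ⟨m, K, hK⟩ := exists_norm_iteratedFDeriv_exp_smul_le hf n (fun _ => (1 : ℂ)) (by simp)
  obtain ⟨K', hK'0, hK'⟩ := exists_one_add_pow_mul_exp_le (k + m) hc
  refine ⟨|K| * K', fun x => ?_⟩
  have h1 := hK x
  simp only [smul_eq_mul, mul_one] at h1
  calc ‖x‖ ^ k * ‖iteratedFDeriv ℝ n (fun x => cexp (f x)) x‖
      ≤ (1 + ‖x‖) ^ k * (|K| * (1 + ‖x‖) ^ m * Real.exp (-(c * ‖x‖ ^ 2))) := by
        gcongr
        · linarith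
        · refine h1.trans ?_
          gcongr
          · exact le_abs_self K
          · exact hre x
    _ = |K| * ((1 + ‖x‖) ^ (k + m) * Real.exp (-(c * ‖x‖ ^ 2))) := by rw [pow_add]; ring
    _ ≤ |K| * K' := by gcongr; exact hK' _ (norm_nonneg _)

theorem integrable_norm_iteratedFDeriv_bounded_mul {V : Type*} [NormedAddCommGroup V]
    [NormedSpace ℝ V] [MeasurableSpace V] [BorelSpace V] [FiniteDimensional ℝ V]
    (μ : Measure V) [μ.HasTemperateGrowth] (g : 𝓢(V, ℂ)) {b : V → ℂ} (hb : ContDiff ℝ ∞ b)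
    {K : ℕ → ℝ} (hK : ∀ k y, ‖iteratedFDeriv ℝ k b y‖ ≤ K k) (k : ℕ) :
    Integrable (fun y => ‖iteratedFDeriv ℝ k (fun z => b z * g z) y‖) μ ∧
      ∫ y, ‖iteratedFDeriv ℝ k (fun z => b z * g z) y‖ ∂μ ≤
        ∑ i ∈ Finset.range (k + 1), (k.choose i : ℝ) * K i *
          ∫ y, ‖iteratedFDeriv ℝ (k - i) g y‖ ∂μ := by
  have hgi : ∀ j, Integrable (fun y => ‖iteratedFDeriv ℝ j g y‖) μ := fun j => by
    simpa using g.integrable_pow_mul_iteratedFDeriv μ 0 j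
  have hle : ∀ y, ‖iteratedFDeriv ℝ k (fun z => b z * g z) y‖ ≤
      ∑ i ∈ Finset.range (k + 1), (k.choose i : ℝ) * K i * ‖iteratedFDeriv ℝ (k - i) g y‖ := by
    intro y
    refine (norm_iteratedFDeriv_mul_le hb (g.smooth ⊤) y (mod_cast le_top)).trans ?_
    gcongr with i hi
    exact hK i y
  have hi : Integrable (fun y => ∑ i ∈ Finset.range (k + 1),
      (k.choose i : ℝ) * K i * ‖iteratedFDeriv ℝ (k - i) g y‖) μ :=
    integrable_finsetSum _ fun i _ => (hgi _).const_mul _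
  have hcont : Continuous (iteratedFDeriv ℝ k (fun z => b z * g z)) :=
    (hb.mul (g.smooth ⊤)).continuous_iteratedFDeriv (mod_cast le_top)
  have h1 : Integrable (fun y => ‖iteratedFDeriv ℝ k (fun z => b z * g z) y‖) μ :=
    hi.mono' hcont.norm.aestronglyMeasurable (ae_of_all _ fun y => by simpa using hle y)
  refine ⟨h1, (integral_mono h1 hi hle).trans (le_of_eq ?_)⟩
  rw [integral_finsetSum _ fun i _ => (hgi _).const_mul _]
  simp only [integral_const_mul]

/-- Decay of the Fourier integral of a Schwartz function times a symbol, uniformly in the symbol. -/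
theorem exists_abs_pow_mul_norm_fourier_le {V W : Type*} [NormedAddCommGroup V]
    [NormedSpace ℝ V] [MeasurableSpace V] [BorelSpace V] [FiniteDimensional ℝ V]
    [NormedAddCommGroup W] [NormedSpace ℝ W]
    (μ : Measure V) [μ.IsAddHaarMeasure] (L : V →L[ℝ] W →L[ℝ] ℝ) (g : 𝓢(V, ℂ)) (K : ℕ → ℝ)
    (N : ℕ) : ∃ D : ℝ, ∀ b : V → ℂ, ContDiff ℝ ∞ b →
      (∀ k y, ‖iteratedFDeriv ℝ k b y‖ ≤ K k) → ∀ v w,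
        |L v w| ^ N * ‖∫ y, cexp (I * (L y w : ℝ)) * (b y * g y) ∂μ‖ ≤ D * ‖v‖ ^ N := by
  refine ⟨(2 * Real.pi) ^ N * (2 ^ N * ∑ k ∈ Finset.range (N + 1),
    ∑ i ∈ Finset.range (k + 1), (k.choose i : ℝ) * K i *
          ∫ y, ‖iteratedFDeriv ℝ (k - i) g y‖ ∂μ), fun b hb hK v w => ?_⟩
  have hint := integrable_norm_iteratedFDeriv_bounded_mul μ g hb hK
  have hpi : (0 : ℝ) < 2 * Real.pi := by positivity
  -- The factor $-(2\pi)^{-1}$ converts the character $e^{-2\pi it}$ into $e^{iL}$.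
  have key := VectorFourier.pow_mul_norm_iteratedFDeriv_fourierIntegral_le
    (L := (-(2 * Real.pi)⁻¹ : ℝ) • L) (f := fun z => b z * g z) (μ := μ) (K := 0) (N := ⊤)
    (hb.mul (g.smooth ⊤)) (fun k n hk _ => by
      have : k = 0 := by simpa using hk
      subst this
      simpa using (hint n).1) (k := 0) (n := N) le_rfl le_top v w
  rw [norm_iteratedFDeriv_zero] at key
  have e1 : VectorFourier.fourierIntegral Real.fourierChar μ
      ((-(2 * Real.pi)⁻¹ : ℝ) • L).toLinearMap₁₂ (fun z => b z * g z) w =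
      ∫ y, cexp (I * (L y w : ℝ)) * (b y * g y) ∂μ := by
    rw [VectorFourier.fourierIntegral]
    refine integral_congr_ae (ae_of_all _ fun y => ?_)
    simp only [Circle.smul_def, Real.fourierChar_apply, smul_eq_mul]
    congr 2
    simp
    field_simp
  rw [e1] at key
  have e2 : |((-(2 * Real.pi)⁻¹ : ℝ) • L) v w| ^ N = ((2 * Real.pi) ^ N)⁻¹ * |L v w| ^ N := by
    simp [abs_mul, abs_of_pos Real.pi_pos, mul_pow]
  rw [e2, mul_assoc, inv_mul_le_iff₀ (by positivity)] at key
  refine key.trans ?_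
  have e3 : ∑ p ∈ Finset.range (0 + 1) ×ˢ Finset.range (N + 1),
      ∫ v, ‖v‖ ^ p.1 * ‖iteratedFDeriv ℝ p.2 (fun z => b z * g z) v‖ ∂μ ≤
      ∑ k ∈ Finset.range (N + 1),
        ∑ i ∈ Finset.range (k + 1), (k.choose i : ℝ) * K i *
          ∫ y, ‖iteratedFDeriv ℝ (k - i) g y‖ ∂μ := by
    rw [Finset.sum_product]
    simp only [zero_add, Finset.range_one, Finset.sum_singleton, pow_zero, one_mul]
    exact Finset.sum_le_sum fun k _ => (hint k).2
  have e4 := mul_le_mul_of_nonneg_left e3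
    (by positivity : 0 ≤ (2 * Real.pi) ^ N * (‖v‖ ^ N * 2 ^ N))
  simp only [pow_zero, mul_one, CharP.cast_eq_zero, mul_zero, zero_add] at e4 ⊢
  calc _ = _ := by ring
    _ ≤ _ := e4
    _ = _ := by ring

/-- Quantitative nondegeneracy of `L` turns decay in `L v w` into decay in `w`: the direction `v`
yields $(c\|w\|^2)^N$ on the left against $\|w\|^N$ on the right, a net gain of $\|w\|^N$. -/
theorem exists_one_add_pow_mul_norm_fourier_le {V W : Type*} [NormedAddCommGroup V]
    [NormedSpace ℝ V] [MeasurableSpace V] [BorelSpace V] [FiniteDimensional ℝ V]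
    [NormedAddCommGroup W] [NormedSpace ℝ W]
    (μ : Measure V) [μ.IsAddHaarMeasure] (L : V →L[ℝ] W →L[ℝ] ℝ) {c : ℝ} (hc : 0 < c)
    (hL : ∀ w, ∃ v, ‖v‖ ≤ ‖w‖ ∧ c * ‖w‖ ^ 2 ≤ |L v w|) (g : 𝓢(V, ℂ)) (K : ℕ → ℝ)
    (N : ℕ) : ∃ D : ℝ, 0 ≤ D ∧ ∀ b : V → ℂ, ContDiff ℝ ∞ b →
      (∀ k y, ‖iteratedFDeriv ℝ k b y‖ ≤ K k) → ∀ w,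
        (1 + ‖w‖) ^ N * ‖∫ y, cexp (I * (L y w : ℝ)) * (b y * g y) ∂μ‖ ≤ D := by
  obtain ⟨D₀, h₀⟩ := exists_abs_pow_mul_norm_fourier_le μ L g K 0
  obtain ⟨D₁, h₁⟩ := exists_abs_pow_mul_norm_fourier_le μ L g K N
  refine ⟨2 ^ N * (|D₀| + (|D₁| / c ^ N + |D₀|)), by positivity, fun b hb hK w => ?_⟩
  set F := ‖∫ y, cexp (I * (L y w : ℝ)) * (b y * g y) ∂μ‖ with hF
  have hF0 : 0 ≤ F := norm_nonneg _
  have hb0 : F ≤ |D₀| := by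
    have := h₀ b hb hK 0 w
    rw [← hF] at this
    simp only [pow_zero, one_mul, mul_one] at this
    exact this.trans (le_abs_self _)
  have hb1 : ‖w‖ ^ N * F ≤ |D₁| / c ^ N + |D₀| := by
    have hq : 0 ≤ |D₁| / c ^ N := by positivity
    rcases (norm_nonneg w).eq_or_lt with hw | hw
    · rw [← hw]
      calc (0 : ℝ) ^ N * F ≤ 1 * F := by gcongr; exact pow_le_one₀ le_rfl zero_le_one
        _ ≤ _ := by linarith
    · obtain ⟨v, hv, hv'⟩ := hL w
      have h2 := h₁ b hb hK v w
      rw [← hF] at h2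
      have h3 : (c * ‖w‖ ^ 2) ^ N * F ≤ |D₁| * ‖w‖ ^ N := by
        calc (c * ‖w‖ ^ 2) ^ N * F ≤ |L v w| ^ N * F := by gcongr
          _ ≤ D₁ * ‖v‖ ^ N := h2
          _ ≤ |D₁| * ‖w‖ ^ N := by gcongr; exact le_abs_self _
      have h4 : ‖w‖ ^ N * F ≤ |D₁| / c ^ N := by
        rw [le_div_iff₀ (by positivity)]
        have hp : 0 < ‖w‖ ^ N := by positivity
        refine le_of_mul_le_mul_right ?_ hp
        calc ‖w‖ ^ N * F * c ^ N * ‖w‖ ^ N = (c * ‖w‖ ^ 2) ^ N * F := by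
              rw [mul_pow, ← pow_mul, mul_comm 2 N, pow_mul]; ring
          _ ≤ _ := h3
      linarith [abs_nonneg D₀]
  calc (1 + ‖w‖) ^ N * F ≤ 2 ^ N * (1 + ‖w‖ ^ N) * F := by
        gcongr
        have := add_pow_le zero_le_one (norm_nonneg w) N
        rw [one_pow] at this
        refine this.trans ?_
        gcongr
        · norm_num
        · omega
    _ = 2 ^ N * (F + ‖w‖ ^ N * F) := by ring
    _ ≤ _ := by gcongr

theorem IsBoundedSymbol.exists_bound_comp_affine {E V : Type*} [NormedAddCommGroup E]
    [NormedSpace ℝ E] [NormedAddCommGroup V] [NormedSpace ℝ V] {b : E → ℂ}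
    (hb : IsBoundedSymbol b) (T : V →L[ℝ] E) :
    ∃ K : ℕ → ℝ, ∀ p, ContDiff ℝ ∞ (fun y => b (p + T y)) ∧
      ∀ k y, ‖iteratedFDeriv ℝ k (fun y => b (p + T y)) y‖ ≤ K k := by
  choose K hK using hb.2
  have hK0 : ∀ k, 0 ≤ K k := fun k => (norm_nonneg _).trans (hK k 0)
  refine ⟨fun k => K k * ‖T‖ ^ k, fun p => ?_⟩
  have hc : ContDiff ℝ ∞ (fun e => b (p + e)) := hb.1.comp (contDiff_const.add contDiff_id)
  refine ⟨hc.comp T.contDiff, fun k y => ?_⟩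
  have := T.iteratedFDeriv_comp_right hc y (i := k) (mod_cast le_top)
  change ‖iteratedFDeriv ℝ k ((fun e => b (p + e)) ∘ T) y‖ ≤ _
  rw [this]
  refine (ContinuousMultilinearMap.norm_compContinuousLinearMap_le _ _).trans ?_
  rw [iteratedFDeriv_comp_add_left]
  simp only [Finset.prod_const, Finset.card_univ, Fintype.card_fin]
  gcongr
  exact hK _ _

/-! ### Operators from sesquilinear forms. -/

/-- The sum-of-squares bound is what the Schur test produces; rescaling both arguments to unit norm
upgrades it to a product bound. -/
theorem exists_operator_of_sesquilinear {H : Type*} [NormedAddCommGroup H] [InnerProductSpace ℂ H]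
    [CompleteSpace H] (S : H →ₗ⋆[ℂ] H →ₗ[ℂ] ℂ) {K : ℝ}
    (hS : ∀ g f, ‖S g f‖ ≤ K * (‖g‖ ^ 2 + ‖f‖ ^ 2)) :
    ∃ A : H →L[ℂ] H, ∀ g f, inner ℂ g (A f) = S g f := by
  have hb : ∀ g f, ‖S g f‖ ≤ (2 * K) * ‖g‖ * ‖f‖ := by
    intro g f
    rcases eq_or_ne g 0 with rfl | hg
    · simp
    rcases eq_or_ne f 0 with rfl | hf
    · simp
    have hg' : ‖g‖ ≠ 0 := norm_ne_zero_iff.mpr hg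
    have hf' : ‖f‖ ≠ 0 := norm_ne_zero_iff.mpr hf
    have h1 := hS (((‖g‖⁻¹ : ℝ) : ℂ) • g) (((‖f‖⁻¹ : ℝ) : ℂ) • f)
    rw [S.map_smulₛₗ, LinearMap.smul_apply, (S g).map_smul, norm_smul, norm_smul,
      norm_smul, norm_smul] at h1
    simp only [starRingEnd_apply, norm_star, norm_real, norm_inv, norm_norm] at h1
    rw [inv_mul_cancel₀ hg', inv_mul_cancel₀ hf'] at h1
    calc ‖S g f‖ = ‖g‖ * ‖f‖ * (‖g‖⁻¹ * (‖f‖⁻¹ * ‖S g f‖)) := by field_simp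
      _ ≤ ‖g‖ * ‖f‖ * (K * (1 ^ 2 + 1 ^ 2)) := by gcongr
      _ = _ := by ring
  let B : H →L⋆[ℂ] H →L[ℂ] ℂ := LinearMap.mkContinuous₂ S (2 * K) hb
  refine ⟨ContinuousLinearMap.adjoint (InnerProductSpace.continuousLinearMapOfBilin B),
    fun g f => ?_⟩
  rw [ContinuousLinearMap.adjoint_inner_right,
    InnerProductSpace.continuousLinearMapOfBilin_apply]
  rfl

theorem integrable_shear_mul {E : Type*} [NormedAddCommGroup E] [MeasurableSpace E] [BorelSpace E]
    [SecondCountableTopology E] {μ : Measure E} [SigmaFinite μ] [μ.IsAddHaarMeasure]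
    {κ u : E → ℝ} (hκ : Integrable κ μ) (hu : Integrable u μ) :
    Integrable (fun q : E × E => κ (q.1 - q.2) * u q.2) (μ.prod μ) ∧
      ∫ q, κ (q.1 - q.2) * u q.2 ∂(μ.prod μ) = (∫ x, κ x ∂μ) * ∫ x, u x ∂μ := by
  have hi : Integrable (fun q : E × E => κ (q.1 - q.2) * u q.2) (μ.prod μ) := by
    refine (hu.convolution_integrand (ContinuousLinearMap.mul ℝ ℝ) hκ).congr
      (ae_of_all _ fun q => ?_)
    simp [mul_comm]
  refine ⟨hi, ?_⟩
  rw [integral_prod_symm _ hi, ← integral_const_mul]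
  refine integral_congr_ae (ae_of_all _ fun z => ?_)
  simp only
  rw [integral_mul_const, integral_sub_right_eq_self]

theorem integral_norm_sq_eq_norm_sq {X : Type*} [MeasurableSpace X] {μ : Measure X}
    (f : Lp ℂ 2 μ) : ∫ x, ‖f x‖ ^ 2 ∂μ = ‖f‖ ^ 2 := by
  have h1 : inner ℂ f f = ((‖f‖ ^ 2 : ℝ) : ℂ) := by
    rw [inner_self_eq_norm_sq_to_K]; simp
  rw [L2.inner_def] at h1
  have h2 : ∀ x, inner ℂ (f x) (f x) = ((‖f x‖ ^ 2 : ℝ) : ℂ) := fun x => by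
    rw [inner_self_eq_norm_sq_to_K]; simp
  simp only [h2] at h1
  rw [integral_complex_ofReal] at h1
  exact_mod_cast h1

/-! ### The Weyl kernel, its off-diagonal decay and Schur's test. -/

namespace FBIPhase

variable {n : ℕ} (φ : FBIPhase n) {h : ℝ}

/-- The Hermitian form as a continuous real bilinear map. -/
def hermCLM : (Fin n → ℂ) →L[ℝ] (Fin n → ℂ) →L[ℝ] ℂ :=
  LinearMap.toContinuousBilinearMap <| LinearMap.mk₂ ℝ φ.herm φ.herm_add_left
    (fun c z w => by
      have : c • z = (c : ℂ) • z := by ext; simp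
      rw [this, herm_smul_left]; simp)
    φ.herm_add_right
    (fun c z w => by
      have : c • w = (c : ℂ) • w := by ext; simp
      rw [this, herm_smul_right]; simp)

theorem hermCLM_apply (z w : Fin n → ℂ) : φ.hermCLM z w = φ.herm z w := rfl

/-- With $d=(x-z)/2$, moving $s$ off the midpoint by `r` adds
$\mathrm{herm}(d,r)-\mathrm{herm}(r,d)$, which is purely imaginary, and $-\mathrm{herm}(r,r)$: an
oscillation of frequency $d$ times a fixed Gaussian. -/
theorem reflKer_midpoint_add (x z r : Fin n → ℂ) :
    φ.reflKer h x ((1 / 2 : ℂ) • (x + z) + r) z = φ.reflKer h x ((1 / 2 : ℂ) • (x + z)) z *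
      (cexp (I * ((2 / h * (φ.herm ((1 / 2 : ℂ) • (x - z)) r).im : ℝ) : ℂ)) *
        cexp (-φ.herm r r / h)) := by
  set m := (1 / 2 : ℂ) • (x + z) with hm
  set d := (1 / 2 : ℂ) • (x - z) with hd
  have hx : x = m + d := by rw [hm, hd, ← smul_add]; ext; simp; ring
  have hz : z = m - d := by rw [hm, hd, ← smul_sub]; ext; simp; ring
  have him : I * ((2 / h * (φ.herm d r).im : ℝ) : ℂ) = (φ.herm d r - φ.herm r d) / h := by
    rw [← φ.star_herm d r, Complex.star_def, Complex.sub_conj]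
    push_cast
    ring
  rw [him, ← Complex.exp_add, reflKer, reflKer, ← Complex.exp_add]
  congr 1
  have key : φ.herm x (m + r) - φ.herm (m + r) (m + r) + φ.herm (m + r) z =
      φ.herm x m - φ.herm m m + φ.herm m z + (φ.herm d r - φ.herm r d) - φ.herm r r := by
    clear_value m d
    subst hx hz
    simp only [herm_add_left, herm_add_right, herm_sub_right]
    ring
  linear_combination (1 / (h : ℂ)) * key

/-- The kernel of the Weyl quantization on the transform side, up to normalization. -/
def weylKer (h : ℝ) (α : (Fin n → ℂ) → ℂ) (x z : Fin n → ℂ) : ℂ :=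
  ∫ s, α s * φ.reflKer h x s z

theorem exists_weylKer_bound (hh : 0 < h) {α : (Fin n → ℂ) → ℂ} (hα : IsBoundedSymbol α)
    (N : ℕ) : ∃ D : ℝ, 0 ≤ D ∧ ∀ x z, ‖φ.weylKer h α x z‖ ≤
      D * ((1 + ‖x - z‖) ^ N)⁻¹ * Real.exp ((φ.weight x + φ.weight z) / h) := by
  obtain ⟨c, hc, hcl⟩ := φ.exists_herm_lower_bound
  have htg : Function.HasTemperateGrowth (fun r : Fin n → ℂ => -φ.herm r r / (h : ℂ)) := by
    have h1 : Function.HasTemperateGrowth (fun r : Fin n → ℂ => φ.hermCLM r r) :=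
      φ.hermCLM.bilinear_hasTemperateGrowth .id' .id'
    have h2 : (fun r : Fin n → ℂ => -φ.herm r r / (h : ℂ)) =
        fun r => (-(1 / (h : ℂ))) * φ.hermCLM r r := by
      funext r
      rw [hermCLM_apply]
      ring
    rw [h2]
    exact (Function.HasTemperateGrowth.const (-(1 / (h : ℂ)))).fun_mul h1
  obtain ⟨g, hg⟩ := exists_schwartz_eq_exp htg (c := c / h) (by positivity) fun r => by
    rw [div_ofReal_re, neg_re, neg_div, neg_le_neg_iff, div_mul_eq_mul_div]
    gcongr
    exact hcl r
  let L : (Fin n → ℂ) →L[ℝ] (Fin n → ℂ) →L[ℝ] ℝ :=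
    (2 / h) • (ContinuousLinearMap.compL ℝ (Fin n → ℂ) ℂ ℝ imCLM).comp φ.hermCLM.flip
  have hLa : ∀ r d, L r d = 2 / h * (φ.herm d r).im := fun r d => by
    simp [L, hermCLM_apply]
  have hL : ∀ w, ∃ v, ‖v‖ ≤ ‖w‖ ∧ (2 / h * c) * ‖w‖ ^ 2 ≤ |L v w| := by
    intro w
    -- The phase is an imaginary part, so rotating `w` by $i$ turns it, up to sign, into the
    -- positive form $\mathrm{herm}(w,w)$.
    refine ⟨I • w, by simp [norm_smul], ?_⟩
    rw [hLa, herm_smul_right, abs_mul, abs_of_pos (show 0 < 2 / h by positivity), mul_assoc]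
    have : (star I * φ.herm w w).im = -(φ.herm w w).re := by simp
    rw [this, abs_neg]
    gcongr
    exact (hcl w).trans (le_abs_self _)
  obtain ⟨K, hK⟩ := hα.exists_bound_comp_affine (ContinuousLinearMap.id ℝ (Fin n → ℂ))
  obtain ⟨D, hD0, hD⟩ := exists_one_add_pow_mul_norm_fourier_le volume L
    (by positivity) hL g K N
  refine ⟨2 ^ N * D, by positivity, fun x z => ?_⟩
  set m := (1 / 2 : ℂ) • (x + z) with hm
  set d := (1 / 2 : ℂ) • (x - z) with hd
  have e1 : φ.weylKer h α x z = φ.reflKer h x m z *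
      ∫ r, cexp (I * (L r d : ℝ)) * (α (m + r) * g r) := by
    rw [weylKer, ← integral_add_left_eq_self _ m, ← integral_const_mul]
    refine integral_congr_ae (ae_of_all _ fun r => ?_)
    simp only [hm, reflKer_midpoint_add, hLa, hg, hd]
    ring
  have hb := hD (fun r => α (m + r)) (hK m).1 (hK m).2 d
  have hnd : 1 + ‖x - z‖ ≤ 2 * (1 + ‖d‖) := by
    rw [hd, norm_smul]
    norm_num
    linarith [norm_nonneg (x - z)]
  have hr : ‖φ.reflKer h x m z‖ = Real.exp ((φ.weight x + φ.weight z) / h) := by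
    rw [norm_reflKer, ← hm]
    simp [herm]
  rw [e1, norm_mul, hr, mul_comm]
  gcongr
  rw [← div_eq_mul_inv, le_div_iff₀ (by positivity)]
  set F := ‖∫ r, cexp (I * (L r d : ℝ)) * (α (m + r) * g r)‖
  calc F * (1 + ‖x - z‖) ^ N ≤ F * (2 * (1 + ‖d‖)) ^ N := by gcongr
    _ = 2 ^ N * ((1 + ‖d‖) ^ N * F) := by rw [mul_pow]; ring
    _ ≤ 2 ^ N * D := by gcongr

theorem stronglyMeasurable_weylKer {α : (Fin n → ℂ) → ℂ} (hα : Continuous α) :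
    StronglyMeasurable fun q : (Fin n → ℂ) × (Fin n → ℂ) => φ.weylKer h α q.1 q.2 := by
  have h1 : Continuous fun p : ((Fin n → ℂ) × (Fin n → ℂ)) × (Fin n → ℂ) =>
      φ.reflKer h p.1.1 p.2 p.1.2 := by
    unfold reflKer
    fun_prop
  have h2 : Continuous fun p : ((Fin n → ℂ) × (Fin n → ℂ)) × (Fin n → ℂ) =>
      α p.2 * φ.reflKer h p.1.1 p.2 p.1.2 := (hα.comp continuous_snd).mul h1
  exact h2.stronglyMeasurable.integral_prod_right'

/-- Schur's test for kernels with off-diagonal decay. -/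
theorem exists_operator_of_kernel {k : (Fin n → ℂ) → (Fin n → ℂ) → ℂ}
    (hk : StronglyMeasurable fun q : (Fin n → ℂ) × (Fin n → ℂ) => k q.1 q.2)
    {κ : (Fin n → ℂ) → ℝ} (hκ : Integrable κ) (hκs : ∀ x, κ (-x) = κ x)
    (hb : ∀ x z, ‖k x z‖ ≤ κ (x - z) * Real.exp ((φ.weight x + φ.weight z) / h)) :
    ∃ A : φ.L2Weight h →L[ℂ] φ.L2Weight h, ∀ g f : φ.L2Weight h,
      Integrable (fun q : (Fin n → ℂ) × (Fin n → ℂ) =>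
        (starRingEnd ℂ) (g q.1) * k q.1 q.2 * f q.2)
        ((φ.weightMeasure h).prod (φ.weightMeasure h)) ∧
      inner ℂ g (A f) = ∫ q : (Fin n → ℂ) × (Fin n → ℂ),
        (starRingEnd ℂ) (g q.1) * k q.1 q.2 * f q.2
          ∂((φ.weightMeasure h).prod (φ.weightMeasure h)) := by
  set μ := φ.weightMeasure h with hμ
  set wt : (Fin n → ℂ) → ℝ := fun x => Real.exp (-2 * φ.weight x / h) with hwt
  have hwt0 : ∀ x, 0 < wt x := fun x => Real.exp_pos _
  have hκ0 : ∀ x, 0 ≤ κ x := fun x => by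
    have := (norm_nonneg _).trans (hb x 0)
    rw [sub_zero] at this
    exact nonneg_of_mul_nonneg_left this (Real.exp_pos _)
  have hsq : ∀ f : φ.L2Weight h, Integrable (fun x => wt x * ‖f x‖ ^ 2) ∧
      ∫ x, wt x * ‖f x‖ ^ 2 = ‖f‖ ^ 2 := by
    intro f
    have h1 : Integrable (fun x => ‖f x‖ ^ 2) μ := (Lp.memLp f).integrable_norm_pow two_ne_zero
    refine ⟨φ.integrable_weightMeasure_real_iff.mp h1, ?_⟩
    rw [← φ.integral_weightMeasure_real, integral_norm_sq_eq_norm_sq]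
  have hprod : μ.prod μ = (volume.prod volume : Measure ((Fin n → ℂ) × (Fin n → ℂ))).withDensity
      (fun q => ENNReal.ofReal (wt q.1) * ENNReal.ofReal (wt q.2)) := by
    rw [hμ, weightMeasure]
    exact prod_withDensity φ.measurable_weight_density φ.measurable_weight_density
  have hmd : Measurable fun q : (Fin n → ℂ) × (Fin n → ℂ) =>
      ENNReal.ofReal (wt q.1) * ENNReal.ofReal (wt q.2) :=
    (φ.measurable_weight_density.comp measurable_fst).mul
      (φ.measurable_weight_density.comp measurable_snd)
  have hfin : ∀ᵐ q : (Fin n → ℂ) × (Fin n → ℂ) ∂(volume.prod volume),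
      ENNReal.ofReal (wt q.1) * ENNReal.ofReal (wt q.2) < ⊤ :=
    ae_of_all _ fun q => ENNReal.mul_lt_top ENNReal.ofReal_lt_top ENNReal.ofReal_lt_top
  set F : φ.L2Weight h → φ.L2Weight h → (Fin n → ℂ) × (Fin n → ℂ) → ℂ := fun g f q =>
    (starRingEnd ℂ) (g q.1) * k q.1 q.2 * f q.2 with hF
  have hmeas : ∀ g f, AEStronglyMeasurable (F g f) (μ.prod μ) := fun g f =>
    ((((Lp.aestronglyMeasurable g).comp_fst).star).mul
      hk.aestronglyMeasurable).mul (Lp.aestronglyMeasurable f).comp_snd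
  have hac : (volume.prod volume : Measure ((Fin n → ℂ) × (Fin n → ℂ))) ≪ μ.prod μ :=
    φ.ac_weightMeasure.prod φ.ac_weightMeasure
  have hint : ∀ g f, Integrable (F g f) (μ.prod μ) ∧
      ‖∫ q, F g f q ∂(μ.prod μ)‖ ≤ (∫ x, κ x) / 2 * (‖g‖ ^ 2 + ‖f‖ ^ 2) := by
    intro g f
    obtain ⟨i1, e1⟩ := integrable_shear_mul hκ (hsq f).1
    obtain ⟨i2, e2⟩ := integrable_shear_mul hκ (hsq g).1
    have i2' := i2.swap
    have e2' := integral_prod_swap (fun q : (Fin n → ℂ) × (Fin n → ℂ) =>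
      κ (q.1 - q.2) * (wt q.2 * ‖g q.2‖ ^ 2)) (μ := volume) (ν := volume)
    rw [e2, (hsq g).2] at e2'
    rw [(hsq f).2] at e1
    -- The inequality between geometric and arithmetic means leaves one square in each variable;
    -- evenness of `κ` makes the two halves swapped copies of the same shear integral.
    have hle : ∀ q : (Fin n → ℂ) × (Fin n → ℂ),
        ‖(ENNReal.ofReal (wt q.1) * ENNReal.ofReal (wt q.2)).toReal • F g f q‖ ≤
        (κ (q.swap.1 - q.swap.2) * (wt q.swap.2 * ‖g q.swap.2‖ ^ 2) +
          κ (q.1 - q.2) * (wt q.2 * ‖f q.2‖ ^ 2)) / 2 := by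
      rintro ⟨x, z⟩
      simp only [Prod.swap, hF]
      have hsym : κ (z - x) = κ (x - z) := by rw [← hκs, neg_sub]
      rw [hsym, ENNReal.toReal_mul, ENNReal.toReal_ofReal (hwt0 _).le,
        ENNReal.toReal_ofReal (hwt0 _).le, norm_smul, Real.norm_of_nonneg
        (mul_pos (hwt0 _) (hwt0 _)).le, norm_mul, norm_mul, RCLike.norm_conj]
      -- The weight is $p^2$, and $p(x)p(z)$ cancels the growth of the kernel, leaving an unweighted
      -- estimate.
      set p : (Fin n → ℂ) → ℝ := fun x => Real.exp (-φ.weight x / h)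
      have hp : ∀ x, wt x = p x ^ 2 := fun x => by
        simp only [hwt, p]
        rw [← Real.exp_nat_mul]
        congr 1
        push_cast
        ring
      have hpe : p x * p z * Real.exp ((φ.weight x + φ.weight z) / h) = 1 := by
        simp only [p]
        rw [← Real.exp_add, ← Real.exp_add, Real.exp_eq_one_iff]
        ring
      have hp0 : ∀ x, 0 < p x := fun x => Real.exp_pos _
      calc wt x * wt z * (‖g x‖ * ‖k x z‖ * ‖f z‖)
          ≤ wt x * wt z * (‖g x‖ * (κ (x - z) * Real.exp ((φ.weight x + φ.weight z) / h)) *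
              ‖f z‖) := by
            have := (hwt0 x).le
            have := (hwt0 z).le
            gcongr
            exact hb x z
        _ = κ (x - z) * ((p x * ‖g x‖) * (p z * ‖f z‖)) := by
            rw [hp, hp]
            linear_combination (p x * p z * κ (x - z) * ‖g x‖ * ‖f z‖) * hpe
        _ ≤ κ (x - z) * (((p x * ‖g x‖) ^ 2 + (p z * ‖f z‖) ^ 2) / 2) := by
            gcongr
            · exact hκ0 _
            · nlinarith [sq_nonneg (p x * ‖g x‖ - p z * ‖f z‖)]
        _ = _ := by rw [hp, hp]; ring
    have hi := (i2'.add i1).div_const 2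
    constructor
    · rw [hprod, integrable_withDensity_iff_integrable_smul' hmd hfin]
      exact hi.mono' ((hmd.ennreal_toReal.aestronglyMeasurable).smul ((hmeas g f).mono_ac hac))
        (ae_of_all _ hle)
    · rw [hprod, integral_withDensity_eq_integral_toReal_smul hmd hfin]
      refine (norm_integral_le_of_norm_le hi (ae_of_all _ hle)).trans (le_of_eq ?_)
      have hadd := integral_add i2' i1
      simp only [Function.comp_apply] at hadd
      simp only [Pi.add_apply, Function.comp_apply]
      rw [integral_div, hadd, e2', e1]
      ring
  let S : φ.L2Weight h →ₗ⋆[ℂ] φ.L2Weight h →ₗ[ℂ] ℂ :=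
    LinearMap.mk₂'ₛₗ _ _ (fun g f => ∫ q, F g f q ∂(μ.prod μ))
      (fun g g' f => by
        rw [← integral_add (hint g f).1 (hint g' f).1]
        refine integral_congr_ae ?_
        filter_upwards [Measure.quasiMeasurePreserving_fst.ae (Lp.coeFn_add g g')] with q hq
        simp only [hF, hq, Pi.add_apply, map_add]
        ring)
      (fun c g f => by
        rw [smul_eq_mul, ← integral_const_mul]
        refine integral_congr_ae ?_
        filter_upwards [Measure.quasiMeasurePreserving_fst.ae (Lp.coeFn_smul c g)] with q hq
        simp only [hF, hq, Pi.smul_apply, smul_eq_mul, map_mul]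
        ring)
      (fun g f f' => by
        rw [← integral_add (hint g f).1 (hint g f').1]
        refine integral_congr_ae ?_
        filter_upwards [Measure.quasiMeasurePreserving_snd.ae (Lp.coeFn_add f f')] with q hq
        simp only [hF, hq, Pi.add_apply]
        ring)
      (fun c g f => by
        rw [RingHom.id_apply, smul_eq_mul, ← integral_const_mul]
        refine integral_congr_ae ?_
        filter_upwards [Measure.quasiMeasurePreserving_snd.ae (Lp.coeFn_smul c f)] with q hq
        simp only [hF, hq, Pi.smul_apply, smul_eq_mul]
        ring)
  obtain ⟨A, hA⟩ := exists_operator_of_sesquilinear S fun g f => (hint g f).2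
  exact ⟨A, fun g f => ⟨(hint g f).1, hA g f⟩⟩

end FBIPhase

/-! ### The Weyl operator on the transform side. -/

theorem integrable_mul_comp_sub {X E : Type*} [MeasurableSpace X] {ν : Measure X} [SFinite ν]
    [NormedAddCommGroup E] [MeasurableSpace E] [BorelSpace E] [SecondCountableTopology E]
    {μ : Measure E} [SFinite μ] [μ.IsAddHaarMeasure] {u : X → ℝ} (hu : Integrable u ν)
    {w : E → ℝ} (hw : Integrable w μ) (hwm : Measurable w) {p : X → E} (hp : Measurable p) :
    Integrable (fun q : X × E => u q.1 * w (q.2 - p q.1)) (ν.prod μ) := by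
  have hm : AEStronglyMeasurable (fun q : X × E => u q.1 * w (q.2 - p q.1)) (ν.prod μ) :=
    hu.aestronglyMeasurable.comp_fst.mul
      (hwm.comp (measurable_snd.sub (hp.comp measurable_fst))).aestronglyMeasurable
  rw [integrable_prod_iff hm]
  refine ⟨ae_of_all _ fun x => (hw.comp_sub_right (p x)).const_mul (u x), ?_⟩
  have : ∀ x, ∫ s, ‖u x * w (s - p x)‖ ∂μ = ‖u x‖ * ∫ s, ‖w s‖ ∂μ := fun x => by
    simp only [norm_mul]
    rw [integral_const_mul, integral_sub_right_eq_self (fun s => ‖w s‖)]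
  simp only [this]
  exact hu.norm.mul_const _

namespace FBIPhase

variable {n : ℕ} (φ : FBIPhase n) {h : ℝ}

/-- The constant in front of the reflection form of the Weyl quantization. -/
def opConst (h : ℝ) : ℝ :=
  (1 / (2 * Real.pi * h) ^ n) * (4 ^ n * ((2 ^ n)⁻¹ * ‖φ.B.det‖ ^ 2 / φ.imC.det))

/-- The substitution $y=2s-x$ has Jacobian $4^n$ in real dimension $2n$, and the contour density is
a constant. -/
theorem opIntegral_eq (a : φ.Lambda → ℂ) (v : (Fin n → ℂ) → ℂ) (x : Fin n → ℂ) :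
    φ.opIntegral h a v x = (φ.opConst h : ℂ) *
      ∫ s, cexp (I / h * ((x - ((2 : ℂ) • s - x)) ⬝ᵥ φ.contourTheta x ((2 : ℂ) • s - x))) *
        a (φ.lift s) * v ((2 : ℂ) • s - x) := by
  set F : (Fin n → ℂ) → ℂ := fun y => cexp (I / h * ((x - y) ⬝ᵥ φ.contourTheta x y))
      * a (φ.lift ((1 / 2 : ℂ) • (x + y))) * v y with hF
  have e1 : ∫ y, F y = 4 ^ n * ∫ s, F ((2 : ℂ) • s - x) := by
    have h1 := Measure.integral_comp_smul (volume : Measure (Fin n → ℂ)) (fun y => F (y - x)) 2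
    rw [integral_sub_right_eq_self] at h1
    have h2 : ∀ s : Fin n → ℂ, (2 : ℝ) • s = (2 : ℂ) • s := fun s => by ext; simp
    simp only [h2] at h1
    rw [h1]
    have h3 : Module.finrank ℝ (Fin n → ℂ) = 2 * n := by
      rw [Module.finrank_pi_fintype]; simp [mul_comm]
    rw [h3, pow_mul, abs_of_pos (by positivity), Complex.real_smul, ← mul_assoc]
    norm_num
  have e2 : ∀ s, F ((2 : ℂ) • s - x) =
      cexp (I / h * ((x - ((2 : ℂ) • s - x)) ⬝ᵥ φ.contourTheta x ((2 : ℂ) • s - x))) *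
        a (φ.lift s) * v ((2 : ℂ) • s - x) := fun s => by
    simp only [hF, half_smul_add_reflect]
  simp only [e2] at e1
  rw [opIntegral]
  simp only [contourDensity_eq]
  rw [integral_mul_const]
  change _ * ((∫ y, F y) * _) = _
  rw [e1, opConst]
  push_cast
  ring

theorem differentiable_reflKer (s z : Fin n → ℂ) :
    Differentiable ℂ fun x => φ.reflKer h x s z := by
  unfold reflKer
  have h1 := φ.differentiable_hol_self
  have h2 := φ.differentiable_herm_left s
  have h3 := φ.differentiable_herm_left z
  simp only [div_eq_mul_inv _ (h : ℂ)]
  exact ((((((h1.add_const _).add h2).sub_const _).add_const _).sub (h3.const_mul _)).mul_const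
    _).cexp

theorem measurable_exp_neg_herm (c : ℝ) :
    Measurable fun x : Fin n → ℂ => Real.exp (-(c * (φ.herm x x).re)) := by
  have : Continuous fun x : Fin n → ℂ => (φ.herm x x).re :=
    Complex.continuous_re.comp (by fun_prop)
  fun_prop

theorem norm_reflKer_eq (x s z : Fin n → ℂ) : ‖φ.reflKer h x s z‖ =
    Real.exp ((φ.weight x + φ.weight z) / h) *
      Real.exp (-(h⁻¹ * (φ.herm (s - (1 / 2 : ℂ) • (x + z)) (s - (1 / 2 : ℂ) • (x + z))).re)) := by
  rw [norm_reflKer, ← Real.exp_add]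
  congr 1
  ring

theorem norm_reflKer_le (hh : 0 < h) (x s z : Fin n → ℂ) : ‖φ.reflKer h x s z‖ ≤
    Real.exp ((φ.weight x + φ.weight z) / h) := by
  rw [norm_reflKer_eq]
  refine mul_le_of_le_one_right (Real.exp_pos _).le (Real.exp_le_one_iff.mpr ?_)
  have := φ.herm_self_nonneg (s - (1 / 2 : ℂ) • (x + z))
  rw [neg_nonpos]
  positivity

/-- For fixed `s` the reflected kernel is holomorphic in its first variable, so the reproducing
formula applies under the `s`-integral. This allows pairing with `kerLp` without first proving that
the kernel operator preserves $H_\Phi$. -/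
theorem integral_cohKer_mul_weylKer (hh : 0 < h) {α : (Fin n → ℂ) → ℂ} (hα : Continuous α)
    {M : ℝ} (hM : ∀ s, ‖α s‖ ≤ M) (x z : Fin n → ℂ) :
    ∫ y, φ.cohKer h x y * φ.weylKer h α y z ∂(φ.weightMeasure h) =
      φ.kap h * φ.weylKer h α x z := by
  set u : (Fin n → ℂ) → ℝ := fun y => ‖φ.cohKer h x y‖ *
    Real.exp ((φ.weight y + φ.weight z) / h) with hu
  have hcc : Continuous fun y => φ.cohKer h x y := by
    unfold cohKer
    fun_prop
  have hcw := φ.continuous_weight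
  have hui : Integrable u (φ.weightMeasure h) := by
    rw [integrable_weightMeasure_real_iff]
    have h1 := ((φ.integrable_exp_neg_herm (c := (4 * h)⁻¹) (by positivity)).comp_sub_left x).const_mul
      (Real.exp ((φ.weight x + φ.weight z) / h))
    refine h1.congr (ae_of_all _ fun y => ?_)
    simp only [hu, norm_cohKer]
    rw [← Real.exp_add, ← Real.exp_add, ← Real.exp_add]
    congr 1
    field_simp
    ring
  have hcr : Continuous fun q : (Fin n → ℂ) × (Fin n → ℂ) => φ.reflKer h q.1 q.2 z := by
    unfold reflKer
    fun_prop
  have hint : Integrable (fun q : (Fin n → ℂ) × (Fin n → ℂ) =>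
      φ.cohKer h x q.1 * (α q.2 * φ.reflKer h q.1 q.2 z)) ((φ.weightMeasure h).prod volume) := by
    have h1 := (integrable_mul_comp_sub hui
      (φ.integrable_exp_neg_herm (c := h⁻¹) (by positivity)) (φ.measurable_exp_neg_herm _)
      (p := fun y => (1 / 2 : ℂ) • (y + z)) (by fun_prop)).const_mul M
    refine h1.mono' (Continuous.aestronglyMeasurable (by fun_prop)) (ae_of_all _ fun q => ?_)
    rw [norm_mul, norm_mul, norm_reflKer_eq]
    simp only [hu]
    calc _ ≤ ‖φ.cohKer h x q.1‖ * (M * (Real.exp ((φ.weight q.1 + φ.weight z) / h) *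
      Real.exp (-(h⁻¹ * (φ.herm (q.2 - (1 / 2 : ℂ) • (q.1 + z))
        (q.2 - (1 / 2 : ℂ) • (q.1 + z))).re)))) := by gcongr; exact hM _
      _ = _ := by ring
  simp only [weylKer, ← integral_const_mul]
  rw [integral_integral_swap hint]
  refine integral_congr_ae (ae_of_all _ fun s => ?_)
  have hi : Integrable (fun y => φ.cohKer h x y * φ.reflKer h y s z) (φ.weightMeasure h) := by
    refine hui.mono' ((hcc.mul (hcr.comp (by fun_prop :
      Continuous fun y : Fin n → ℂ => (y, s)))).aestronglyMeasurable) (ae_of_all _ fun y => ?_)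
    rw [norm_mul]
    simp only [hu]
    gcongr
    exact φ.norm_reflKer_le hh _ _ _
  have h2 := φ.integral_cohKer_mul hh (φ.differentiable_reflKer s z) hi
  simp only
  rw [show (fun y => φ.cohKer h x y * (α s * φ.reflKer h y s z)) =
    fun y => α s * (φ.cohKer h x y * φ.reflKer h y s z) from by funext; ring, integral_const_mul, h2]
  ring

/-- Insert the reproducing formula for `v` into the reflection form and exchange integrals. Fubini
is justified by the Gaussian in `s` and the integrability of $e^{-\Phi/h}v$. -/
theorem opIntegral_eq_weylKer (hh : 0 < h) (a : φ.Lambda → ℂ)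
    (hα : Continuous fun s => a (φ.lift s)) {M : ℝ} (hM : ∀ s, ‖a (φ.lift s)‖ ≤ M)
    {f : φ.L2Weight h} {v : (Fin n → ℂ) → ℂ} (hv : Differentiable ℂ v)
    (hf : f =ᵐ[φ.weightMeasure h] v)
    (hi : Integrable fun z => Real.exp (-φ.weight z / h) * ‖v z‖) (x : Fin n → ℂ) :
    (φ.kap h : ℂ) * φ.opIntegral h a v x = φ.opConst h *
      ∫ z, φ.weylKer h (fun s => a (φ.lift s)) x z * v z ∂(φ.weightMeasure h) := by
  have hcw := φ.continuous_weight
  have hrep : ∀ y, (φ.kap h : ℂ) * v y = ∫ z, φ.cohKer h y z * v z ∂(φ.weightMeasure h) := by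
    intro y
    refine (φ.integral_cohKer_mul hh hv ((φ.integrable_cohKer_mul hh y f).congr ?_)).symm
    filter_upwards [hf] with z hz
    rw [hz]
  have hui : Integrable (fun z => Real.exp ((φ.weight x + φ.weight z) / h) * ‖v z‖)
      (φ.weightMeasure h) := by
    rw [integrable_weightMeasure_real_iff]
    refine (hi.const_mul (Real.exp (φ.weight x / h))).congr (ae_of_all _ fun z => ?_)
    simp only
    rw [← mul_assoc, ← mul_assoc, ← Real.exp_add, ← Real.exp_add]
    congr 2
    ring
  have hcr : Continuous fun q : (Fin n → ℂ) × (Fin n → ℂ) => φ.reflKer h x q.2 q.1 := by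
    unfold reflKer
    fun_prop
  have hcv := hv.continuous
  have hint : Integrable (fun q : (Fin n → ℂ) × (Fin n → ℂ) =>
      a (φ.lift q.2) * φ.reflKer h x q.2 q.1 * v q.1) ((φ.weightMeasure h).prod volume) := by
    have h1 := (integrable_mul_comp_sub hui
      (φ.integrable_exp_neg_herm (c := h⁻¹) (by positivity)) (φ.measurable_exp_neg_herm _)
      (p := fun z => (1 / 2 : ℂ) • (x + z)) (by fun_prop)).const_mul M
    refine h1.mono' (Continuous.aestronglyMeasurable (((hα.comp continuous_snd).mul hcr).mul
      (hcv.comp continuous_fst))) (ae_of_all _ fun q => ?_)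
    rw [norm_mul, norm_mul, norm_reflKer_eq]
    calc _ ≤ M * (Real.exp ((φ.weight x + φ.weight q.1) / h) *
      Real.exp (-(h⁻¹ * (φ.herm (q.2 - (1 / 2 : ℂ) • (x + q.1))
        (q.2 - (1 / 2 : ℂ) • (x + q.1))).re))) * ‖v q.1‖ := by gcongr; exact hM _
      _ = _ := by ring
  rw [opIntegral_eq, mul_left_comm, ← integral_const_mul]
  congr 1
  simp only [weylKer, ← integral_mul_const]
  rw [integral_integral_swap hint]
  refine integral_congr_ae (ae_of_all _ fun s => ?_)
  simp only
  rw [mul_left_comm, hrep, ← integral_const_mul]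
  refine integral_congr_ae (ae_of_all _ fun z => ?_)
  simp only
  rw [← φ.exp_contour_mul_cohKer]
  ring

/-- The Weyl quantization on the transform side, transported to `L²(ℝⁿ)`. -/
theorem exists_transported_operator (hh : 0 < h) {T : L2Real n ≃ₗᵢ[ℂ] φ.HPhi h}
    (hT : φ.IsFBITransform h T)
    (hTc : ∀ x, (T (φ.cohLp hh x) : φ.L2Weight h) =
      ((φ.fbiScale h * φ.cohConst h : ℝ) : ℂ) • φ.kerLp hh x)
    {a : φ.Lambda → ℂ} (ha : φ.IsSymbol a) :
    ∃ Q : L2Real n →L[ℂ] L2Real n, ∀ u : L2Real n,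
      (Integrable fun z => Real.exp (-φ.weight z / h) * ‖φ.fbiIntegral h u z‖) →
        ∀ x, φ.fbiIntegral h (Q u) x = φ.opIntegral h a (φ.fbiIntegral h u) x := by
  set α : (Fin n → ℂ) → ℂ := fun s => a (φ.lift s) with hα
  have hαc : Continuous α := ha.1.continuous
  obtain ⟨M, hM⟩ := ha.2 0
  simp only [norm_iteratedFDeriv_zero] at hM
  set N := Module.finrank ℝ (Fin n → ℂ) + 1 with hN
  obtain ⟨D, hD0, hD⟩ := φ.exists_weylKer_bound hh ha N
  have hk0 : (φ.kap h : ℂ) ≠ 0 := by exact_mod_cast (φ.kap_pos hh).ne'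
  set c : ℂ := φ.opConst h / φ.kap h with hc
  obtain ⟨A, hA⟩ := φ.exists_operator_of_kernel (h := h)
    (k := fun x z => c * φ.weylKer h α x z)
    ((φ.stronglyMeasurable_weylKer hαc).const_mul c)
    (κ := fun x => ‖c‖ * (D * ((1 + ‖x‖) ^ N)⁻¹))
    (((integrable_one_add_norm_pow_inv volume (Nat.lt_succ_self _)).const_mul D).const_mul _)
    (fun x => by simp) (fun x z => by
      rw [norm_mul, mul_assoc]
      gcongr
      exact hD x z)
  set T₀ := φ.toL2Weight h T with hT₀
  have hT₀a : ∀ u, T₀ u = (T u : φ.L2Weight h) := fun u => rfl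
  -- The FBI integral of $T_0^*AT_0u$ at $x$ is a pairing of $AT_0u$ with the image of a coherent
  -- state, a multiple of the reproducing kernel at $x$; the three constants multiply to 1.
  refine ⟨ContinuousLinearMap.adjoint T₀ ∘L A ∘L T₀, fun u hu x => ?_⟩
  have hTu : T₀ u =ᵐ[φ.weightMeasure h] φ.fbiIntegral h u := hT u
  have hi := φ.opIntegral_eq_weylKer hh a hαc hM (φ.differentiable_fbiIntegral hh u) hTu hu x
  have h1 : inner ℂ (φ.kerLp hh x) (A (T₀ u)) =
      (φ.kap h : ℂ) * φ.opIntegral h a (φ.fbiIntegral h u) x := by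
    obtain ⟨hint, he⟩ := hA (φ.kerLp hh x) (T₀ u)
    rw [he, integral_prod_symm _ hint, hi, ← integral_const_mul]
    refine integral_congr_ae ?_
    filter_upwards [hTu] with z hz
    have h2 := φ.integral_cohKer_mul_weylKer hh hαc hM x z
    have h3 : ∫ y, (starRingEnd ℂ) (φ.kerLp hh x y) * (c * φ.weylKer h α y z) * T₀ u z
        ∂(φ.weightMeasure h) = ∫ y, (φ.cohKer h x y * φ.weylKer h α y z) * (c * T₀ u z)
        ∂(φ.weightMeasure h) := by
      refine integral_congr_ae ?_
      filter_upwards [(φ.memLp_cohKer hh x).coeFn_toLp] with y hy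
      rw [kerLp, hy, conj_cohKer]
      ring
    rw [h3, integral_mul_const, h2, hz, hc]
    simp only [hα]
    field_simp
  rw [fbiIntegral_eq_inner φ hh]
  simp only [ContinuousLinearMap.comp_apply]
  rw [ContinuousLinearMap.adjoint_inner_right, hT₀a (φ.cohLp hh x), hTc, inner_smul_left, h1,
    conj_ofReal]
  have := φ.fbiScale_sq_mul hh
  calc _ = ((φ.fbiScale h ^ 2 * φ.cohConst h * φ.kap h : ℝ) : ℂ) *
      φ.opIntegral h a (φ.fbiIntegral h u) x := by push_cast; ring
    _ = _ := by rw [this]; simp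

end FBIPhase

/-! ### FBI transforms of Schwartz functions. -/

theorem SchwartzMap.exists_one_add_pow_mul_norm_le {V : Type*} [NormedAddCommGroup V]
    [NormedSpace ℝ V] (g : 𝓢(V, ℂ)) (N : ℕ) :
    ∃ K : ℝ, ∀ x, (1 + ‖x‖) ^ N * ‖g x‖ ≤ K := by
  have h1 := fun x => g.one_add_le_sup_seminorm_apply (𝕜 := ℝ) (m := (N, 0)) le_rfl le_rfl x
  simp only [norm_iteratedFDeriv_zero] at h1
  exact ⟨_, h1⟩

theorem SchwartzMap.integrable_one_add_pow_mul_norm {V : Type*} [NormedAddCommGroup V]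
    [NormedSpace ℝ V] [MeasurableSpace V] [BorelSpace V] [FiniteDimensional ℝ V]
    (μ : Measure V) [μ.IsAddHaarMeasure] (g : 𝓢(V, ℂ)) (N : ℕ) :
    Integrable (fun x => (1 + ‖x‖) ^ N * ‖g x‖) μ := by
  obtain ⟨K, hK⟩ := g.exists_one_add_pow_mul_norm_le (N + (Module.finrank ℝ V + 1))
  refine ((integrable_one_add_norm_pow_inv μ (Nat.lt_succ_self _)).const_mul K).mono'
    (Continuous.aestronglyMeasurable (by fun_prop)) (ae_of_all _ fun x => ?_)
  rw [Real.norm_of_nonneg (by positivity), ← div_eq_mul_inv, le_div_iff₀ (by positivity)]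
  calc _ = (1 + ‖x‖) ^ (N + (Module.finrank ℝ V + 1)) * ‖g x‖ := by
        rw [Nat.succ_eq_add_one, pow_add]; ring
    _ ≤ K := hK x

theorem SchwartzMap.isBoundedSymbol {V : Type*} [NormedAddCommGroup V]
    [NormedSpace ℝ V] (g : 𝓢(V, ℂ)) : IsBoundedSymbol g := by
  refine ⟨g.smooth ⊤, fun k => ?_⟩
  obtain ⟨C, -, hC⟩ := g.decay 0 k
  exact ⟨C, fun x => by simpa using hC x⟩

namespace FBIPhase

variable {n : ℕ} (φ : FBIPhase n) {h : ℝ}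

theorem exists_schwartz_eq_exp_phase (hh : 0 < h) : ∃ g : 𝓢(EuclideanSpace ℝ (Fin n), ℂ),
    ∀ y, g y = cexp (I * φ.eval 0 (realToComplex y) / h) := by
  obtain ⟨c, hc, hcl⟩ := φ.exists_imC_lower_bound
  have hadd : ∀ y y' : EuclideanSpace ℝ (Fin n),
      realToComplex (y + y') = realToComplex y + realToComplex y' := fun y y' => by
    ext; simp [realToComplex]
  let Bq : EuclideanSpace ℝ (Fin n) →L[ℝ] EuclideanSpace ℝ (Fin n) →L[ℝ] ℂ :=
    LinearMap.toContinuousBilinearMap <| LinearMap.mk₂ ℝ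
      (fun y y' => φ.C *ᵥ realToComplex y ⬝ᵥ realToComplex y')
      (fun y y' w => by rw [hadd, mulVec_add, add_dotProduct])
      (fun t y w => by rw [realToComplex_smul, mulVec_smul, smul_dotProduct]; simp)
      (fun y w w' => by rw [hadd, dotProduct_add])
      (fun t y w => by rw [realToComplex_smul, dotProduct_smul]; simp)
  have h2 : (fun y : EuclideanSpace ℝ (Fin n) => I * φ.eval 0 (realToComplex y) / (h : ℂ)) =
      fun y => (I / (2 * h)) * Bq y y := by
    funext y
    have : Bq y y = φ.C *ᵥ realToComplex y ⬝ᵥ realToComplex y := rfl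
    rw [this]
    simp only [eval, mulVec_zero, zero_dotProduct]
    ring
  refine exists_schwartz_eq_exp (c := c / (2 * h)) ?_ (by positivity) fun y => ?_
  · rw [h2]
    exact (Function.HasTemperateGrowth.const _).fun_mul
      (Bq.bilinear_hasTemperateGrowth .id' .id')
  · have h3 := φ.norm_exp_phase_zero (h := h) y
    rw [norm_exp, Real.exp_eq_exp] at h3
    rw [h3, neg_div, neg_le_neg_iff, div_mul_eq_mul_div]
    gcongr
    exact hcl y

theorem integrable_exp_phase (hh : 0 < h) (x : Fin n → ℂ) :
    Integrable fun y : EuclideanSpace ℝ (Fin n) => cexp (I * φ.eval x (realToComplex y) / h) := by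
  obtain ⟨c, hc, hcl⟩ := φ.exists_imC_lower_bound
  set t : EuclideanSpace ℝ (Fin n) := WithLp.toLp 2 (φ.imC⁻¹ *ᵥ φ.imB x) with ht
  have h1 := ((integrable_exp_neg_mul_norm_sq (volume : Measure (EuclideanSpace ℝ (Fin n)))
    (c := c / (2 * h)) (by positivity)).comp_add_right t).const_mul (Real.exp (φ.weight x / h))
  refine h1.mono' (Continuous.aestronglyMeasurable (by fun_prop)) (ae_of_all _ fun y => ?_)
  rw [norm_exp_phase, ← Real.exp_add, sub_eq_add_neg]
  gcongr
  rw [div_mul_eq_mul_div]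
  gcongr
  exact hcl (y + t)

theorem exists_fbiIntegral_basePt_bound (hh : 0 < h) (u : 𝓢(EuclideanSpace ℝ (Fin n), ℂ))
    (N : ℕ) : ∃ D : ℝ, ∀ s ξ : EuclideanSpace ℝ (Fin n),
      Real.exp (-φ.weight (φ.basePt s ξ) / h) * ‖φ.fbiIntegral h u (φ.basePt s ξ)‖ ≤
        D * (((1 + ‖s‖) ^ N)⁻¹ * ((1 + ‖ξ‖) ^ N)⁻¹) := by
  obtain ⟨g, hg⟩ := φ.exists_schwartz_eq_exp_phase hh
  -- Windowed Fourier transform. For decay in $\xi$ the translated window is treated as a bounded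
  -- symbol, uniformly in `s`; decay in `s` comes from the separation of window and function.
  set F : EuclideanSpace ℝ (Fin n) → EuclideanSpace ℝ (Fin n) → ℂ := fun s ξ =>
    ∫ y, cexp (I * ((-(1 / h) * inner ℝ y ξ : ℝ) : ℂ)) * (g (-s + y) * u y) with hF
  have hnorm : ∀ s ξ, Real.exp (-φ.weight (φ.basePt s ξ) / h) *
      ‖φ.fbiIntegral h u (φ.basePt s ξ)‖ = φ.fbiScale h * ‖F s ξ‖ := by
    intro s ξ
    have e1 : ∫ y : EuclideanSpace ℝ (Fin n),
        cexp (I * φ.eval (φ.basePt s ξ) (realToComplex y) / h) * u y =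
        cexp (I * φ.eval (φ.basePt s ξ) (realToComplex s) / h) *
          cexp (I * ((1 / h * inner ℝ s ξ : ℝ) : ℂ)) * F s ξ := by
      rw [hF, ← integral_const_mul]
      refine integral_congr_ae (ae_of_all _ fun y => ?_)
      simp only [hg]
      rw [← mul_assoc, ← mul_assoc, ← Complex.exp_add, ← Complex.exp_add, ← Complex.exp_add,
        eval_basePt]
      congr 2
      have e2 : φ.eval 0 (realToComplex (-s + y)) =
          1 / 2 * (φ.C *ᵥ realToComplex (y - s) ⬝ᵥ realToComplex (y - s)) := by
        rw [neg_add_eq_sub]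
        simp [eval]
      rw [e2, inner_sub_left]
      push_cast
      ring
    have e3 : ‖cexp (I * φ.eval (φ.basePt s ξ) (realToComplex s) / h)‖ =
        Real.exp (φ.weight (φ.basePt s ξ) / h) := by
      rw [norm_exp, div_ofReal_re, I_mul_re, ← weight_basePt]
    have e4 : ‖cexp (I * ((1 / h * inner ℝ s ξ : ℝ) : ℂ))‖ = 1 := by
      rw [mul_comm, norm_exp_ofReal_mul_I]
    have e5 : φ.fbiIntegral h u (φ.basePt s ξ) = (φ.fbiScale h : ℂ) *
        ∫ y : EuclideanSpace ℝ (Fin n),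
        cexp (I * φ.eval (φ.basePt s ξ) (realToComplex y) / h) * u y := by
      rw [fbiIntegral, fbiScale, ofReal_mul]
    rw [e5, e1, norm_mul, norm_mul, norm_mul, e3, e4, norm_real,
      Real.norm_of_nonneg (φ.fbiScale_pos hh).le]
    have : Real.exp (-φ.weight (φ.basePt s ξ) / h) * Real.exp (φ.weight (φ.basePt s ξ) / h) = 1 := by
      rw [← Real.exp_add, Real.exp_eq_one_iff]; ring
    linear_combination (φ.fbiScale h * ‖F s ξ‖) * this
  -- decay in `ξ`
  let L : EuclideanSpace ℝ (Fin n) →L[ℝ] EuclideanSpace ℝ (Fin n) →L[ℝ] ℝ :=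
    (-(1 / h)) • innerSL ℝ
  have hLa : ∀ y ξ, L y ξ = -(1 / h) * inner ℝ y ξ := fun y ξ => rfl
  have hL : ∀ w, ∃ v, ‖v‖ ≤ ‖w‖ ∧ (1 / h) * ‖w‖ ^ 2 ≤ |L v w| := fun w =>
    ⟨w, le_rfl, by
      rw [hLa, real_inner_self_eq_norm_sq, abs_mul, abs_neg,
        abs_of_pos (show 0 < 1 / h by positivity), abs_of_nonneg (by positivity)]⟩
  obtain ⟨K, hK⟩ := g.isBoundedSymbol.exists_bound_comp_affine
    (ContinuousLinearMap.id ℝ (EuclideanSpace ℝ (Fin n)))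
  obtain ⟨D₁, hD₁, hξ⟩ := exists_one_add_pow_mul_norm_fourier_le volume L
    (by positivity) hL u K (2 * N)
  have hξ' : ∀ s ξ, (1 + ‖ξ‖) ^ (2 * N) * ‖F s ξ‖ ≤ D₁ := fun s ξ => by
    have := hξ _ (hK (-s)).1 (hK (-s)).2 ξ
    simp only [hLa] at this
    exact this
  -- decay in `s`
  obtain ⟨K₂, hK₂⟩ := g.exists_one_add_pow_mul_norm_le (2 * N)
  have hui := u.integrable_one_add_pow_mul_norm volume (2 * N)
  set D₂ := K₂ * ∫ y, (1 + ‖y‖) ^ (2 * N) * ‖u y‖ with hD₂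
  have hs' : ∀ s ξ, (1 + ‖s‖) ^ (2 * N) * ‖F s ξ‖ ≤ D₂ := by
    intro s ξ
    have hpow : 0 < (1 + ‖s‖) ^ (2 * N) := by positivity
    rw [← le_div_iff₀' hpow, hD₂, ← integral_const_mul, ← integral_div]
    refine norm_integral_le_of_norm_le ((hui.const_mul K₂).div_const _) (ae_of_all _ fun y => ?_)
    rw [norm_mul, mul_comm I, norm_exp_ofReal_mul_I, one_mul, norm_mul, le_div_iff₀' hpow]
    have h1 : 1 + ‖s‖ ≤ (1 + ‖-s + y‖) * (1 + ‖y‖) := by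
      have : ‖s‖ ≤ ‖-s + y‖ + ‖y‖ := by
        calc ‖s‖ = ‖-(-s + y) + y‖ := by congr 1; abel
          _ ≤ _ := (norm_add_le _ _).trans (by rw [norm_neg])
      nlinarith [norm_nonneg (-s + y), norm_nonneg y]
    calc (1 + ‖s‖) ^ (2 * N) * (‖g (-s + y)‖ * ‖u y‖)
        ≤ ((1 + ‖-s + y‖) * (1 + ‖y‖)) ^ (2 * N) * (‖g (-s + y)‖ * ‖u y‖) := by gcongr
      _ = ((1 + ‖-s + y‖) ^ (2 * N) * ‖g (-s + y)‖) * ((1 + ‖y‖) ^ (2 * N) * ‖u y‖) := by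
        rw [mul_pow]; ring
      _ ≤ K₂ * ((1 + ‖y‖) ^ (2 * N) * ‖u y‖) := by gcongr; exact hK₂ _
  -- Geometric mean of the two separate bounds, which is why each was taken at order $2N$.
  refine ⟨φ.fbiScale h * Real.sqrt (D₁ * D₂), fun s ξ => ?_⟩
  rw [hnorm, mul_assoc]
  have := (φ.fbiScale_pos hh).le
  gcongr
  rw [← mul_inv, ← div_eq_mul_inv, le_div_iff₀ (by positivity)]
  refine Real.le_sqrt_of_sq_le ?_
  have h1 := hξ' s ξ
  have h2 := hs' s ξ
  calc _ = ((1 + ‖ξ‖) ^ (2 * N) * ‖F s ξ‖) * ((1 + ‖s‖) ^ (2 * N) * ‖F s ξ‖) := by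
        rw [mul_pow, mul_pow, ← pow_mul, ← pow_mul, mul_comm N 2]; ring
    _ ≤ D₁ * D₂ := by gcongr

theorem fbiIntegral_congr {u u' : EuclideanSpace ℝ (Fin n) → ℂ} (hu : u =ᵐ[volume] u') :
    φ.fbiIntegral h u = φ.fbiIntegral h u' := by
  funext x
  rw [fbiIntegral, fbiIntegral]
  congr 1
  refine integral_congr_ae ?_
  filter_upwards [hu] with y hy
  rw [hy]

theorem continuous_fbiIntegral_schwartz (hh : 0 < h) (u : 𝓢(EuclideanSpace ℝ (Fin n), ℂ)) :
    Continuous (φ.fbiIntegral h u) := by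
  rw [← φ.fbiIntegral_congr (u.coeFn_toLp 2)]
  exact (φ.differentiable_fbiIntegral hh _).continuous

theorem integrable_fbiIntegral_schwartz (hh : 0 < h) (u : 𝓢(EuclideanSpace ℝ (Fin n), ℂ)) :
    Integrable fun z => Real.exp (-φ.weight z / h) * ‖φ.fbiIntegral h u z‖ := by
  set N := Module.finrank ℝ (EuclideanSpace ℝ (Fin n)) + 1
  obtain ⟨D, hD⟩ := φ.exists_fbiIntegral_basePt_bound hh u N
  have hcw := φ.continuous_weight
  have hcf := φ.continuous_fbiIntegral_schwartz hh u
  have hb := φ.continuous_basePt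
  have hi := integrable_one_add_norm_pow_inv (volume : Measure (EuclideanSpace ℝ (Fin n)))
    (Nat.lt_succ_self _)
  have h1 : Integrable (fun p : EuclideanSpace ℝ (Fin n) × EuclideanSpace ℝ (Fin n) =>
      ((Real.exp (-φ.weight (φ.basePt p.1 p.2) / h) *
        ‖φ.fbiIntegral h u (φ.basePt p.1 p.2)‖ : ℝ) : ℂ)) := by
    refine ((hi.mul_prod hi).const_mul D).mono' (Continuous.aestronglyMeasurable ?_)
      (ae_of_all _ fun p => ?_)
    · have hc : Continuous fun z => Real.exp (-φ.weight z / h) * ‖φ.fbiIntegral h u z‖ := by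
        fun_prop
      exact Complex.continuous_ofReal.comp (hc.comp hb)
    · rw [norm_real, Real.norm_of_nonneg (by positivity)]
      exact hD p.1 p.2
  have h2 := (φ.integrable_basePt_iff (fun z =>
    ((Real.exp (-φ.weight z / h) * ‖φ.fbiIntegral h u z‖ : ℝ) : ℂ))).mp h1
  exact h2.re.congr (ae_of_all _ fun z => by simp only [ofReal_re, RCLike.re_to_complex])

/-! ### Convergence of the real Weyl integral. -/

/-- The inner integral of the semiclassical Weyl quantization. -/
def weylInner (h : ℝ) (b : EuclideanSpace ℝ (Fin n) × EuclideanSpace ℝ (Fin n) → ℂ)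
    (u : EuclideanSpace ℝ (Fin n) → ℂ) (x ξ : EuclideanSpace ℝ (Fin n)) : ℂ :=
  ∫ y : EuclideanSpace ℝ (Fin n),
    cexp (I / h * (inner ℝ (x - y) ξ : ℝ)) * b ((1 / 2 : ℝ) • (x + y), ξ) * u y

theorem exists_weylInner_bound (hh : 0 < h)
    {b : EuclideanSpace ℝ (Fin n) × EuclideanSpace ℝ (Fin n) → ℂ} (hb : IsBoundedSymbol b)
    (u : 𝓢(EuclideanSpace ℝ (Fin n), ℂ)) (N : ℕ) :
    ∃ D : ℝ, ∀ x ξ, ‖weylInner h b u x ξ‖ ≤ D * ((1 + ‖ξ‖) ^ N)⁻¹ := by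
  let L : EuclideanSpace ℝ (Fin n) →L[ℝ] EuclideanSpace ℝ (Fin n) →L[ℝ] ℝ :=
    (-(1 / h)) • innerSL ℝ
  have hLa : ∀ y ξ, L y ξ = -(1 / h) * inner ℝ y ξ := fun y ξ => rfl
  have hL : ∀ w, ∃ v, ‖v‖ ≤ ‖w‖ ∧ (1 / h) * ‖w‖ ^ 2 ≤ |L v w| := fun w =>
    ⟨w, le_rfl, by
      rw [hLa, real_inner_self_eq_norm_sq, abs_mul, abs_neg,
        abs_of_pos (show 0 < 1 / h by positivity), abs_of_nonneg (by positivity)]⟩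
  let P : EuclideanSpace ℝ (Fin n) →L[ℝ] EuclideanSpace ℝ (Fin n) × EuclideanSpace ℝ (Fin n) :=
    ((1 / 2 : ℝ) • ContinuousLinearMap.id ℝ _).prod 0
  obtain ⟨K, hK⟩ := hb.exists_bound_comp_affine P
  obtain ⟨D, -, hD⟩ := exists_one_add_pow_mul_norm_fourier_le volume L
    (by positivity) hL u K N
  refine ⟨D, fun x ξ => ?_⟩
  have h1 := hD _ (hK ((1 / 2 : ℝ) • x, ξ)).1 (hK ((1 / 2 : ℝ) • x, ξ)).2 ξ
  have e1 : weylInner h b u x ξ = cexp (((1 / h * inner ℝ x ξ : ℝ) : ℂ) * I) *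
      ∫ y, cexp (I * (L y ξ : ℝ)) * (b (((1 / 2 : ℝ) • x, ξ) + P y) * u y) := by
    rw [weylInner, ← integral_const_mul]
    refine integral_congr_ae (ae_of_all _ fun y => ?_)
    have hP : ((1 / 2 : ℝ) • x, ξ) + P y = ((1 / 2 : ℝ) • (x + y), ξ) := by
      simp [P, smul_add]
    simp only [hLa, hP]
    rw [← mul_assoc, ← mul_assoc, ← Complex.exp_add, inner_sub_left]
    congr 3
    push_cast
    ring
  rw [e1, norm_mul, norm_exp_ofReal_mul_I, one_mul, ← div_eq_mul_inv, le_div_iff₀' (by positivity)]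
  exact h1

theorem stronglyMeasurable_weylInner
    {b : EuclideanSpace ℝ (Fin n) × EuclideanSpace ℝ (Fin n) → ℂ} (hb : Continuous b)
    {u : EuclideanSpace ℝ (Fin n) → ℂ} (hu : Continuous u) :
    StronglyMeasurable fun q : EuclideanSpace ℝ (Fin n) × EuclideanSpace ℝ (Fin n) =>
      weylInner h b u q.1 q.2 := by
  have h1 : Continuous fun p : (EuclideanSpace ℝ (Fin n) × EuclideanSpace ℝ (Fin n)) ×
      EuclideanSpace ℝ (Fin n) => cexp (I / h * (inner ℝ (p.1.1 - p.2) p.1.2 : ℝ)) *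
        b ((1 / 2 : ℝ) • (p.1.1 + p.2), p.1.2) * u p.2 := by fun_prop
  exact h1.stronglyMeasurable.integral_prod_right'

theorem weylIntegral_eq (b : EuclideanSpace ℝ (Fin n) × EuclideanSpace ℝ (Fin n) → ℂ)
    (u : EuclideanSpace ℝ (Fin n) → ℂ) (x : EuclideanSpace ℝ (Fin n)) :
    weylIntegral h b u x = (1 / (2 * Real.pi * h) ^ n : ℂ) * ∫ ξ, weylInner h b u x ξ := rfl

theorem exists_weylIntegral_bound (hh : 0 < h)
    {b : EuclideanSpace ℝ (Fin n) × EuclideanSpace ℝ (Fin n) → ℂ} (hb : IsBoundedSymbol b)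
    (u : 𝓢(EuclideanSpace ℝ (Fin n), ℂ)) : ∃ D : ℝ, ∀ x, ‖weylIntegral h b u x‖ ≤ D := by
  obtain ⟨D, hD⟩ := exists_weylInner_bound hh hb u
    (Module.finrank ℝ (EuclideanSpace ℝ (Fin n)) + 1)
  refine ⟨‖(1 / (2 * Real.pi * h) ^ n : ℂ)‖ * ∫ ξ : EuclideanSpace ℝ (Fin n),
    D * ((1 + ‖ξ‖) ^ (Module.finrank ℝ (EuclideanSpace ℝ (Fin n)) + 1))⁻¹, fun x => ?_⟩
  rw [weylIntegral_eq, norm_mul]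
  gcongr
  exact norm_integral_le_of_norm_le
    ((integrable_one_add_norm_pow_inv volume (Nat.lt_succ_self _)).const_mul D)
    (ae_of_all _ fun ξ => hD x ξ)

theorem stronglyMeasurable_weylIntegral
    {b : EuclideanSpace ℝ (Fin n) × EuclideanSpace ℝ (Fin n) → ℂ} (hb : Continuous b)
    {u : EuclideanSpace ℝ (Fin n) → ℂ} (hu : Continuous u) :
    StronglyMeasurable (weylIntegral h b u) :=
  ((stronglyMeasurable_weylInner hb hu).integral_prod_right' (ν := volume)).const_mul
    (1 / (2 * Real.pi * h) ^ n : ℂ)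

/-! ### Intertwining of the two quantizations. -/

/-- The integrand of the Weyl quantization on the transform side, as a function of the midpoint. -/
def opIntegrand (h : ℝ) (a : φ.Lambda → ℂ) (v : (Fin n → ℂ) → ℂ) (x s : Fin n → ℂ) : ℂ :=
  cexp (I / h * ((x - ((2 : ℂ) • s - x)) ⬝ᵥ φ.contourTheta x ((2 : ℂ) • s - x))) *
    a (φ.lift s) * v ((2 : ℂ) • s - x)

theorem integrable_opIntegrand {a : φ.Lambda → ℂ} (ha : φ.IsSymbol a)
    {v : (Fin n → ℂ) → ℂ} (hv : Continuous v)
    (hi : Integrable fun z => Real.exp (-φ.weight z / h) * ‖v z‖) (x : Fin n → ℂ) :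
    Integrable (φ.opIntegrand h a v x) := by
  obtain ⟨M, hM⟩ := ha.2 0
  simp only [norm_iteratedFDeriv_zero] at hM
  have hac := ha.1.continuous
  have h1 := (((hi.comp_sub_right x).comp_smul (two_ne_zero' ℝ)).const_mul
    (M * Real.exp (φ.weight x / h)))
  have h2 : ∀ s : Fin n → ℂ, (2 : ℝ) • s = (2 : ℂ) • s := fun s => by ext; simp
  simp only [h2] at h1
  have hcov := φ.continuous_weightCovector
  refine h1.mono' (Continuous.aestronglyMeasurable ?_) (ae_of_all _ fun s => ?_)
  · unfold opIntegrand
    refine Continuous.mul (Continuous.mul ?_ hac) (by fun_prop)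
    simp only [contourTheta, half_smul_add_reflect]
    exact Complex.continuous_exp.comp (continuous_const.mul
      (Continuous.dotProduct (by fun_prop) hcov))
  · rw [opIntegrand, norm_mul, norm_mul, norm_exp_contour]
    calc _ ≤ Real.exp ((φ.weight x - φ.weight ((2 : ℂ) • s - x)) / h) * M *
          ‖v ((2 : ℂ) • s - x)‖ := by gcongr; exact hM s
      _ = _ := by
        rw [sub_div, sub_eq_add_neg, Real.exp_add, neg_div]
        ring

theorem integral_comp_two_smul_sub (f : EuclideanSpace ℝ (Fin n) → ℂ)
    (y : EuclideanSpace ℝ (Fin n)) : ∫ x, f x = 2 ^ n * ∫ s, f ((2 : ℝ) • s - y) := by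
  have h1 := Measure.integral_comp_smul (volume : Measure (EuclideanSpace ℝ (Fin n)))
    (fun x => f (x - y)) 2
  rw [integral_sub_right_eq_self] at h1
  rw [h1, finrank_euclideanSpace_fin, abs_of_pos (by positivity), Complex.real_smul, ← mul_assoc]
  simp

/-- Passage to the midpoint in a double integral. -/
theorem integral_integral_midpoint {k : EuclideanSpace ℝ (Fin n) → EuclideanSpace ℝ (Fin n) → ℂ}
    (hkc : Continuous fun q : EuclideanSpace ℝ (Fin n) × EuclideanSpace ℝ (Fin n) => k q.1 q.2)
    {e u : EuclideanSpace ℝ (Fin n) → ℂ} (he : Integrable e) (hec : Continuous e)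
    (hu : Integrable u) {M : ℝ} (hkn : ∀ x y, ‖k x y‖ ≤ M * (‖e x‖ * ‖u y‖)) :
    ∫ x, ∫ y, k x y = 2 ^ n * ∫ s, ∫ y, k ((2 : ℝ) • s - y) y := by
  have hi1 : Integrable (Function.uncurry k) (volume.prod volume) := by
    refine ((he.norm.mul_prod hu.norm).const_mul M).mono' hkc.aestronglyMeasurable
      (ae_of_all _ fun q => hkn q.1 q.2)
  have hi2 : Integrable (Function.uncurry fun y s => k ((2 : ℝ) • s - y) y)
      (volume.prod volume) := by
    have h1 := (integrable_mul_comp_sub (ν := volume) (μ := volume) hu.norm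
      (he.norm.comp_smul (two_ne_zero' ℝ)) (Continuous.measurable (by fun_prop))
      (p := fun y : EuclideanSpace ℝ (Fin n) => (1 / 2 : ℝ) • y) (by fun_prop)).const_mul M
    have hc : Continuous fun q : EuclideanSpace ℝ (Fin n) × EuclideanSpace ℝ (Fin n) =>
        ((2 : ℝ) • q.2 - q.1, q.1) := by fun_prop
    refine h1.mono' (hkc.comp hc).aestronglyMeasurable (ae_of_all _ fun q => ?_)
    refine (hkn _ _).trans (le_of_eq ?_)
    have : (2 : ℝ) • (q.2 - (1 / 2 : ℝ) • q.1) = (2 : ℝ) • q.2 - q.1 := by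
      rw [smul_sub, smul_smul]; norm_num
    rw [this]
    ring
  rw [integral_integral_swap hi1]
  have h2 : ∀ y, ∫ x, k x y = 2 ^ n * ∫ s, k ((2 : ℝ) • s - y) y := fun y =>
    integral_comp_two_smul_sub (fun x => k x y) y
  simp only [h2]
  rw [integral_const_mul, integral_integral_swap hi2]

theorem weyl_phase_eq (z : Fin n → ℂ) (s ξ y : EuclideanSpace ℝ (Fin n)) :
    cexp (I * φ.eval z (realToComplex ((2 : ℝ) • s - y)) / h) *
      cexp (I / h * (inner ℝ ((2 : ℝ) • s - y - y) ξ : ℝ)) =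
    cexp (I / h * ((z - ((2 : ℂ) • φ.basePt s ξ - z)) ⬝ᵥ
      φ.contourTheta z ((2 : ℂ) • φ.basePt s ξ - z))) *
        cexp (I * φ.eval ((2 : ℂ) • φ.basePt s ξ - z) (realToComplex y) / h) := by
  have hin : (inner ℝ ((2 : ℝ) • s - y - y) ξ : ℝ) = 2 * inner ℝ (s - y) ξ := by
    rw [show (2 : ℝ) • s - y - y = (2 : ℝ) • (s - y) by rw [smul_sub, two_smul ℝ y]; abel,
      real_inner_smul_left]
  rw [← Complex.exp_add, ← Complex.exp_add, hin]
  congr 1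
  push_cast
  linear_combination (-(I / h)) * φ.contour_phase_add_eval z s ξ y

/-- With $\xi$ frozen the integral over $(x,y)$ converges absolutely, so one may pass to the
midpoint `s`; `weyl_phase_eq` then recognizes the `y`-integral as an FBI integral at the reflected
point. -/
theorem integral_exp_phase_mul_weylInner (hh : 0 < h) {a : φ.Lambda → ℂ}
    (hb : IsBoundedSymbol (a ∘ φ.kappaT)) (u : 𝓢(EuclideanSpace ℝ (Fin n), ℂ))
    (z : Fin n → ℂ) (ξ : EuclideanSpace ℝ (Fin n)) :
    φ.fbiScale h * ∫ x, cexp (I * φ.eval z (realToComplex x) / h) *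
        weylInner h (a ∘ φ.kappaT) u x ξ =
      2 ^ n * ∫ s, φ.opIntegrand h a (φ.fbiIntegral h u) z (φ.basePt s ξ) := by
  have hbv : ∀ s y : EuclideanSpace ℝ (Fin n), (a ∘ φ.kappaT) ((1 / 2 : ℝ) • ((2 : ℝ) • s - y + y), ξ) =
      a (φ.lift (φ.basePt s ξ)) := fun s y => by
    rw [sub_add_cancel, smul_smul, Function.comp_apply, kappaT_eq_lift]
    norm_num
  obtain ⟨M, hM⟩ := hb.2 0
  simp only [norm_iteratedFDeriv_zero] at hM
  have hbc := hb.1.continuous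
  generalize a ∘ φ.kappaT = b at hbv hM hbc
  have huc := u.continuous
  have h1 : ∫ x, cexp (I * φ.eval z (realToComplex x) / h) * weylInner h b u x ξ =
      ∫ x, ∫ y : EuclideanSpace ℝ (Fin n), cexp (I * φ.eval z (realToComplex x) / h) *
        (cexp (I / h * (inner ℝ (x - y) ξ : ℝ)) * b ((1 / 2 : ℝ) • (x + y), ξ) * u y) := by
    simp only [weylInner, integral_const_mul]
  rw [h1, integral_integral_midpoint (by fun_prop) (φ.integrable_exp_phase hh z) (by fun_prop)
    u.integrable (M := M), mul_left_comm, ← integral_const_mul]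
  · congr 1
    refine integral_congr_ae (ae_of_all _ fun s => ?_)
    simp only [hbv]
    rw [opIntegrand, fbiIntegral, ← ofReal_mul, ← fbiScale, mul_left_comm]
    congr 1
    rw [← integral_const_mul]
    refine integral_congr_ae (ae_of_all _ fun y => ?_)
    simp only
    linear_combination (a (φ.lift (φ.basePt s ξ)) * u y) * φ.weyl_phase_eq (h := h) z s ξ y
  · intro x y
    have h2 : ‖cexp (I / h * (inner ℝ (x - y) ξ : ℝ))‖ = 1 := by
      have : I / h * (inner ℝ (x - y) ξ : ℝ) = ((inner ℝ (x - y) ξ / h : ℝ) : ℂ) * I := by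
        push_cast; ring
      rw [this, norm_exp_ofReal_mul_I]
    rw [norm_mul, norm_mul, norm_mul, h2, one_mul, mul_left_comm]
    gcongr
    exact hM _

/-- Absolute convergence in $(x,y,\xi)$ jointly is never used. The exchange of $x$ and $\xi$ uses
the decay of the inner integral in $\xi$, and the final integral over $(s,\xi)$ uses integrability
of `opIntegrand`, transported by `basePt`. -/
theorem fbiIntegral_weylIntegral (hh : 0 < h) {a : φ.Lambda → ℂ} (ha : φ.IsSymbol a)
    (hb : IsBoundedSymbol (a ∘ φ.kappaT)) (u : 𝓢(EuclideanSpace ℝ (Fin n), ℂ))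
    (z : Fin n → ℂ) :
    φ.fbiIntegral h (weylIntegral h (a ∘ φ.kappaT) u) z =
      φ.opIntegral h a (φ.fbiIntegral h u) z := by
  set b := a ∘ φ.kappaT with hbdef
  have he := φ.integrable_exp_phase hh z
  have hG := φ.integrable_opIntegrand ha (φ.continuous_fbiIntegral_schwartz hh u)
    (φ.integrable_fbiIntegral_schwartz hh u) z
  have hGb := (φ.integrable_basePt_iff _).mpr hG
  have hint : Integrable (fun q : EuclideanSpace ℝ (Fin n) × EuclideanSpace ℝ (Fin n) =>
      cexp (I * φ.eval z (realToComplex q.1) / h) * weylInner h b u q.1 q.2)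
      (volume.prod volume) := by
    obtain ⟨D, hD⟩ := exists_weylInner_bound hh hb u
      (Module.finrank ℝ (EuclideanSpace ℝ (Fin n)) + 1)
    refine (he.norm.mul_prod ((integrable_one_add_norm_pow_inv
      (volume : Measure (EuclideanSpace ℝ (Fin n))) (Nat.lt_succ_self _)).const_mul D)).mono'
      ((Continuous.aestronglyMeasurable (by fun_prop)).mul
        (stronglyMeasurable_weylInner hb.1.continuous u.continuous).aestronglyMeasurable)
      (ae_of_all _ fun q => ?_)
    rw [norm_mul]
    gcongr
    exact hD _ _
  have h1 : φ.fbiIntegral h (weylIntegral h b u) z = (1 / (2 * Real.pi * h) ^ n : ℂ) *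
      (φ.fbiScale h * ∫ x, ∫ ξ, cexp (I * φ.eval z (realToComplex x) / h) *
        weylInner h b u x ξ) := by
    rw [fbiIntegral, ← ofReal_mul, ← fbiScale, mul_left_comm]
    congr 1
    rw [← integral_const_mul]
    refine integral_congr_ae (ae_of_all _ fun x => ?_)
    simp only
    rw [weylIntegral_eq, integral_const_mul]
    ring
  rw [h1, integral_integral_swap hint, ← integral_const_mul]
  simp only [hbdef, φ.integral_exp_phase_mul_weylInner hh hb u z]
  rw [integral_const_mul, ← integral_prod_symm (fun p : EuclideanSpace ℝ (Fin n) ×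
    EuclideanSpace ℝ (Fin n) => φ.opIntegrand h a (φ.fbiIntegral h u) z (φ.basePt p.1 p.2)) hGb,
    ← Measure.volume_eq_prod, φ.integral_basePt, opIntegral_eq, opConst]
  simp only [opIntegrand]
  push_cast
  have h4 : (4 : ℂ) ^ n = 2 ^ n * 2 ^ n := by rw [← mul_pow]; norm_num
  rw [h4]
  field_simp

/-! ### Symbols, uniqueness and identification of the operators. -/

/-- In the base coordinate $\kappa_T$ is the real linear map `basePt`, and bounded symbols are
stable under linear substitution. -/
theorem isBoundedSymbol_comp_kappaT {a : φ.Lambda → ℂ} (ha : φ.IsSymbol a) :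
    IsBoundedSymbol (a ∘ φ.kappaT) := by
  have hadd : ∀ y y' : EuclideanSpace ℝ (Fin n),
      realToComplex (y + y') = realToComplex y + realToComplex y' := fun y y' => by
    ext; simp [realToComplex]
  let P : EuclideanSpace ℝ (Fin n) × EuclideanSpace ℝ (Fin n) →ₗ[ℝ] (Fin n → ℂ) :=
    { toFun := fun p => φ.basePt p.1 p.2
      map_add' := fun p q => by
        simp only [basePt_eq, Prod.fst_add, Prod.snd_add, hadd, mulVec_add]
        abel
      map_smul' := fun c p => by
        have h2 : ∀ s : Fin n → ℂ, c • s = (c : ℂ) • s := fun s => by ext; simp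
        simp only [basePt_eq, Prod.smul_fst, Prod.smul_snd, realToComplex_smul, mulVec_smul,
          mulVec_add, RingHom.id_apply, h2, smul_neg, smul_add] }
  obtain ⟨K, hK⟩ := ha.exists_bound_comp_affine P.toContinuousLinearMap
  have he : a ∘ φ.kappaT = fun p => a (φ.lift (0 + P.toContinuousLinearMap p)) := by
    funext p
    rw [zero_add, Function.comp_apply, show p = (p.1, p.2) from rfl, kappaT_eq_lift]
    rfl
  rw [he]
  exact ⟨(hK 0).1, fun k => ⟨K k, (hK 0).2 k⟩⟩

/-- Here `w` is only assumed bounded because a Weyl integral is not known in advance to lie in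
$L^2$; the Gaussian phase still makes its FBI integral converge. -/
theorem ae_eq_of_fbiIntegral_eq (hh : 0 < h) {w : EuclideanSpace ℝ (Fin n) → ℂ}
    (hwm : AEStronglyMeasurable w) {D : ℝ} (hw : ∀ x, ‖w x‖ ≤ D) (q : L2Real n)
    (heq : ∀ x, φ.fbiIntegral h q x = φ.fbiIntegral h w x) : q =ᵐ[volume] w := by
  have hiq : ∀ x, Integrable fun y => cexp (I * φ.eval x (realToComplex y) / h) * q y :=
    fun x => ((φ.memLp_coh hh x).star.integrable_mul (Lp.memLp q)).congr
      (ae_of_all _ fun y => by simp [coh])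
  have hiw : ∀ x, Integrable fun y => cexp (I * φ.eval x (realToComplex y) / h) * w y :=
    fun x => (φ.integrable_exp_phase hh x).mul_bdd hwm (ae_of_all _ hw)
  have h0 := φ.ae_eq_zero_of_integral_exp_phase_eq_zero hh (d := fun y => q y - w y)
    (((hiq 0).sub (hiw 0)).congr (ae_of_all _ fun y => by simp [mul_sub])) fun x => by
      simp only [mul_sub]
      rw [integral_sub (hiq x) (hiw x), sub_eq_zero]
      have hs : (φ.fbiScale h : ℂ) ≠ 0 := by exact_mod_cast (φ.fbiScale_pos hh).ne'
      have h1 := heq x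
      rw [fbiIntegral, fbiIntegral, ← ofReal_mul, ← fbiScale] at h1
      exact mul_left_cancel₀ hs h1
  filter_upwards [h0] with y hy
  exact sub_eq_zero.mp hy

/-- Makes the reproducing kernels admissible test functions, so that the defining formula determines
the Weyl operator on a dense span. -/
theorem isRapidlyDecreasing_cohKer (hh : 0 < h) (x : Fin n → ℂ) :
    φ.IsRapidlyDecreasing h fun z => φ.cohKer h z x := by
  refine ⟨φ.differentiable_cohKer x, fun N => ?_⟩
  obtain ⟨c, hc, hcl⟩ := φ.exists_herm_lower_bound
  obtain ⟨K, hK0, hK⟩ := exists_one_add_pow_mul_exp_le N (c := c / (4 * h)) (by positivity)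
  refine ⟨(1 + ‖x‖) ^ N * K * Real.exp (φ.weight x / h), fun z => ?_⟩
  have h1 : 1 + ‖z‖ ≤ (1 + ‖x‖) * (1 + ‖z - x‖) := by
    have : ‖z‖ ≤ ‖z - x‖ + ‖x‖ := by simpa using norm_add_le (z - x) x
    nlinarith [norm_nonneg x, norm_nonneg (z - x)]
  have h2 : ‖φ.cohKer h z x‖ ≤ Real.exp (φ.weight z / h) * Real.exp (φ.weight x / h) *
      Real.exp (-(c / (4 * h) * ‖z - x‖ ^ 2)) := by
    rw [norm_cohKer, ← Real.exp_add, ← Real.exp_add, Real.exp_le_exp, add_div, sub_eq_add_neg]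
    gcongr
    rw [div_mul_eq_mul_div]
    gcongr
    exact hcl _
  calc (1 + ‖z‖) ^ N * ‖φ.cohKer h z x‖
      ≤ ((1 + ‖x‖) * (1 + ‖z - x‖)) ^ N * (Real.exp (φ.weight z / h) *
        Real.exp (φ.weight x / h) * Real.exp (-(c / (4 * h) * ‖z - x‖ ^ 2))) := by gcongr
    _ = (1 + ‖x‖) ^ N * ((1 + ‖z - x‖) ^ N * Real.exp (-(c / (4 * h) * ‖z - x‖ ^ 2))) *
        Real.exp (φ.weight x / h) * Real.exp (φ.weight z / h) := by rw [mul_pow]; ring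
    _ ≤ (1 + ‖x‖) ^ N * K * Real.exp (φ.weight x / h) * Real.exp (φ.weight z / h) := by
        gcongr
        exact hK _ (norm_nonneg _)

theorem IsRapidlyDecreasing.integrable {v : (Fin n → ℂ) → ℂ}
    (hv : φ.IsRapidlyDecreasing h v) :
    Integrable fun z => Real.exp (-φ.weight z / h) * ‖v z‖ := by
  obtain ⟨K, hK⟩ := hv.2 (Module.finrank ℝ (Fin n → ℂ) + 1)
  have hcw := φ.continuous_weight
  have hcv := hv.1.continuous
  refine ((integrable_one_add_norm_pow_inv volume (Nat.lt_succ_self _)).const_mul K).mono'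
    (Continuous.aestronglyMeasurable (by fun_prop)) (ae_of_all _ fun z => ?_)
  rw [Real.norm_of_nonneg (by positivity), ← div_eq_mul_inv, le_div_iff₀' (by positivity)]
  calc _ = Real.exp (-φ.weight z / h) *
        ((1 + ‖z‖) ^ (Module.finrank ℝ (Fin n → ℂ) + 1) * ‖v z‖) := by
          rw [Nat.succ_eq_add_one]; ring
    _ ≤ Real.exp (-φ.weight z / h) * (K * Real.exp (φ.weight z / h)) :=
        mul_le_mul_of_nonneg_left (hK z) (Real.exp_pos _).le
    _ = K := by
      rw [mul_left_comm, ← Real.exp_add, neg_div, neg_add_cancel, Real.exp_zero, mul_one]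

theorem isWeylOp_unique (hh : 0 < h) {T : L2Real n ≃ₗᵢ[ℂ] φ.HPhi h}
    (hTc : ∀ x, (T (φ.cohLp hh x) : φ.L2Weight h) =
      ((φ.fbiScale h * φ.cohConst h : ℝ) : ℂ) • φ.kerLp hh x)
    {a : φ.Lambda → ℂ} {A A' : φ.HPhi h →L[ℂ] φ.HPhi h} (hA : φ.IsWeylOp h a A)
    (hA' : φ.IsWeylOp h a A') : A = A' := by
  set c : ℂ := ((φ.fbiScale h * φ.cohConst h : ℝ) : ℂ) with hc
  have hc0 : c ≠ 0 := by
    rw [hc]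
    exact_mod_cast (mul_pos (φ.fbiScale_pos hh) (φ.cohConst_pos hh)).ne'
  have h1 : ∀ x, A (T (φ.cohLp hh x)) = A' (T (φ.cohLp hh x)) := by
    intro x
    set f : φ.HPhi h := c⁻¹ • T (φ.cohLp hh x) with hf
    have hfk : (f : φ.L2Weight h) = φ.kerLp hh x := by
      rw [hf, Submodule.coe_smul, hTc, smul_smul, inv_mul_cancel₀ hc0, one_smul]
    have hfa : (f : φ.L2Weight h) =ᵐ[φ.weightMeasure h] fun z => φ.cohKer h z x := by
      rw [hfk]
      exact (φ.memLp_cohKer hh x).coeFn_toLp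
    have h2 : A f = A' f := Subtype.ext <| Lp.ext <|
      (hA f _ (φ.isRapidlyDecreasing_cohKer hh x) hfa).trans
        (hA' f _ (φ.isRapidlyDecreasing_cohKer hh x) hfa).symm
    have h3 : T (φ.cohLp hh x) = c • f := by
      rw [hf, smul_smul, mul_inv_cancel₀ hc0, one_smul]
    rw [h3, A.map_smul c f, A'.map_smul c f, h2]
  have hd := denseRange_linearCombination (φ.eq_zero_of_inner_cohLp hh)
  have h4 : (fun u : L2Real n => A (T u)) = fun u => A' (T u) := by
    refine hd.equalizer (by fun_prop) (by fun_prop) ?_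
    funext l
    simp only [Function.comp_apply, Finsupp.linearCombination_apply, Finsupp.sum, map_sum, map_smul,
      h1]
  ext1 f
  simpa using congrFun h4 (T.symm f)

theorem isRealWeylOp_unique {b : EuclideanSpace ℝ (Fin n) × EuclideanSpace ℝ (Fin n) → ℂ}
    {Q Q' : L2Real n →L[ℂ] L2Real n} (hQ : IsRealWeylOp h b Q) (hQ' : IsRealWeylOp h b Q') :
    Q = Q' := by
  have hd := SchwartzMap.denseRange_toLpCLM (E := EuclideanSpace ℝ (Fin n)) (F := ℂ) (p := 2)
    (by simp) (μ := volume)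
  have h4 : (Q : L2Real n → L2Real n) = Q' := by
    refine hd.equalizer Q.continuous Q'.continuous ?_
    funext u
    exact Lp.ext ((hQ u).trans (hQ' u).symm)
  exact DFunLike.coe_injective h4

theorem adjoint_toL2Weight_comp (T : L2Real n ≃ₗᵢ[ℂ] φ.HPhi h) (q : L2Real n) :
    φ.fbiAdjoint h T (T q) = q := by
  refine ext_inner_left ℂ fun w => ?_
  change inner ℂ w (ContinuousLinearMap.adjoint (φ.toL2Weight h T) (T q : φ.L2Weight h)) = _
  rw [ContinuousLinearMap.adjoint_inner_right]
  exact T.inner_map_map w q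

/-- $Qu$ and the Weyl integral of $u$ have the same FBI integral. Thus $L^2$ boundedness of the real
Weyl quantization is inherited from the transform side. -/
theorem isRealWeylOp_of_fbiIntegral_eq (hh : 0 < h) {a : φ.Lambda → ℂ} (ha : φ.IsSymbol a)
    {Q : L2Real n →L[ℂ] L2Real n} (hQ : ∀ u : L2Real n,
      (Integrable fun z => Real.exp (-φ.weight z / h) * ‖φ.fbiIntegral h u z‖) →
        ∀ x, φ.fbiIntegral h (Q u) x = φ.opIntegral h a (φ.fbiIntegral h u) x) :
    IsRealWeylOp h (a ∘ φ.kappaT) Q := by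
  intro u
  have hb := φ.isBoundedSymbol_comp_kappaT ha
  obtain ⟨D, hD⟩ := exists_weylIntegral_bound hh hb u
  have hu := φ.fbiIntegral_congr (h := h) (u.coeFn_toLp 2)
  refine φ.ae_eq_of_fbiIntegral_eq hh
    (stronglyMeasurable_weylIntegral hb.1.continuous u.continuous).aestronglyMeasurable hD _
    fun x => ?_
  rw [φ.fbiIntegral_weylIntegral hh ha hb u, hQ, hu]
  rw [hu]
  exact φ.integrable_fbiIntegral_schwartz hh u

theorem isWeylOp_of_fbiIntegral_eq (hh : 0 < h) {T : L2Real n ≃ₗᵢ[ℂ] φ.HPhi h}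
    (hT : φ.IsFBITransform h T) {a : φ.Lambda → ℂ}
    {Q : L2Real n →L[ℂ] L2Real n} (hQ : ∀ u : L2Real n,
      (Integrable fun z => Real.exp (-φ.weight z / h) * ‖φ.fbiIntegral h u z‖) →
        ∀ x, φ.fbiIntegral h (Q u) x = φ.opIntegral h a (φ.fbiIntegral h u) x) :
    φ.IsWeylOp h a ((T.toContinuousLinearEquiv : L2Real n →L[ℂ] φ.HPhi h) ∘L Q ∘L
      (T.symm.toContinuousLinearEquiv : φ.HPhi h →L[ℂ] L2Real n)) := by
  intro f v hv hf
  set u : L2Real n := T.symm f with hu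
  have hTu : T u = f := by simp [hu]
  have h1 : φ.fbiIntegral h u = v := by
    have h2 : φ.fbiIntegral h u =ᵐ[φ.weightMeasure h] v := by
      refine (hT u).symm.trans ?_
      rw [hTu]
      exact hf
    -- The weighted measure charges every nonempty open set, so continuous representatives that
    -- agree almost everywhere agree everywhere.
    exact (Continuous.ae_eq_iff_eq _ (φ.differentiable_fbiIntegral hh u).continuous
      hv.1.continuous).mp h2
  have h3 : φ.fbiIntegral h (Q u) = φ.opIntegral h a v := by
    funext x
    rw [hQ u (by rw [h1]; exact hv.integrable), h1]
  rw [← h3]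
  exact hT (Q u)

end FBIPhase

end

theorem theorem1p4p2 {n : ℕ} (φ : FBIPhase n) (h : ℝ) (h_pos : 0 < h) (h_le : h ≤ 1) :
    ∃ T : L2Real n ≃ₗᵢ[ℂ] φ.HPhi h, φ.IsFBITransform h T ∧
      ∀ a : φ.Lambda → ℂ, φ.IsSymbol a →
        IsBoundedSymbol (a ∘ φ.kappaT) ∧
        (∃! A : φ.HPhi h →L[ℂ] φ.HPhi h, φ.IsWeylOp h a A) ∧
        (∃! Q : L2Real n →L[ℂ] L2Real n, IsRealWeylOp h (a ∘ φ.kappaT) Q) ∧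
        ∀ (A : φ.HPhi h →L[ℂ] φ.HPhi h) (Q : L2Real n →L[ℂ] L2Real n),
          φ.IsWeylOp h a A → IsRealWeylOp h (a ∘ φ.kappaT) Q →
            φ.fbiAdjoint h T ∘L A ∘L (T.toContinuousLinearEquiv : L2Real n →L[ℂ] φ.HPhi h) = Q := by
  obtain ⟨T, hT, hTc⟩ := φ.exists_isFBITransform h_pos
  refine ⟨T, hT, fun a ha => ?_⟩
  obtain ⟨Q₀, hQ₀⟩ := φ.exists_transported_operator h_pos hT hTc ha
  have hA := φ.isWeylOp_of_fbiIntegral_eq h_pos hT hQ₀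
  have hQ := φ.isRealWeylOp_of_fbiIntegral_eq h_pos ha hQ₀
  refine ⟨φ.isBoundedSymbol_comp_kappaT ha,
    ⟨_, hA, fun A hA' => φ.isWeylOp_unique h_pos hTc hA' hA⟩,
    ⟨_, hQ, fun Q hQ' => FBIPhase.isRealWeylOp_unique hQ' hQ⟩, fun A Q hA' hQ' => ?_⟩
  -- By uniqueness the operators are $TQ_0T^{-1}$ and $Q_0$, and the claim reduces to $T^*T=1$.
  rw [φ.isWeylOp_unique h_pos hTc hA' hA, FBIPhase.isRealWeylOp_unique hQ' hQ]
  ext1 u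
  simp [φ.adjoint_toL2Weight_comp T (Q₀ u)]
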